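/- Let $K$ be a number field, let $S=\{p_1,\dots,p_r\}$ be a non-empty finite set of primes (finite or archimedean places) of $K$ such that $S\setminus\{p_1\}$ contains all archimedean primes of $K$ (so $p_1$ is a finite prime), and let $n\ge 4$. A degree-$n$ extension $F/K$ is said to have group $A_n$ if the Galois group of its Galois closure, acting on the $n$ conjugates of $F$ (the $n$ $K$-embeddings of $F$ into the Galois closure), is identified with the alternating group $A_n\le S_n$ by a suitable numbering of these conjugates. Then: (1) There are infinitely many pairwise non-$K$-isomorphic degree-$n$ extensions $F_1/K$ with group $A_n$ such that, for a suitable such identification and for every prime $P$ of the Galois closure of $F_1/K$ above $p_1$, the decomposition group at $P$ is conjugate in $A_n$ to the Klein four-group $\langle (1,2)(3,4),(1,3)(2,4)\rangle$ and the inertia group at $P$ is conjugate, by the same element of $A_n$, to $\langle(1,2)(3,4)\rangle$; and such that $p_2,\dots,p_r$ all split completely in $F_1/K$. (2) There are infinitely many pairwise non-$K$-isomorphic degree-$n$ extensions $F_2/K$ with group $A_n$ in which $p_1,p_2,\dots,p_r$ all split completely. Here a place of $K$ splits completely in $F$ if there are exactly $[F:K]$ places of $F$ above it. -/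

import Mathlib

open NumberField Module
open scoped Pointwise

namespace AnLocal

/-- The primes (places) of a number field `K`: the maximal ideals of its ring of integers
(finite primes) together with its archimedean places. -/
abbrev Place (K : Type*) [Field K] [NumberField K] : Type _ :=
  IsDedekindDomain.HeightOneSpectrum (𝓞 K) ⊕ InfinitePlace K

/-- A finite prime of `K`, viewed as a place. -/
abbrev finitePlace {K : Type*} [Field K] [NumberField K]
    (p : IsDedekindDomain.HeightOneSpectrum (𝓞 K)) : Place K := Sum.inl p

/-- An archimedean place of `K`, viewed as a place. -/
abbrev archPlace {K : Type*} [Field K] [NumberField K]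
    (v : InfinitePlace K) : Place K := Sum.inr v

/-- A place of `K` splits completely in the finite extension `F/K` when there are exactly
`[F : K]` places of `F` above it. -/
def SplitsCompletely {K : Type*} [Field K] [NumberField K]
    (F : Type*) [Field F] [Algebra K F] : Place K → Prop
  | Sum.inl p => (p.asIdeal.primesOver (𝓞 F)).ncard = finrank K F
  | Sum.inr v => {w : InfinitePlace F | w.comap (algebraMap K F) = v}.ncard = finrank K F

/-- The Galois closure of `F/K` inside the fixed algebraic closure of `K`. -/
noncomputable abbrev galoisClosure {K : Type*} [Field K]
    (F : IntermediateField K (AlgebraicClosure K)) : IntermediateField K (AlgebraicClosure K) :=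
  IntermediateField.normalClosure K F (AlgebraicClosure K)

/-- The action of `Gal(L/K)` by composition on the set of `K`-embeddings of `F` into `L`; when
`L` is the Galois closure of `F/K`, this is the usual permutation action on the conjugates
of a primitive element of `F/K`. -/
def embeddingPerm (K F L : Type*) [Field K] [Field F] [Field L] [Algebra K F] [Algebra K L] :
    Gal(L/K) →* Equiv.Perm (F →ₐ[K] L) where
  toFun σ :=
    { toFun := fun φ => (σ : L →ₐ[K] L).comp φ
      invFun := fun φ => (σ.symm : L →ₐ[K] L).comp φ
      left_inv := fun φ => by ext x; simp
      right_inv := fun φ => by ext x; simp }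
  map_one' := by ext; rfl
  map_mul' _ _ := by ext; rfl

/-- `embeddingPerm`, after numbering the `n` embeddings of `F` into `L`. -/
def permRep {K F L : Type*} [Field K] [Field F] [Field L] [Algebra K F] [Algebra K L] {n : ℕ}
    (e : (F →ₐ[K] L) ≃ Fin n) : Gal(L/K) →* Equiv.Perm (Fin n) :=
  e.permCongrHom.toMonoidHom.comp (embeddingPerm K F L)

/-- The numbering `e` of the conjugates of `F` identifies the Galois group of the Galois closure of
`F/K` with the alternating group `A_n` (this permutation action is always faithful). -/
def IdentifiesWithAn {K : Type*} [Field K] {F : IntermediateField K (AlgebraicClosure K)} {n : ℕ}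
    (e : (F →ₐ[K] galoisClosure F) ≃ Fin n) : Prop :=
  (permRep e).range = alternatingGroup (Fin n)

/-- `F/K` is a degree-`n` extension with group `A_n`. -/
def IsAnExtension {K : Type*} [Field K] (n : ℕ)
    (F : IntermediateField K (AlgebraicClosure K)) : Prop :=
  finrank K F = n ∧ ∃ e : (F →ₐ[K] galoisClosure F) ≃ Fin n, IdentifiesWithAn e

/-- The `i`-th of the first four points of `{0, …, n - 1}`. -/
abbrev pt {n : ℕ} (hn : 4 ≤ n) (i : Fin 4) : Fin n := Fin.castLE hn i

/-- The double transposition `(1 2)(3 4)`. -/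
def dblTransp₁ {n : ℕ} (hn : 4 ≤ n) : Equiv.Perm (Fin n) :=
  Equiv.swap (pt hn 0) (pt hn 1) * Equiv.swap (pt hn 2) (pt hn 3)

/-- The double transposition `(1 3)(2 4)`. -/
def dblTransp₂ {n : ℕ} (hn : 4 ≤ n) : Equiv.Perm (Fin n) :=
  Equiv.swap (pt hn 0) (pt hn 2) * Equiv.swap (pt hn 1) (pt hn 3)

/-- The Klein four-group `⟨(1 2)(3 4), (1 3)(2 4)⟩` in `S_n`. -/
def klein {n : ℕ} (hn : 4 ≤ n) : Subgroup (Equiv.Perm (Fin n)) :=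
  Subgroup.closure {dblTransp₁ hn, dblTransp₂ hn}

/-- The subgroup `⟨(1 2)(3 4)⟩` of `S_n`. -/
def kleinInertia {n : ℕ} (hn : 4 ≤ n) : Subgroup (Equiv.Perm (Fin n)) :=
  Subgroup.zpowers (dblTransp₁ hn)

/-- Decomposition group in `Gal(L/K)` of a prime ideal `P` of the ring of integers of `L`. -/
def decompositionGroup (K : Type*) {L : Type*} [Field K] [Field L] [Algebra K L]
    (P : Ideal (𝓞 L)) : Subgroup Gal(L/K) :=
  MulAction.stabilizer Gal(L/K) P

/-- Inertia group in `Gal(L/K)` of a prime ideal `P` of the ring of integers of `L`: the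
automorphisms `σ` such that `σ x - x ∈ P` for all integers `x` of `L`. -/
def inertiaGroup (K : Type*) {L : Type*} [Field K] [Field L] [Algebra K L]
    (P : Ideal (𝓞 L)) : Subgroup Gal(L/K) :=
  P.inertia Gal(L/K)

/-- `F/K` is a degree-`n` extension with group `A_n` such that, for every prime `P` above `p` in the
Galois closure, the decomposition group at `P` is conjugate in `A_n` to
`⟨(1 2)(3 4), (1 3)(2 4)⟩`, and the inertia group at `P` is conjugate, by the same element, to
`⟨(1 2)(3 4)⟩`. -/
def IsAnExtensionWithKleinAt {K : Type*} [Field K] [NumberField K] {n : ℕ} (hn : 4 ≤ n)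
    (p : IsDedekindDomain.HeightOneSpectrum (𝓞 K))
    (F : IntermediateField K (AlgebraicClosure K)) : Prop :=
  finrank K F = n ∧ ∃ e : (F →ₐ[K] galoisClosure F) ≃ Fin n, IdentifiesWithAn e ∧
    ∀ P : Ideal (𝓞 (galoisClosure F)), P.IsPrime → P.LiesOver p.asIdeal →
      ∃ τ ∈ alternatingGroup (Fin n),
        (decompositionGroup K P).map (permRep e) = (klein hn).map (MulAut.conj τ).toMonoidHom ∧
        (inertiaGroup K P).map (permRep e) = (kleinInertia hn).map (MulAut.conj τ).toMonoidHom

/-- Infinitely many pairwise non-`K`-isomorphic extensions of `K` satisfy `Q`. -/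
def InfinitelyManyExtensions {K : Type*} [Field K]
    (Q : IntermediateField K (AlgebraicClosure K) → Prop) : Prop :=
  ∃ F : ℕ → IntermediateField K (AlgebraicClosure K),
    (∀ i j, i ≠ j → IsEmpty (F i ≃ₐ[K] F j)) ∧ ∀ i, Q (F i)

end AnLocal

/-! The polynomials come from Mestre's construction. Let `P` be monic and separable of odd degree `N
= 2m + 1` with square discriminant. There are `R ≠ 0` and `Q` of degree below `N` with `P'Q - PQ' =
R²`, and comparing products over roots shows that, when `P` and `Q` are coprime, every separable
member of the pencil `P - tQ` again has square discriminant (`SquareDisc.pencil`). So the Galois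
groups stay inside the alternating group while `t` is free for weak approximation. Taking `t` near
`0` at given places preserves the local behaviour of `P`. At an auxiliary prime where `P ≡ X^N - 1`,
the partner `Q` is, up to scaling, a nonzero constant, so the pencil reaches `X^N - b` for every
`b`.

`Reach k` says that any local targets of degree `k + 4` (a quartic given by its cubic resolvent,
times linear factors) are approximated by one global polynomial with the properties that force the
alternating group. It is proved by induction on `k`. Quartics are obtained from cubics in a pencil.
From even to odd degree, one linear factor is added and the product is moved in its pencil until it
is `X^N - b`, irreducible, at a new prime. From odd to even degree, two linear factors are added,
the member of the pencil with a prescribed rational root `y` is taken, and `X - y` is divided out.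
At one more prime the quotient has a Newton polygon of slope `1/m`, hence no rational root.

The alternating group is recognised by Jordan's theorem: a primitive group containing a 3-cycle
contains `A_n`. The 3-cycle and the transitivity needed for primitivity come from decomposition
groups at primes where the reduction is an irreducible factor times distinct linear ones.

Local conditions are transferred by a Krasner argument: when `f` is close to a target, its roots
pair off with those of the target compatibly with the decomposition group. A target with integer
roots gives trivial decomposition groups, and real roots at real places. The target with roots `±α ±
β ± αβ`, for `α² = a` generating an unramified quadratic extension and `β² = b` a uniformizer, gives
the Klein group with inertia of order two (`exists_klein_target`).

Infinitude: every field built has an auxiliary prime with nontrivial decomposition group, and later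
fields are required to split at it. The second assertion follows from the first with an extra prime
outside `S`. -/

namespace AnLocal

open Polynomial Matrix

/-! ### Mestre's equation `P'Q - PQ' = R²` in odd degree -/

section Mestre

/-- Apply a linear functional coefficientwise to a polynomial. -/
noncomputable def mapCoeffs {K L : Type*} [Field K] [Field L] [Algebra K L] (l : L →ₗ[K] K) :
    L[X] →ₗ[K] K[X] where
  toFun q := ⟨.ofCoeff (q.toFinsupp.coeff.mapRange l l.map_zero)⟩
  map_add' p q := by ext; simp
  map_smul' p q := by ext; simp

variable {K L : Type*} [Field K] [Field L] [Algebra K L]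

@[simp] lemma coeff_mapCoeffs (l : L →ₗ[K] K) (q : L[X]) (i : ℕ) :
    (mapCoeffs l q).coeff i = l (q.coeff i) := rfl

lemma mapCoeffs_map_mul (l : L →ₗ[K] K) (p : K[X]) (q : L[X]) :
    mapCoeffs l (p.map (algebraMap K L) * q) = p * mapCoeffs l q := by
  ext i
  simp only [coeff_mapCoeffs, coeff_mul, map_sum, coeff_map]
  refine Finset.sum_congr rfl fun x _ => ?_
  rw [← Algebra.smul_def, map_smul, smul_eq_mul]

lemma mapCoeffs_derivative (l : L →ₗ[K] K) (q : L[X]) :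
    mapCoeffs l (derivative q) = derivative (mapCoeffs l q) := by
  ext i
  simp only [coeff_mapCoeffs, coeff_derivative]
  have : q.coeff (i + 1) * ((i : L) + 1) = ((i + 1 : ℕ) : K) • q.coeff (i + 1) := by
    rw [Algebra.smul_def]; push_cast; ring
  rw [this, map_smul]; simp [mul_comm]

/-- An antisymmetric matrix of odd size is singular. -/
lemma exists_ker_of_antisymm [CharZero L] {n : ℕ} (hn : Odd n) (M : Matrix (Fin n) (Fin n) L)
    (hM : Mᵀ = -M) : ∃ d, d ≠ 0 ∧ M *ᵥ d = 0 := by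
  rw [Matrix.exists_mulVec_eq_zero_iff]
  have h : M.det = -M.det := by
    conv_lhs => rw [← Matrix.det_transpose, hM, Matrix.det_neg]
    simp [hn.neg_one_pow]
  linear_combination h / 2

/-- Try `R = ∑ dᵢ P/(X - aᵢ)`. At the root `a_k` the expression `P''R - 2P'R'` equals `-2 (P/(X -
a_k))(a_k)²` times `∑_{i ≠ k} dᵢ/(a_k - aᵢ)`. So `d` has to lie in the kernel of the antisymmetric
matrix with entries `1/(aᵢ - aⱼ)`, which is singular because its size is odd. -/
lemma exists_root_solution [CharZero L] {n : ℕ} (hn : Odd n) (a : Fin n → L)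
    (ha : Function.Injective a) :
    ∃ R : L[X], R ≠ 0 ∧ R.degree < n ∧
      (∏ i, (X - C (a i))) ∣ derivative (derivative (∏ i, (X - C (a i)))) * R -
        2 * derivative (∏ i, (X - C (a i))) * derivative R := by
  classical
  obtain ⟨d, hd0, hd⟩ := exists_ker_of_antisymm (L := L) hn
    (Matrix.of fun i j => if i = j then 0 else (a i - a j)⁻¹) (by
      ext i j
      change (if j = i then (0 : L) else (a j - a i)⁻¹) = -(if i = j then 0 else (a i - a j)⁻¹)
      by_cases h : i = j
      · simp [h]
      · rw [if_neg h, if_neg (Ne.symm h), ← inv_neg, neg_sub])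
  set P : L[X] := ∏ i, (X - C (a i)) with hP
  let Pk : Fin n → L[X] := fun k => ∏ j ∈ Finset.univ.erase k, (X - C (a j))
  have hPk : ∀ k, P = (X - C (a k)) * Pk k := fun k =>
    (Finset.mul_prod_erase _ _ (Finset.mem_univ k)).symm
  let R : L[X] := ∑ i, C (d i) * Pk i
  have hPk0 : ∀ i k, i ≠ k → (Pk i).eval (a k) = 0 := by
    intro i k h
    simp only [Pk, eval_prod]
    exact Finset.prod_eq_zero (Finset.mem_erase.2 ⟨Ne.symm h, Finset.mem_univ _⟩) (by simp)
  have hPkne : ∀ k, (Pk k).eval (a k) ≠ 0 := by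
    intro k
    simp only [Pk, eval_prod, Finset.prod_ne_zero_iff, Finset.mem_erase]
    intro j hj
    simpa [sub_eq_zero] using fun h => hj.1 (ha h.symm)
  have hReval : ∀ k, R.eval (a k) = d k * (Pk k).eval (a k) := by
    intro k
    simp only [R, eval_finsetSum, eval_mul, eval_C]
    rw [Finset.sum_eq_single k]
    · intro i _ h; rw [hPk0 i k h, mul_zero]
    · simp
  refine ⟨R, ?_, ?_, ?_⟩
  · obtain ⟨k, hk⟩ := Function.ne_iff.1 hd0
    intro h
    have := hReval k
    rw [h, eval_zero] at this
    exact mul_ne_zero hk (hPkne k) this.symm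
  · refine (degree_sum_le _ _).trans_lt ?_
    rw [Finset.sup_lt_iff (WithBot.bot_lt_coe _)]
    intro i _
    refine (degree_mul_le _ _).trans_lt ?_
    refine (add_le_add_left degree_C_le _).trans_lt ?_
    simp only [zero_add, Pk, degree_prod, degree_X_sub_C, Finset.sum_const, Finset.card_erase_of_mem
      (Finset.mem_univ i), Finset.card_univ, Fintype.card_fin]
    have := i.pos
    simp only [nsmul_eq_mul, mul_one]
    exact_mod_cast Nat.sub_lt this one_pos
  · rw [hP]
    refine Finset.prod_dvd_of_coprime ?_ ?_
    · intro i _ j _ hij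
      exact pairwise_coprime_X_sub_C ha hij
    · intro k _
      rw [← hP, dvd_iff_isRoot, IsRoot.def]
      let G : L[X] := ∑ i ∈ Finset.univ.erase k, C (d i) *
        ∏ j ∈ (Finset.univ.erase k).erase i, (X - C (a j))
      have hR : R = C (d k) * Pk k + (X - C (a k)) * G := by
        simp only [R, G]
        rw [← Finset.add_sum_erase _ _ (Finset.mem_univ k), Finset.mul_sum]
        congr 1
        refine Finset.sum_congr rfl fun i hi => ?_
        have : Pk i = (X - C (a k)) * ∏ j ∈ (Finset.univ.erase k).erase i, (X - C (a j)) := by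
          simp only [Pk]
          rw [Finset.erase_right_comm, Finset.mul_prod_erase _ (fun j => X - C (a j))]
          exact Finset.mem_erase.2 ⟨(Finset.ne_of_mem_erase hi).symm, Finset.mem_univ _⟩
        rw [this]; ring
      have hG : G.eval (a k) = 0 := by
        have h1 := congrFun hd k
        simp only [mulVec, dotProduct, of_apply, Pi.zero_apply] at h1
        rw [← Finset.add_sum_erase _ _ (Finset.mem_univ k)] at h1
        simp only [if_true, zero_mul, zero_add] at h1
        have : G.eval (a k) = (Pk k).eval (a k) *
            ∑ i ∈ Finset.univ.erase k, (if k = i then 0 else (a k - a i)⁻¹) * d i := by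
          simp only [G, eval_finsetSum, eval_mul, eval_C, Finset.mul_sum]
          refine Finset.sum_congr rfl fun i hi => ?_
          have hik := Finset.ne_of_mem_erase hi
          rw [if_neg (Ne.symm hik)]
          have h2 : Pk k = (X - C (a i)) * ∏ j ∈ (Finset.univ.erase k).erase i, (X - C (a j)) :=
            (Finset.mul_prod_erase _ _ hi).symm
          have h3 : a k - a i ≠ 0 := sub_ne_zero.2 fun h => hik (ha h.symm)
          rw [h2, eval_mul, eval_sub, eval_X, eval_C]
          field_simp
        rw [this, h1, mul_zero]
      rw [hPk k, hR]
      simp only [derivative_add, derivative_mul, derivative_C, derivative_sub, derivative_X, sub_zero,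
        one_mul, zero_mul, zero_add]
      simp only [eval_add, eval_mul, eval_sub, eval_X,
        eval_C, eval_ofNat, hG, sub_self]
      ring

/-- The divisibility is linear in `R` and `P` has coefficients in `K`, so a `K`-linear functional `L
→ K` applied to coefficients turns a solution over `L` into one over `K`; it is chosen not to kill a
nonzero coefficient. -/
lemma exists_mestre_root [CharZero K] [CharZero L] {n : ℕ} (hn : Odd n) (P : K[X]) (a : Fin n → L)
    (ha : Function.Injective a) (hP : P.map (algebraMap K L) = ∏ i, (X - C (a i))) :
    ∃ R : K[X], R ≠ 0 ∧ R.degree < n ∧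
      P ∣ derivative (derivative P) * R - 2 * derivative P * derivative R := by
  obtain ⟨R, hR0, hRd, S, hS⟩ := exists_root_solution hn a ha
  rw [← hP] at hS
  obtain ⟨i, hi⟩ : ∃ i, R.coeff i ≠ 0 := by
    by_contra! h; exact hR0 (by ext i; simpa using h i)
  obtain ⟨l, hl⟩ : ∃ l : Dual K L, l (R.coeff i) ≠ 0 := by
    by_contra! h; exact hi ((forall_dual_apply_eq_zero_iff K _).1 h)
  refine ⟨mapCoeffs l R, ?_, ?_, mapCoeffs l S, ?_⟩
  · intro h
    have := congrArg (fun q => q.coeff i) h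
    simp [hl] at this
  · rw [degree_lt_iff_coeff_zero] at hRd ⊢
    intro m hm
    simp [hRd m hm]
  · rw [← mapCoeffs_map_mul l P S, ← hS, map_sub, ← mapCoeffs_derivative,
      ← mapCoeffs_map_mul l (2 * derivative P), ← mapCoeffs_map_mul l (derivative _)]
    simp [derivative_map]

/-- Mestre's partner `Q` of `P`: the Wronskian of `P` and `Q` is a square. -/
lemma exists_mestre_partner [CharZero K] {n : ℕ} (P R : K[X]) (hP : P.Monic)
    (hdeg : P.natDegree = n) (hsep : P.Separable) (hRd : R.degree < n)
    (hR : P ∣ derivative (derivative P) * R - 2 * derivative P * derivative R) :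
    ∃ Q : K[X], Q.degree < n ∧ derivative P * Q - P * derivative Q = R ^ 2 := by
  obtain ⟨A, B, hAB⟩ := hsep
  have hPdeg : P.degree = n := by rw [degree_eq_natDegree hP.ne_zero, hdeg]
  -- `B` inverts `P'` modulo `P`, so this is the only candidate: `Q ≡ R²/P'` modulo `P`.
  let Q := (B * R ^ 2) %ₘ P
  have hQd : Q.degree < n := hPdeg ▸ degree_modByMonic_lt _ hP
  refine ⟨Q, hQd, ?_⟩
  set E := derivative P * Q - P * derivative Q - R ^ 2 with hE
  have hcop : IsCoprime P (derivative P) := ⟨A, B, hAB⟩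
  have hQ : Q = B * R ^ 2 - P * ((B * R ^ 2) /ₘ P) := modByMonic_eq_sub_mul_div _ _
  have h1 : P ∣ derivative P * Q - R ^ 2 := by
    refine ⟨-A * R ^ 2 - derivative P * ((B * R ^ 2) /ₘ P), ?_⟩
    rw [hQ]
    linear_combination R ^ 2 * hAB
  have hPE : P ∣ E := by
    have : E = (derivative P * Q - R ^ 2) - P * derivative Q := by rw [hE]; ring
    rw [this]; exact dvd_sub h1 (dvd_mul_right _ _)
  -- The equation for `R` enters here: it says that the error `E` vanishes to second order at the
  -- roots of `P`. Then `P² ∣ E`, while `E` has degree below `2n`.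
  have hPE' : P ∣ derivative E := by
    refine hcop.dvd_of_dvd_mul_left (z := derivative E) ?_
    have : derivative P * derivative E =
        derivative (derivative P) * (derivative P * Q - R ^ 2)
        + R * (derivative (derivative P) * R - 2 * derivative P * derivative R)
        - P * (derivative P * derivative (derivative Q)) := by
      rw [hE, sq R]; simp only [derivative_sub, derivative_mul]; ring
    rw [this]
    exact dvd_sub (dvd_add (h1.mul_left _) (hR.mul_left _)) (dvd_mul_right _ _)
  have hPP : P * P ∣ E := by
    obtain ⟨F, hF⟩ := hPE
    have : P ∣ F := by
      refine hcop.dvd_of_dvd_mul_left ?_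
      have h2 : derivative P * F = derivative E - P * derivative F := by
        rw [hF, derivative_mul]; ring
      rw [h2]; exact dvd_sub hPE' (dvd_mul_right _ _)
    rw [hF]; exact mul_dvd_mul_left _ this
  have hE0 : E = 0 := by
    by_contra h
    have h2 := degree_le_of_dvd hPP h
    rw [degree_mul, hPdeg] at h2
    have h3 : E.degree < ((n + n : ℕ) : WithBot ℕ) := by
      have key : ∀ U V : K[X], U.degree ≤ n → V.degree < n →
          (U * V).degree < ((n + n : ℕ) : WithBot ℕ) := by
        intro U V hU hV
        by_cases hU0 : U = 0
        · simp only [hU0, zero_mul, degree_zero]; exact WithBot.bot_lt_coe _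
        by_cases hV0 : V = 0
        · simp only [hV0, mul_zero, degree_zero]; exact WithBot.bot_lt_coe _
        rw [degree_mul]
        rw [degree_eq_natDegree hU0] at hU ⊢
        rw [degree_eq_natDegree hV0] at hV ⊢
        norm_cast at hU hV ⊢
        omega
      refine (degree_sub_le _ _).trans_lt (max_lt ((degree_sub_le _ _).trans_lt (max_lt ?_ ?_)) ?_)
      · exact key _ _ ((degree_derivative_le).trans hPdeg.le) hQd
      · exact key _ _ hPdeg.le (degree_derivative_le.trans_lt hQd)
      · rw [sq]; exact key _ _ hRd.le hRd
    rw [← Nat.cast_add] at h2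
    exact absurd (h2.trans_lt h3) (lt_irrefl _)
  rw [hE] at hE0
  linear_combination hE0

end Mestre
end AnLocal

namespace AnLocal

open Polynomial Matrix

/-! ### Square discriminants along the pencil -/

section SquareDisc

variable {K : Type*} [Field K]

/-- `f` is a monic separable polynomial of degree `n` whose discriminant is a square in `K`. -/
def SquareDisc (n : ℕ) (f : K[X]) : Prop :=
  ∃ θ : Fin n → AlgebraicClosure K, Function.Injective θ ∧
    f.map (algebraMap K (AlgebraicClosure K)) = ∏ i, (X - C (θ i)) ∧
    ∃ δ : K, algebraMap K (AlgebraicClosure K) δ = (vandermonde θ).det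

lemma monic_of_map_eq_prod {L : Type*} [Field L] [Algebra K L] {n : ℕ} {f : K[X]} {θ : Fin n → L}
    (h : f.map (algebraMap K L) = ∏ i, (X - C (θ i))) : f.Monic := by
  have : (f.map (algebraMap K L)).Monic := h ▸ monic_prod_of_monic _ _ fun i _ => monic_X_sub_C _
  exact monic_of_injective (algebraMap K L).injective this

lemma natDegree_of_map_eq_prod {L : Type*} [Field L] [Algebra K L] {n : ℕ} {f : K[X]}
    {θ : Fin n → L} (h : f.map (algebraMap K L) = ∏ i, (X - C (θ i))) : f.natDegree = n := by
  rw [← natDegree_map (algebraMap K L), h, natDegree_prod_of_monic _ _ fun i _ => monic_X_sub_C _]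
  simp

lemma separable_of_map_eq_prod {L : Type*} [Field L] [Algebra K L] {n : ℕ} {f : K[X]}
    {θ : Fin n → L} (h : f.map (algebraMap K L) = ∏ i, (X - C (θ i)))
    (hθ : Function.Injective θ) : f.Separable := by
  rw [← separable_map (algebraMap K L), h]
  exact separable_prod_X_sub_C_iff.2 hθ

lemma aeval_eq_prod {L : Type*} [Field L] [Algebra K L] {n : ℕ} {f : K[X]} {θ : Fin n → L}
    (h : f.map (algebraMap K L) = ∏ i, (X - C (θ i))) (x : L) :
    aeval x f = ∏ i, (x - θ i) := by
  rw [← eval_map_algebraMap, h, eval_prod]; simp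

lemma aeval_eq_zero_iff {L : Type*} [Field L] [Algebra K L] {n : ℕ} {f : K[X]} {θ : Fin n → L}
    (h : f.map (algebraMap K L) = ∏ i, (X - C (θ i))) (x : L) :
    aeval x f = 0 ↔ ∃ i, x = θ i := by
  simp [aeval_eq_prod h, Finset.prod_eq_zero_iff, sub_eq_zero]

lemma exists_roots {L : Type*} [Field L] [IsAlgClosed L] [Algebra K L] {n : ℕ} {f : K[X]}
    (hf : f.Monic) (hn : f.natDegree = n) :
    ∃ θ : Fin n → L, f.map (algebraMap K L) = ∏ i, (X - C (θ i)) := by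
  have h := (IsAlgClosed.splits (f.map (algebraMap K L))).eq_prod_roots_of_monic (hf.map _)
  have hc : (f.map (algebraMap K L)).roots.card = n := by
    rw [← (IsAlgClosed.splits (f.map (algebraMap K L))).natDegree_eq_card_roots, natDegree_map, hn]
  set s := (f.map (algebraMap K L)).roots
  have hl : s.toList.length = n := by simp [hc]
  refine ⟨fun i => s.toList.get (i.cast hl.symm), ?_⟩
  rw [h]
  conv_lhs => rw [← Multiset.coe_toList s]
  subst hl
  simp only [Multiset.map_coe, Multiset.prod_coe, List.get_eq_getElem, Fin.cast_eq_self]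
  rw [← List.prod_ofFn]
  congr 1
  apply List.ext_getElem <;> simp

lemma injective_of_separable {L : Type*} [Field L] [Algebra K L] {n : ℕ} {f : K[X]}
    {θ : Fin n → L} (h : f.map (algebraMap K L) = ∏ i, (X - C (θ i))) (hf : f.Separable) :
    Function.Injective θ := by
  rw [← separable_map (algebraMap K L), h] at hf
  exact separable_prod_X_sub_C_iff.1 hf

/-- An automorphism permutes the roots. -/
lemma exists_perm {L : Type*} [Field L] [Algebra K L] {n : ℕ} {f : K[X]}
    {θ : Fin n → L} (h : f.map (algebraMap K L) = ∏ i, (X - C (θ i)))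
    (hθ : Function.Injective θ) (σ : L →ₐ[K] L) :
    ∃ π : Equiv.Perm (Fin n), ∀ i, σ (θ i) = θ (π i) := by
  have h1 : ∀ i, ∃ j, σ (θ i) = θ j := fun i => by
    rw [← aeval_eq_zero_iff h, aeval_algHom_apply, (aeval_eq_zero_iff h _).2 ⟨i, rfl⟩, map_zero]
  choose p hp using h1
  have hinj : Function.Injective p := fun i j hij =>
    hθ ((σ : L →+* L).injective (by change σ (θ i) = σ (θ j); rw [hp, hp, hij]))
  exact ⟨Equiv.ofBijective p (Finite.injective_iff_bijective.1 hinj), fun i => hp i⟩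

lemma mem_range_of_fixed [CharZero K] {x : AlgebraicClosure K}
    (h : ∀ σ : AlgebraicClosure K ≃ₐ[K] AlgebraicClosure K, σ x = x) :
    x ∈ (algebraMap K (AlgebraicClosure K)).range := by
  have := (InfiniteGalois.mem_range_algebraMap_iff_fixed (k := K) (K := AlgebraicClosure K) x).2 h
  exact this

lemma prod_aeval_mem_range [CharZero K] {n : ℕ} {f : K[X]} {θ : Fin n → AlgebraicClosure K}
    (h : f.map (algebraMap K _) = ∏ i, (X - C (θ i))) (hθ : Function.Injective θ) (R : K[X]) :
    ∃ r : K, algebraMap K _ r = ∏ i, aeval (θ i) R := by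
  refine mem_range_of_fixed fun σ => ?_
  obtain ⟨π, hπ⟩ := exists_perm h hθ σ.toAlgHom
  rw [map_prod]
  conv_rhs => rw [← Equiv.prod_comp π]
  refine Finset.prod_congr rfl fun i _ => ?_
  rw [← hπ, aeval_algHom_apply]; rfl

/-- The constant `s` is a sign depending on `n` only, so it cancels when two polynomials of the same
degree are compared. -/
lemma prod_derivative_eq {L : Type*} [Field L] (n : ℕ) : ∃ s : L, s ≠ 0 ∧ ∀ θ : Fin n → L,
    ∏ i, (derivative (∏ j, (X - C (θ j)))).eval (θ i) = s * (vandermonde θ).det ^ 2 := by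
  classical
  refine ⟨∏ i : Fin n, ∏ j ∈ Finset.Ioi i, (-1 : L), ?_, fun θ => ?_⟩
  · exact Finset.prod_ne_zero_iff.2 fun i _ => Finset.prod_ne_zero_iff.2 fun j _ => by simp
  · have h1 : ∀ i, (derivative (∏ j, (X - C (θ j)))).eval (θ i) =
        (∏ j ∈ Finset.Ioi i, (θ i - θ j)) * ∏ j ∈ Finset.Iio i, (θ i - θ j) := by
      intro i
      have := Lagrange.eval_nodal_derivative_eval_node_eq (v := θ) (Finset.mem_univ i)
      rw [Lagrange.nodal] at this
      have hd : Disjoint (Finset.Ioi i) (Finset.Iio i) := by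
        rw [Finset.disjoint_left]; intro j; simp only [Finset.mem_Ioi, Finset.mem_Iio]
        exact fun h => h.asymm
      have hu : Finset.univ.erase i = Finset.Ioi i ∪ Finset.Iio i := by
        ext j; simp only [Finset.mem_erase, Finset.mem_univ, and_true, Finset.mem_union,
          Finset.mem_Ioi, Finset.mem_Iio, ne_eq, ← lt_or_lt_iff_ne]; exact or_comm
      rw [this, hu, Lagrange.eval_nodal, Finset.prod_union hd]
    simp only [h1, Finset.prod_mul_distrib]
    have h2 : (∏ i, ∏ j ∈ Finset.Ioi i, (θ i - θ j) : L) =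
        (∏ i : Fin n, ∏ j ∈ Finset.Ioi i, (-1 : L)) * (vandermonde θ).det := by
      rw [det_vandermonde, ← Finset.prod_mul_distrib]
      refine Finset.prod_congr rfl fun i _ => ?_
      rw [← Finset.prod_mul_distrib]
      exact Finset.prod_congr rfl fun j _ => by ring
    have h3 : ∏ i, ∏ j ∈ Finset.Iio i, (θ i - θ j) = (vandermonde θ).det := by
      rw [det_vandermonde]
      exact Finset.prod_comm' (by simp)
    rw [h2, h3]; ring

lemma vandermonde_det_ne_zero {L : Type*} [Field L] {n : ℕ} {θ : Fin n → L}
    (h : Function.Injective θ) : (vandermonde θ).det ≠ 0 :=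
  det_vandermonde_ne_zero_iff.2 h

lemma SquareDisc.monic {n : ℕ} {P : K[X]} (hP : SquareDisc n P) : P.Monic :=
  let ⟨_, _, h, _⟩ := hP; monic_of_map_eq_prod h

lemma SquareDisc.natDegree {n : ℕ} {P : K[X]} (hP : SquareDisc n P) : P.natDegree = n :=
  let ⟨_, _, h, _⟩ := hP; natDegree_of_map_eq_prod h

lemma SquareDisc.separable {n : ℕ} {P : K[X]} (hP : SquareDisc n P) : P.Separable :=
  let ⟨_, h', h, _⟩ := hP; separable_of_map_eq_prod h h'

/-- The members of Mestre's pencil have square discriminant. -/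
lemma SquareDisc.pencil [CharZero K] {n : ℕ} {P Q R : K[X]} (hP : SquareDisc n P)
    (hW : derivative P * Q - P * derivative Q = R ^ 2) (hQ : Q.degree < n)
    (hPQ : IsCoprime P Q) (t : K) (hF : (P - C t * Q).Separable) :
    SquareDisc n (P - C t * Q) := by
  set F := P - C t * Q with hFdef
  obtain ⟨a, ha, hPa, δ, hδ⟩ := hP
  by_cases ht : t = 0
  · exact ⟨a, ha, by simpa [hFdef, ht] using hPa, δ, hδ⟩
  have hPm := monic_of_map_eq_prod hPa
  have hPn := natDegree_of_map_eq_prod hPa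
  have hlt : (C t * Q).degree < P.degree := by
    rw [degree_C_mul ht, degree_eq_natDegree hPm.ne_zero, hPn]; exact hQ
  have hFm : F.Monic := hPm.sub_of_left hlt
  have hFn : F.natDegree = n := by
    rw [hFdef, natDegree_eq_of_degree_eq (degree_sub_eq_left_of_degree_lt hlt), hPn]
  obtain ⟨θ, hFθ⟩ := exists_roots (L := AlgebraicClosure K) hFm hFn
  have hθ := injective_of_separable hFθ hF
  refine ⟨θ, hθ, hFθ, ?_⟩
  obtain ⟨s, hs0, hs⟩ := prod_derivative_eq (L := AlgebraicClosure K) n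
  have hsF := hs θ
  have hsP := hs a
  rw [← hFθ, derivative_map] at hsF
  rw [← hPa, derivative_map] at hsP
  simp only [eval_map_algebraMap] at hsF hsP
  have hPt : ∀ i, aeval (θ i) P = algebraMap K _ t * aeval (θ i) Q := fun i => by
    have := (aeval_eq_zero_iff hFθ (θ i)).2 ⟨i, rfl⟩
    rw [hFdef, map_sub, map_mul, aeval_C] at this
    exact sub_eq_zero.1 this
  have hPa0 : ∀ i, aeval (a i) P = 0 := fun i => (aeval_eq_zero_iff hPa _).2 ⟨i, rfl⟩
  obtain ⟨U, V, hUV⟩ := hPQ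
  have hcop : ∀ x : AlgebraicClosure K, aeval x P = 0 → aeval x Q ≠ 0 := fun x h1 h2 => by
    have := congrArg (aeval x) hUV
    simp [h1, h2] at this
  have hW' : ∀ x : AlgebraicClosure K, aeval x (derivative P) * aeval x Q -
      aeval x P * aeval x (derivative Q) = aeval x R ^ 2 := fun x => by
    have := congrArg (aeval x) hW
    simpa using this
  -- At a root of `F` one has `P = tQ`, so the Wronskian `P'Q - PQ'` becomes `(P' - tQ')Q = F'Q`.
  have h1 : ∀ i, aeval (θ i) (derivative F) * aeval (θ i) Q = aeval (θ i) R ^ 2 := fun i => by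
    rw [← hW' (θ i), hPt i, hFdef]
    simp
    ring
  have h2 : ∀ i, aeval (a i) (derivative P) * aeval (a i) Q = aeval (a i) R ^ 2 := fun i => by
    rw [← hW' (a i), hPa0 i]; ring
  -- A resultant computation: `∏ P(θᵢ)` and `∏ F(aᵢ)` agree up to the sign `(-1)^(n²)`, and `P = tQ`
  -- at the `θᵢ` while `F = -tQ` at the `aᵢ`. The common factor `tⁿ` is cancelled.
  have hQQ : ∏ i, aeval (θ i) Q = ∏ i, aeval (a i) Q := by
    have h3 : ∏ i, aeval (θ i) P = algebraMap K _ t ^ n * ∏ i, aeval (θ i) Q := by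
      simp [hPt, Finset.prod_mul_distrib]
    have h4 : ∏ i, aeval (a i) F = (-1) ^ n * (algebraMap K _ t ^ n * ∏ i, aeval (a i) Q) := by
      have : ∀ i, aeval (a i) F = (-1) * (algebraMap K _ t * aeval (a i) Q) := fun i => by
        rw [hFdef]; simp [hPa0 i]
      simp only [this, Finset.prod_mul_distrib, Finset.prod_const, Finset.card_univ, Fintype.card_fin]
    have h5 : ∏ i, aeval (θ i) P = (-1) ^ n * ∏ i, aeval (a i) F := by
      simp only [aeval_eq_prod hPa, aeval_eq_prod hFθ]
      rw [Finset.prod_comm]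
      have : ∀ k i, θ i - a k = (-1) * (a k - θ i) := fun k i => by ring
      simp only [this, Finset.prod_mul_distrib]
      have h6 : ∏ k : Fin n, ∏ i : Fin n, (-1 : AlgebraicClosure K) = (-1) ^ n := by
        simp only [Finset.prod_const, Finset.card_univ, Fintype.card_fin, ← pow_mul]
        rcases Nat.even_or_odd n with h | h
        · rw [(h.mul_left n).neg_one_pow, h.neg_one_pow]
        · rw [(h.mul h).neg_one_pow, h.neg_one_pow]
      rw [h6]
    have h7 : algebraMap K (AlgebraicClosure K) t ^ n ≠ 0 := pow_ne_zero _ (by simpa using ht)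
    have h8 : ((-1 : AlgebraicClosure K) ^ n) * (-1) ^ n = 1 := by rw [← mul_pow]; simp
    rw [h4, h3, ← mul_assoc, h8, one_mul] at h5
    exact mul_left_cancel₀ h7 h5
  obtain ⟨r, hr⟩ := prod_aeval_mem_range hFθ hθ R
  obtain ⟨r', hr'⟩ := prod_aeval_mem_range hPa ha R
  have h3 : (∏ i, aeval (θ i) (derivative F)) * ∏ i, aeval (a i) Q = algebraMap K _ r ^ 2 := by
    rw [hr, ← hQQ, ← Finset.prod_mul_distrib, ← Finset.prod_pow]
    exact Finset.prod_congr rfl fun i _ => h1 i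
  have h4 : (∏ i, aeval (a i) (derivative P)) * ∏ i, aeval (a i) Q = algebraMap K _ r' ^ 2 := by
    rw [hr', ← Finset.prod_mul_distrib, ← Finset.prod_pow]
    exact Finset.prod_congr rfl fun i _ => h2 i
  rw [hsF] at h3
  rw [hsP, ← hδ] at h4
  have hQ0 : ∏ i, aeval (a i) Q ≠ 0 := Finset.prod_ne_zero_iff.2 fun i _ => hcop _ (hPa0 i)
  have hδ0 : algebraMap K (AlgebraicClosure K) δ ≠ 0 := hδ ▸ vandermonde_det_ne_zero ha
  have hr'0 : algebraMap K (AlgebraicClosure K) r' ≠ 0 := by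
    intro h
    rw [h] at h4
    have : s * algebraMap K (AlgebraicClosure K) δ ^ 2 * ∏ i, aeval (a i) Q ≠ 0 :=
      mul_ne_zero (mul_ne_zero hs0 (pow_ne_zero _ hδ0)) hQ0
    exact this (by simpa using h4)
  -- Dividing the product of the Wronskian identity over the `θᵢ` by that over the `aᵢ` removes both
  -- the sign and `∏ Q`, leaving a quotient of squares.
  have h5 : (vandermonde θ).det ^ 2 = (algebraMap K _ (δ * r / r')) ^ 2 := by
    rw [map_div₀, map_mul, div_pow, mul_pow, eq_div_iff (pow_ne_zero _ hr'0)]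
    apply mul_left_cancel₀ (mul_ne_zero hs0 hQ0)
    linear_combination (algebraMap K (AlgebraicClosure K) r' ^ 2) * h3 -
      (algebraMap K (AlgebraicClosure K) r ^ 2) * h4
  rcases sq_eq_sq_iff_eq_or_eq_neg.1 h5 with h | h
  · exact ⟨_, h.symm⟩
  · exact ⟨-(δ * r / r'), by rw [h, map_neg]⟩

end SquareDisc
end AnLocal

namespace AnLocal

open Polynomial

/-! ### Continuity of polynomial maps in the coefficients -/

section PolyNorm

/-- Polynomial maps are continuous for a ring seminorm. -/
lemma exists_delta_eval {R σ : Type*} [CommRing R] (p : RingSeminorm R) (G : MvPolynomial σ R)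
    (x : σ → R) {ε : ℝ} (hε : 0 < ε) :
    ∃ δ > 0, ∀ y : σ → R, (∀ i, p (y i - x i) < δ) →
      p (MvPolynomial.eval y G - MvPolynomial.eval x G) < ε := by
  induction G using MvPolynomial.induction_on generalizing ε with
  | C a => exact ⟨1, one_pos, fun y _ => by simpa using hε⟩
  | add f g hf hg =>
    obtain ⟨δ, h0, h⟩ := hf (half_pos hε)
    obtain ⟨δ', h0', h'⟩ := hg (half_pos hε)
    refine ⟨min δ δ', lt_min h0 h0', fun y hy => ?_⟩
    have h1 := h y fun i => (hy i).trans_le (min_le_left _ _)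
    have h2 := h' y fun i => (hy i).trans_le (min_le_right _ _)
    rw [map_add, map_add, add_sub_add_comm]
    exact (map_add_le_add p _ _).trans_lt (by linarith)
  | mul_X f i hf =>
    set A := p (MvPolynomial.eval x f)
    set B := p (x i)
    have hA : 0 ≤ A := apply_nonneg _ _
    have hB : 0 ≤ B := apply_nonneg _ _
    set η := min 1 (ε / (A + B + 2)) with hη
    have hη0 : 0 < η := lt_min one_pos (by positivity)
    obtain ⟨δ, h0, h⟩ := hf hη0
    refine ⟨min δ η, lt_min h0 hη0, fun y hy => ?_⟩
    have h1 := h y fun i => (hy i).trans_le (min_le_left _ _)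
    have h2 := (hy i).trans_le (min_le_right _ _)
    simp only [map_mul, MvPolynomial.eval_X]
    have : MvPolynomial.eval y f * y i - MvPolynomial.eval x f * x i =
      (MvPolynomial.eval y f - MvPolynomial.eval x f) * (y i - x i) +
      ((MvPolynomial.eval y f - MvPolynomial.eval x f) * x i +
       MvPolynomial.eval x f * (y i - x i)) := by ring
    rw [this]
    set u := MvPolynomial.eval y f - MvPolynomial.eval x f
    set w := y i - x i
    have e1 : p (u * w) ≤ η * 1 := (map_mul_le_mul p _ _).trans
      (mul_le_mul h1.le (h2.le.trans (min_le_left _ _)) (apply_nonneg _ _) hη0.le)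
    have e2 : p (u * x i) ≤ η * B := (map_mul_le_mul p _ _).trans
      (mul_le_mul_of_nonneg_right h1.le hB)
    have e3 : p (MvPolynomial.eval x f * w) ≤ A * η := (map_mul_le_mul p _ _).trans
      (mul_le_mul_of_nonneg_left h2.le hA)
    have e4 : η * (A + B + 2) ≤ ε := by
      rw [← le_div_iff₀ (by positivity)]; exact min_le_right _ _
    have := map_add_le_add p (u * w) (u * x i + MvPolynomial.eval x f * w)
    have := map_add_le_add p (u * x i) (MvPolynomial.eval x f * w)
    nlinarith

variable {K : Type*} [Field K]

/-- An absolute value, as a ring seminorm. -/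
noncomputable def absSeminorm (v : AbsoluteValue K ℝ) : RingSeminorm K where
  toFun := v
  map_zero' := map_zero v
  add_le' := v.add_le
  neg' := v.map_neg
  mul_le' x y := (map_mul v x y).le

@[simp] lemma absSeminorm_apply (v : AbsoluteValue K ℝ) (x : K) : absSeminorm v x = v x := rfl

lemma sum_coeff_eq_sum_range (v : AbsoluteValue K ℝ) (f : K[X]) {n : ℕ} (h : f.natDegree < n) :
    f.sum (fun _ c => v c) = ∑ i ∈ Finset.range n, v (f.coeff i) :=
  f.sum_over_range' (fun _ => map_zero v) n h

lemma sum_coeff_add_le (v : AbsoluteValue K ℝ) (f g : K[X]) :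
    (f + g).sum (fun _ c => v c) ≤ f.sum (fun _ c => v c) + g.sum (fun _ c => v c) := by
  set n := max f.natDegree g.natDegree + 1
  rw [sum_coeff_eq_sum_range v f (n := n) (by omega), sum_coeff_eq_sum_range v g (n := n) (by omega),
    sum_coeff_eq_sum_range v (f + g) (n := n) (by have := natDegree_add_le f g; omega),
    ← Finset.sum_add_distrib]
  exact Finset.sum_le_sum fun i _ => by rw [coeff_add]; exact v.add_le _ _

lemma sum_coeff_C_mul_X_pow_mul (v : AbsoluteValue K ℝ) (a : K) (k : ℕ) (g : K[X]) :
    (C a * X ^ k * g).sum (fun _ c => v c) = v a * g.sum (fun _ c => v c) := by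
  by_cases ha : a = 0
  · simp [ha]
  have h1 : (C a * X ^ k * g).natDegree < k + (g.natDegree + 1) := by
    have := natDegree_mul_le (p := C a * X ^ k) (q := g)
    have := natDegree_C_mul_X_pow_le a k
    omega
  rw [sum_coeff_eq_sum_range v _ h1, sum_coeff_eq_sum_range v g (n := g.natDegree + 1) (by omega),
    Finset.sum_range_add, Finset.mul_sum]
  have h2 : ∀ i, (C a * X ^ k * g).coeff i = if k ≤ i then a * g.coeff (i - k) else 0 := fun i => by
    rw [mul_assoc, coeff_C_mul, coeff_X_pow_mul']; split_ifs <;> simp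
  rw [Finset.sum_eq_zero, zero_add]
  · exact Finset.sum_congr rfl fun i _ => by rw [h2]; simp
  · intro i hi
    rw [h2, if_neg (by simpa using hi), map_zero]

/-- The sum of the absolute values of the coefficients. -/
noncomputable def polyNorm (v : AbsoluteValue K ℝ) : RingSeminorm K[X] where
  toFun f := f.sum fun _ c => v c
  map_zero' := by simp
  add_le' := sum_coeff_add_le v
  neg' f := by simp [Polynomial.sum_def]
  mul_le' f g := by
    have h0 : ∀ s : Finset ℕ, (∑ i ∈ s, C (f.coeff i) * X ^ i * g).sum (fun _ c => v c) ≤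
        ∑ i ∈ s, (C (f.coeff i) * X ^ i * g).sum (fun _ c => v c) := fun s => by
      classical
      induction s using Finset.induction_on with
      | empty => simp
      | insert a s ha ih =>
        rw [Finset.sum_insert ha, Finset.sum_insert ha]
        exact (sum_coeff_add_le v _ _).trans (by linarith)
    have h1 := h0 f.support
    rw [← Finset.sum_mul, ← f.as_sum_support_C_mul_X_pow] at h1
    refine h1.trans (le_of_eq ?_)
    simp only [sum_coeff_C_mul_X_pow_mul]
    rw [← Finset.sum_mul]; rfl

lemma polyNorm_eq (v : AbsoluteValue K ℝ) (f : K[X]) :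
    polyNorm v f = ∑ i ∈ f.support, v (f.coeff i) := rfl

lemma coeff_le_polyNorm (v : AbsoluteValue K ℝ) (f : K[X]) (i : ℕ) : v (f.coeff i) ≤ polyNorm v f := by
  by_cases h : i ∈ f.support
  · exact Finset.single_le_sum (f := fun i => v (f.coeff i)) (fun _ _ => v.nonneg _) h
  · rw [notMem_support_iff.1 h, map_zero]; exact apply_nonneg _ _

@[simp] lemma polyNorm_C (v : AbsoluteValue K ℝ) (a : K) : polyNorm v (C a) = v a :=
  sum_C_index (map_zero v)

@[simp] lemma polyNorm_C_mul (v : AbsoluteValue K ℝ) (a : K) (f : K[X]) :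
    polyNorm v (C a * f) = v a * polyNorm v f := by
  have := sum_coeff_C_mul_X_pow_mul v a 0 f
  rw [pow_zero, mul_one] at this
  exact this

end PolyNorm

/-! ### Absolute values of places and weak approximation -/

section Places

variable {K : Type*} [Field K] [NumberField K]

open IsDedekindDomain

/-- The normalized absolute value attached to a place. -/
noncomputable def placeAbs : Place K → AbsoluteValue K ℝ
  | Sum.inl p => NumberField.HeightOneSpectrum.adicAbv K p
  | Sum.inr v => v.1

lemma placeAbs_finite_le_one_iff (p : HeightOneSpectrum (𝓞 K)) (x : K) :
    placeAbs (Sum.inl p) x ≤ 1 ↔ p.valuation K x ≤ 1 :=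
  WithZeroMulInt.toNNReal_le_one_iff (NumberField.HeightOneSpectrum.one_lt_absNorm_nnreal p)

lemma placeAbs_finite_lt_one_iff (p : HeightOneSpectrum (𝓞 K)) (x : K) :
    placeAbs (Sum.inl p) x < 1 ↔ p.valuation K x < 1 :=
  WithZeroMulInt.toNNReal_lt_one_iff (NumberField.HeightOneSpectrum.one_lt_absNorm_nnreal p)

lemma placeAbs_finite_le_iff (p : HeightOneSpectrum (𝓞 K)) (x y : K) :
    placeAbs (Sum.inl p) x ≤ placeAbs (Sum.inl p) y ↔ p.valuation K x ≤ p.valuation K y :=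
  (WithZeroMulInt.toNNReal_strictMono
    (NumberField.HeightOneSpectrum.one_lt_absNorm_nnreal p)).le_iff_le

lemma placeAbs_finite_add_le (p : HeightOneSpectrum (𝓞 K)) (x y : K) :
    placeAbs (Sum.inl p) (x + y) ≤ max (placeAbs (Sum.inl p) x) (placeAbs (Sum.inl p) y) :=
  NumberField.HeightOneSpectrum.adicAbv_add_le_max K p x y

lemma placeAbs_algebraMap_le_one (p : HeightOneSpectrum (𝓞 K)) (x : 𝓞 K) :
    placeAbs (Sum.inl p) (algebraMap (𝓞 K) K x) ≤ 1 :=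
  (placeAbs_finite_le_one_iff _ _).2 (p.valuation_le_one x)

lemma placeAbs_algebraMap_lt_one_iff (p : HeightOneSpectrum (𝓞 K)) (x : 𝓞 K) :
    placeAbs (Sum.inl p) (algebraMap (𝓞 K) K x) < 1 ↔ x ∈ p.asIdeal :=
  (placeAbs_finite_lt_one_iff _ _).trans (p.valuation_lt_one_iff_mem x)

lemma placeAbs_isNontrivial (v : Place K) : (placeAbs v).IsNontrivial := by
  rcases v with p | v
  · obtain ⟨x, hx, hx0⟩ := Submodule.exists_mem_ne_zero_of_ne_bot p.ne_bot
    refine ⟨algebraMap (𝓞 K) K x, by simpa using hx0, ?_⟩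
    exact ((placeAbs_algebraMap_lt_one_iff p x).2 hx).ne
  · exact v.isNontrivial

lemma placeAbs_not_isEquiv {v w : Place K} (h : v ≠ w) : ¬(placeAbs v).IsEquiv (placeAbs w) := by
  -- The element `2` separates the two kinds of place: it has absolute value at most `1` at a finite
  -- prime and exceeds `1` at an archimedean one.
  have aux : ∀ (p : HeightOneSpectrum (𝓞 K)) (w : InfinitePlace K),
      ¬(placeAbs (Sum.inl p)).IsEquiv w.1 := fun p w h => by
    have h1 := placeAbs_algebraMap_le_one p 2
    rw [map_ofNat, ← map_one (placeAbs (Sum.inl p))] at h1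
    have h2 : w (2 : K) ≤ w 1 := (h (2 : K) 1).1 h1
    rw [← InfinitePlace.norm_embedding_eq, ← InfinitePlace.norm_embedding_eq] at h2
    rw [show w.embedding 2 = 2 from map_ofNat w.embedding 2, map_one] at h2
    norm_num at h2
  intro he
  rcases v with p | v <;> rcases w with q | w
  · refine h (congrArg _ (HeightOneSpectrum.eq_of_valuation_isEquiv_valuation (K := K) ?_))
    intro x y
    rw [← placeAbs_finite_le_iff, ← placeAbs_finite_le_iff]
    exact he x y
  · exact aux p w he
  · exact aux q v he.symm
  · exact h (congrArg _ (InfinitePlace.eq_iff_isEquiv.2 he))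

/-- Weak approximation. -/
lemma exists_approx (S : Finset (Place K)) (a : Place K → K) {ε : ℝ} (hε : 0 < ε) :
    ∃ x : K, ∀ v ∈ S, placeAbs v (x - a v) < ε := by
  have h := AbsoluteValue.denseRange_algebraMap_pi (F := K) (v := fun i : S => placeAbs i.1)
    (fun i => placeAbs_isNontrivial _)
    (fun i j hij => placeAbs_not_isEquiv fun h => hij (Subtype.ext h))
  obtain ⟨x, hx⟩ := Metric.denseRange_iff.1 h
    (fun i => (WithAbs.equiv (placeAbs i.1)).symm (a i.1)) ε hε
  refine ⟨x, fun v hv => ?_⟩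
  have := (dist_pi_lt_iff hε).1 hx ⟨v, hv⟩
  rw [dist_comm, dist_eq_norm, WithAbs.norm_eq_apply_ofAbs] at this
  exact this

end Places
end AnLocal

namespace AnLocal

open Polynomial IsLocalRing

/-! ### Mestre's equation over a valuation ring, modulo the maximal ideal -/

section Reduction

variable {A K : Type*} [CommRing A] [IsDomain A] [ValuationRing A] [Field K] [Algebra A K]
  [IsFractionRing A K]

/-- Coprimality can be checked on reductions. -/
lemma isCoprime_of_reduction {F G : A[X]} (hF : F.Monic)
    (h : IsCoprime (F.map (residue A)) (G.map (residue A))) :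
    IsCoprime (F.map (algebraMap A K)) (G.map (algebraMap A K)) := by
  classical
  rw [← EuclideanDomain.gcd_isUnit_iff]
  have hF0 : F.map (algebraMap A K) ≠ 0 := (hF.map _).ne_zero
  set D := EuclideanDomain.gcd (F.map (algebraMap A K)) (G.map (algebraMap A K)) with hD
  have hD0 : D ≠ 0 := fun h0 => hF0 (zero_dvd_iff.1 (h0 ▸ EuclideanDomain.gcd_dvd_left _ _))
  -- Gauss's lemma: the gcd is, up to a scalar, a monic polynomial over `A` dividing both `F` and
  -- `G`. Its reduction divides coprime polynomials, and a monic polynomial keeps its degree under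
  -- reduction.
  obtain ⟨E, hE⟩ := IsIntegrallyClosed.eq_map_mul_C_of_dvd K hF
    (EuclideanDomain.gcd_dvd_left (F.map (algebraMap A K)) (G.map (algebraMap A K)))
  rw [← hD] at hE
  have hlc : D.leadingCoeff ≠ 0 := leadingCoeff_ne_zero.2 hD0
  have hEm : E.Monic := by
    refine monic_of_injective (IsFractionRing.injective A K) ?_
    have := congrArg leadingCoeff hE
    rw [leadingCoeff_mul, leadingCoeff_C] at this
    exact mul_right_cancel₀ hlc (by rw [this, one_mul])
  have hEF : E ∣ F := (map_dvd_map (algebraMap A K) (IsFractionRing.injective A K) hEm).1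
    ((Dvd.intro _ hE).trans (EuclideanDomain.gcd_dvd_left _ _))
  have hEG : E ∣ G := (map_dvd_map (algebraMap A K) (IsFractionRing.injective A K) hEm).1
    ((Dvd.intro _ hE).trans (EuclideanDomain.gcd_dvd_right _ _))
  have hu := h.isUnit_of_dvd' (Polynomial.map_dvd (residue A) hEF) (Polynomial.map_dvd (residue A) hEG)
  have hE1 : E.natDegree = 0 := by
    rw [← hEm.natDegree_map (residue A)]; exact natDegree_eq_zero_of_isUnit hu
  have hE2 : E = 1 := hEm.natDegree_eq_zero.1 hE1
  rw [← hE, hE2]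
  simpa using hlc

lemma separable_of_reduction {F : A[X]} (hF : F.Monic) (h : (F.map (residue A)).Separable) :
    (F.map (algebraMap A K)).Separable := by
  rw [Separable, derivative_map]
  rw [Separable, derivative_map] at h
  exact isCoprime_of_reduction hF h

/-- Divide by a coefficient of largest valuation: all coefficients become integral and that one
becomes `1`. -/
lemma exists_primitive_scaling {f : K[X]} (hf : f ≠ 0) :
    ∃ c : K, c ≠ 0 ∧ ∃ g : A[X], g.map (algebraMap A K) = C c * f ∧ g.map (residue A) ≠ 0 := by
  obtain ⟨i, hi, hmax⟩ := f.support.exists_max_image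
    (fun i => ValuationRing.valuation A K (f.coeff i)) (support_nonempty.2 hf)
  have hfi : f.coeff i ≠ 0 := mem_support_iff.1 hi
  have h1 : ∀ j, ∃ a : A, algebraMap A K a = (f.coeff i)⁻¹ * f.coeff j := fun j => by
    by_cases hj : j ∈ f.support
    · have : (f.coeff i)⁻¹ * f.coeff j ∈ (ValuationRing.valuation A K).integer := by
        rw [Valuation.mem_integer_iff, map_mul, map_inv₀, ← div_eq_inv_mul]
        exact div_le_one_of_le₀ (hmax j hj) zero_le
      exact (ValuationRing.mem_integer_iff A K _).1 this
    · exact ⟨0, by rw [notMem_support_iff.1 hj]; simp⟩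
  have h2 : C (f.coeff i)⁻¹ * f ∈ Polynomial.lifts (algebraMap A K) := by
    rw [lifts_iff_coeff_lifts]
    intro j
    rw [coeff_C_mul]
    exact h1 j
  obtain ⟨g, hg⟩ := (mem_lifts _).1 h2
  refine ⟨_, inv_ne_zero hfi, g, hg, fun h => ?_⟩
  have h3 := congrArg (coeff · i) hg
  simp only [coeff_map, coeff_C_mul, inv_mul_cancel₀ hfi] at h3
  have h4 : g.coeff i = 1 := IsFractionRing.injective A K (by rw [h3, map_one])
  have h5 := congrArg (coeff · i) h
  simp [h4] at h5

/-- The Mestre equation for `X ^ N - 1`. -/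
lemma eq_C_mul_X_pow_of_dvd {k : Type*} [Field k] {m : ℕ} (hm : 0 < m)
    (hk : ∀ j : ℕ, 0 < j → j ≤ 2 * m + 1 → (j : k) ≠ 0) {R : k[X]} (hR : R.degree < (2 * m + 1 : ℕ))
    (h : (X ^ (2 * m + 1) - 1 : k[X]) ∣ derivative (derivative (X ^ (2 * m + 1) - 1)) * R -
      2 * derivative (X ^ (2 * m + 1) - 1) * derivative R) : ∃ r, R = C r * X ^ m := by
  -- The left side of Mestre's equation for `X^N - 1` is `N X^(2m-1) S`, and the `i`-th coefficient
  -- of `S` is `2(m - i)` times that of `R`. Divisibility by `X^N - 1` forces `S = 0` by degree, so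
  -- only the coefficient of `X^m` in `R` survives.
  set S : k[X] := (2 * m : k[X]) * R - 2 * X * derivative R with hS
  have h1 : derivative (derivative (X ^ (2 * m + 1) - 1)) * R -
      2 * derivative (X ^ (2 * m + 1) - 1) * derivative R =
      C ((2 * m + 1 : ℕ) : k) * (X ^ (2 * m - 1) * S) := by
    obtain ⟨l, rfl⟩ : ∃ l, m = l + 1 := ⟨m - 1, by omega⟩
    simp only [derivative_sub, derivative_X_pow, derivative_one, sub_zero, hS, derivative_C_mul]
    have e1 : 2 * (l + 1) + 1 - 1 = 2 * l + 1 + 1 := by omega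
    have e2 : 2 * (l + 1) - 1 = 2 * l + 1 := by omega
    rw [e1, e2, Nat.add_sub_cancel]
    push_cast
    simp only [map_add, map_mul, map_natCast, map_one, C_ofNat]
    ring
  have h2 : (X ^ (2 * m + 1) - 1 : k[X]) ∣ S := by
    rw [h1] at h
    have hu : IsUnit (C ((2 * m + 1 : ℕ) : k)) :=
      isUnit_C.2 (isUnit_iff_ne_zero.2 (hk _ (by omega) le_rfl))
    have hc : IsCoprime (X ^ (2 * m + 1) - 1 : k[X]) (X ^ (2 * m - 1)) := by
      refine IsCoprime.pow_right ⟨-1, X ^ (2 * m), ?_⟩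
      ring
    exact hc.dvd_of_dvd_mul_left ((hu.dvd_mul_left).1 h)
  have hcoeff : ∀ i, S.coeff i = 2 * ((m : k) - i) * R.coeff i := fun i => by
    have e1 : (2 * m : k[X]) * R = C (2 * m : k) * R := by
      simp only [map_mul, map_natCast, C_ofNat]
    have e2 : (2 * X * derivative R : k[X]) = C 2 * (X * derivative R) := by
      rw [C_ofNat]; ring
    rw [hS, e1, e2, coeff_sub, coeff_C_mul, coeff_C_mul]
    cases i with
    | zero => simp
    | succ i => rw [coeff_X_mul, coeff_derivative]; push_cast; ring
  have hS0 : S = 0 := by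
    refine eq_zero_of_dvd_of_degree_lt h2 ?_
    have hd : (X ^ (2 * m + 1) - 1 : k[X]).degree = (2 * m + 1 : ℕ) := by
      have := degree_X_pow_sub_C (n := 2 * m + 1) (by omega) (1 : k)
      simpa using this
    rw [hd, degree_lt_iff_coeff_zero]
    intro i hi
    rw [hcoeff, (degree_lt_iff_coeff_zero _ _).1 hR i hi, mul_zero]
  refine ⟨R.coeff m, ?_⟩
  ext i
  rw [coeff_C_mul_X_pow]
  split_ifs with hi
  · rw [hi]
  · by_cases hi2 : i < 2 * m + 1
    · have h3 := hcoeff i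
      rw [hS0, coeff_zero] at h3
      have h20 : (2 : k) ≠ 0 := by simpa using hk 2 (by omega) (by omega)
      have h4 : (m : k) - i ≠ 0 := by
        rcases lt_or_gt_of_ne hi with h | h
        · have := hk (m - i) (by omega) (by omega)
          rwa [Nat.cast_sub h.le] at this
        · have := hk (i - m) (by omega) (by omega)
          rw [Nat.cast_sub h.le] at this
          rwa [← neg_ne_zero, neg_sub]
      exact (mul_eq_zero.1 h3.symm).resolve_left (mul_ne_zero h20 h4)
    · exact (degree_lt_iff_coeff_zero _ _).1 hR i (by omega)

/-- Where `P` reduces to `X ^ N - 1`, Mestre's partner of `P` reduces, up to scaling, to a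
nonzero constant. -/
lemma exists_partner_reduction {m : ℕ} (hm : 0 < m)
    (hk : ∀ j : ℕ, 0 < j → j ≤ 2 * m + 1 → (j : ResidueField A) ≠ 0) {P : A[X]} (hP : P.Monic)
    (hPr : P.map (residue A) = X ^ (2 * m + 1) - 1) {R Q : K[X]} (hR0 : R ≠ 0)
    (hRd : R.degree < (2 * m + 1 : ℕ)) (hQd : Q.degree < (2 * m + 1 : ℕ))
    (hR : P.map (algebraMap A K) ∣ derivative (derivative (P.map (algebraMap A K))) * R -
      2 * derivative (P.map (algebraMap A K)) * derivative R)
    (hW : derivative (P.map (algebraMap A K)) * Q - P.map (algebraMap A K) * derivative Q = R ^ 2) :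
    ∃ c : K, c ≠ 0 ∧ ∃ Q₁ : A[X], Q₁.map (algebraMap A K) = C c * Q ∧
      ∃ κ, κ ≠ 0 ∧ Q₁.map (residue A) = C κ := by
  have hinj := IsFractionRing.injective A K
  have hinj' := map_injective (algebraMap A K) hinj
  have hdegmap : ∀ {c : K} {f : K[X]} {g : A[X]}, f.degree < (2 * m + 1 : ℕ) →
      g.map (algebraMap A K) = C c * f → (g.map (residue A)).degree < (2 * m + 1 : ℕ) := by
    intro c f g hf hg
    refine degree_map_le.trans_lt ?_
    rw [← degree_map_eq_of_injective hinj, hg]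
    refine (degree_mul_le _ _).trans_lt (lt_of_le_of_lt (add_le_add_left degree_C_le _) ?_)
    simpa using hf
  have hsep : IsCoprime (X ^ (2 * m + 1) - 1 : (ResidueField A)[X])
      (derivative (X ^ (2 * m + 1) - 1)) := by
    have := separable_X_pow_sub_C (n := 2 * m + 1) (1 : ResidueField A) (hk _ (by omega) le_rfl)
      one_ne_zero
    simpa [Separable] using this
  have hpd : (X ^ (2 * m + 1) - 1 : (ResidueField A)[X]).degree = (2 * m + 1 : ℕ) := by
    have := degree_X_pow_sub_C (n := 2 * m + 1) (by omega) (1 : ResidueField A)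
    simpa using this
  -- The partner is unique modulo the maximal ideal: with `p = X^N - 1`, the equation `p'D = pD'`
  -- makes the separable `p` divide `D`, which has smaller degree.
  have huniq : ∀ D : (ResidueField A)[X], D.degree < (2 * m + 1 : ℕ) →
      derivative (X ^ (2 * m + 1) - 1) * D - (X ^ (2 * m + 1) - 1) * derivative D = 0 → D = 0 := by
    intro D hD h
    refine eq_zero_of_dvd_of_degree_lt (hsep.dvd_of_dvd_mul_left ?_) (hpd ▸ hD)
    rw [sub_eq_zero.1 h]; exact dvd_mul_right _ _
  obtain ⟨c, hc, R₁, hR₁, hR₁0⟩ := exists_primitive_scaling (A := A) hR0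
  have hdvd : P ∣ derivative (derivative P) * R₁ - 2 * derivative P * derivative R₁ := by
    rw [← map_dvd_map (algebraMap A K) hinj hP]
    obtain ⟨T, hT⟩ := hR
    refine ⟨C c * T, ?_⟩
    simp only [Polynomial.map_sub, Polynomial.map_mul, ← derivative_map, hR₁, derivative_C_mul,
      Polynomial.map_ofNat]
    linear_combination C c * hT
  obtain ⟨r, hr⟩ : ∃ r, R₁.map (residue A) = C r * X ^ m := by
    refine eq_C_mul_X_pow_of_dvd hm hk (hdegmap hRd hR₁) ?_
    have := Polynomial.map_dvd (residue A) hdvd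
    simpa [← derivative_map, hPr] using this
  have hr0 : r ≠ 0 := by rintro rfl; simp [hr] at hR₁0
  have hQ0 : Q ≠ 0 := by
    rintro rfl
    simp at hW
    exact hR0 ((pow_eq_zero_iff two_ne_zero).1 hW.symm)
  obtain ⟨d, hd, G, hG, hG0⟩ := exists_primitive_scaling (A := A) (f := C (c ^ 2) * Q)
    (mul_ne_zero (by simpa using hc) hQ0)
  have hG' : G.map (algebraMap A K) = C (d * c ^ 2) * Q := by rw [hG, C_mul, mul_assoc]
  have hGW : (derivative P * G - P * derivative G).map (algebraMap A K) =
      C d * (R₁ ^ 2).map (algebraMap A K) := by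
    simp only [Polynomial.map_sub, Polynomial.map_mul, ← derivative_map, Polynomial.map_pow, hR₁, hG',
      derivative_C_mul]
    rw [mul_pow, ← hW, ← C_pow, C_mul]
    ring
  -- `G` is the primitive multiple of `c²Q`, by the factor `d`, and its Wronskian with `P` is `d
  -- R₁²`. If `d` were integral and not a unit, this would reduce to `0`, hence so would `G` by
  -- uniqueness. So `d⁻¹` is integral.
  obtain ⟨Q₁, hQ₁⟩ : ∃ Q₁ : A[X], Q₁.map (algebraMap A K) = C (c ^ 2) * Q := by
    rcases ValuationRing.isInteger_or_isInteger A d with ⟨a, ha⟩ | ⟨a, ha⟩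
    · have h1 : derivative P * G - P * derivative G = C a * R₁ ^ 2 := hinj' (by
        rw [hGW, Polynomial.map_mul, map_C, ha])
      by_cases hau : IsUnit a
      · obtain ⟨u, rfl⟩ := hau
        refine ⟨C (↑u⁻¹ : A) * G, ?_⟩
        rw [Polynomial.map_mul, map_C, hG, ← ha, ← mul_assoc, ← C_mul, ← map_mul]
        simp
      · exfalso
        refine hG0 (huniq _ (hdegmap hQd hG') ?_)
        have h2 := congrArg (Polynomial.map (residue A)) h1
        have h3 : residue A a = 0 := (residue_eq_zero_iff a).2 hau
        simpa [← derivative_map, hPr, h3] using h2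
    · refine ⟨C a * G, ?_⟩
      rw [Polynomial.map_mul, map_C, hG, ha, ← mul_assoc, ← C_mul, inv_mul_cancel₀ hd]
      simp
  -- The right side of the reduced equation is `r² X^(2m)`, and the constant `r²/N` solves it since
  -- `(X^N - 1)' = N X^(2m)`; uniqueness identifies the reduction of `Q₁`.
  refine ⟨c ^ 2, pow_ne_zero _ hc, Q₁, hQ₁, r ^ 2 / (2 * m + 1 : ℕ), ?_, ?_⟩
  · exact div_ne_zero (pow_ne_zero _ hr0) (hk _ (by omega) le_rfl)
  · have h1 : derivative P * Q₁ - P * derivative Q₁ = R₁ ^ 2 := hinj' (by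
      simp only [Polynomial.map_sub, Polynomial.map_mul, ← derivative_map, Polynomial.map_pow, hR₁,
        hQ₁, derivative_C_mul]
      rw [mul_pow, ← hW, ← C_pow]
      ring)
    have h2 := congrArg (Polynomial.map (residue A)) h1
    simp only [Polynomial.map_sub, Polynomial.map_mul, ← derivative_map, Polynomial.map_pow, hPr,
      hr] at h2
    rw [← sub_eq_zero]
    refine huniq _ ?_ ?_
    · refine (degree_sub_le _ _).trans_lt (max_lt (hdegmap hQd hQ₁) ?_)
      exact degree_C_le.trans_lt (by exact_mod_cast Nat.succ_pos _)
    · have h3 : C (((2 * m + 1 : ℕ) : ResidueField A)) * C (r ^ 2 / ((2 * m + 1 : ℕ) : ResidueField A))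
          = C r ^ 2 := by
        rw [← C_mul, mul_div_cancel₀ _ (hk _ (by omega) le_rfl), C_pow]
      simp only [derivative_sub, derivative_C, sub_zero, derivative_X_pow, derivative_one] at h2 ⊢
      have e : 2 * m + 1 - 1 = 2 * m := by omega
      rw [e] at h2 ⊢
      linear_combination h2 - X ^ (2 * m) * h3

end Reduction

/-! ### Congruences of polynomials at a finite prime -/

section Congruence

open IsDedekindDomain

variable {K : Type*} [Field K] [NumberField K]

/-- Two polynomials over `K` are congruent modulo the finite prime `q`. -/
def CongrAt (q : HeightOneSpectrum (𝓞 K)) (f g : K[X]) : Prop :=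
  ∀ i, placeAbs (Sum.inl q) ((f - g).coeff i) < 1

lemma CongrAt.trans {q : HeightOneSpectrum (𝓞 K)} {f g h : K[X]} (h₁ : CongrAt q f g)
    (h₂ : CongrAt q g h) : CongrAt q f h := fun i => by
  have : (f - h).coeff i = (f - g).coeff i + (g - h).coeff i := by simp
  rw [this]
  exact (placeAbs_finite_add_le q _ _).trans_lt (max_lt (h₁ i) (h₂ i))

lemma CongrAt.symm {q : HeightOneSpectrum (𝓞 K)} {f g : K[X]} (h : CongrAt q f g) :
    CongrAt q g f := fun i => by
  have := h i
  rwa [← neg_sub, coeff_neg, AbsoluteValue.map_neg] at this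

lemma congrAt_of_polyNorm_lt {q : HeightOneSpectrum (𝓞 K)} {f g : K[X]}
    (h : polyNorm (placeAbs (Sum.inl q)) (f - g) < 1) : CongrAt q f g := fun i =>
  (coeff_le_polyNorm _ _ i).trans_lt h

/-- The valuation ring of a finite prime. -/
noncomputable abbrev valRing (q : HeightOneSpectrum (𝓞 K)) : ValuationSubring K :=
  (q.valuation K).valuationSubring

lemma mem_valRing_iff (q : HeightOneSpectrum (𝓞 K)) (x : K) :
    x ∈ valRing q ↔ placeAbs (Sum.inl q) x ≤ 1 :=
  (placeAbs_finite_le_one_iff q x).symm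

lemma residue_valRing_eq_zero_iff (q : HeightOneSpectrum (𝓞 K)) (x : valRing q) :
    residue _ x = 0 ↔ placeAbs (Sum.inl q) (x : K) < 1 := by
  rw [residue_eq_zero_iff, mem_maximalIdeal, mem_nonunits_iff, ← not_le, not_iff_not]
  have hx := (mem_valRing_iff q x).1 x.2
  constructor
  · rintro ⟨u, rfl⟩
    have h1 := (mem_valRing_iff q _).1 (↑u⁻¹ : valRing q).2
    have h2 : placeAbs (Sum.inl q) ((u : valRing q) : K) *
        placeAbs (Sum.inl q) ((↑u⁻¹ : valRing q) : K) = 1 := by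
      rw [← map_mul, ← MulMemClass.coe_mul, Units.mul_inv]; simp
    by_contra! h
    nlinarith [(placeAbs (Sum.inl q)).nonneg ((u : valRing q) : K),
      (placeAbs (Sum.inl q)).nonneg ((↑u⁻¹ : valRing q) : K)]
  · intro h
    have h1 : placeAbs (Sum.inl q) (x : K) = 1 := le_antisymm hx h
    have h0 : (x : K) ≠ 0 := by
      intro h0; rw [h0, map_zero] at h1; exact zero_ne_one h1
    refine IsUnit.of_mul_eq_one ⟨(x : K)⁻¹, (mem_valRing_iff q _).2 ?_⟩ (Subtype.ext ?_)
    · rw [map_inv₀, h1, inv_one]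
    · exact mul_inv_cancel₀ h0

lemma exists_lift_valRing {q : HeightOneSpectrum (𝓞 K)} {f : K[X]}
    (h : ∀ i, placeAbs (Sum.inl q) (f.coeff i) ≤ 1) :
    ∃ F : (valRing q)[X], F.map (algebraMap (valRing q) K) = f := by
  rw [← mem_lifts, lifts_iff_coeff_lifts]
  exact fun i => ⟨⟨f.coeff i, (mem_valRing_iff q _).2 (h i)⟩, rfl⟩

lemma map_residue_eq_iff {q : HeightOneSpectrum (𝓞 K)} (F G : (valRing q)[X]) :
    F.map (residue _) = G.map (residue _) ↔
      CongrAt q (F.map (algebraMap (valRing q) K)) (G.map (algebraMap (valRing q) K)) := by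
  rw [← sub_eq_zero, ← Polynomial.map_sub, CongrAt, Polynomial.ext_iff]
  refine forall_congr' fun i => ?_
  rw [coeff_map, coeff_zero, residue_valRing_eq_zero_iff, ← Polynomial.map_sub, coeff_map]
  rfl

lemma CongrAt.exists_lift {q : HeightOneSpectrum (𝓞 K)} {f : K[X]} {G : (valRing q)[X]}
    (h : CongrAt q f (G.map (algebraMap (valRing q) K))) :
    ∃ F : (valRing q)[X], F.map (algebraMap (valRing q) K) = f ∧
      F.map (residue _) = G.map (residue _) := by
  obtain ⟨F, hF⟩ := exists_lift_valRing (q := q) (f := f) fun i => by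
    have h1 : f.coeff i = (f - G.map (algebraMap (valRing q) K)).coeff i + (G.coeff i : K) := by
      rw [coeff_sub, coeff_map]
      exact (sub_add_cancel _ _).symm
    rw [h1]
    exact (placeAbs_finite_add_le q _ _).trans
      (max_le (h i).le ((mem_valRing_iff q _).1 (G.coeff i).2))
  exact ⟨F, hF, (map_residue_eq_iff F G).2 (hF ▸ h)⟩

lemma natCast_residue_ne_zero {q : HeightOneSpectrum (𝓞 K)} {j : ℕ} (h : (j : 𝓞 K) ∉ q.asIdeal) :
    (j : ResidueField (valRing q)) ≠ 0 := by
  intro h0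
  rw [← map_natCast (residue (valRing q)), residue_valRing_eq_zero_iff] at h0
  refine h ((placeAbs_algebraMap_lt_one_iff q _).1 ?_)
  simpa using h0

/-- Local behaviour of Mestre's pencil at a prime where `P` is congruent to `X ^ N - 1`. -/
lemma exists_pencil_congrAt {m : ℕ} (hm : 0 < m) {q : HeightOneSpectrum (𝓞 K)}
    (hq : ∀ j : ℕ, 0 < j → j ≤ 2 * m + 1 → (j : 𝓞 K) ∉ q.asIdeal) {P R Q : K[X]} (hP : P.Monic)
    (hPq : CongrAt q P (X ^ (2 * m + 1) - 1)) (hR0 : R ≠ 0) (hRd : R.degree < (2 * m + 1 : ℕ))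
    (hQd : Q.degree < (2 * m + 1 : ℕ))
    (hR : P ∣ derivative (derivative P) * R - 2 * derivative P * derivative R)
    (hW : derivative P * Q - P * derivative Q = R ^ 2) :
    IsCoprime P Q ∧ ∀ b : 𝓞 K, ∃ t₀ : K, ∃ δ > 0, ∀ t : K, placeAbs (Sum.inl q) (t - t₀) < δ →
      CongrAt q (P - C t * Q) (X ^ (2 * m + 1) - C (algebraMap (𝓞 K) K b)) := by
  have hk : ∀ j : ℕ, 0 < j → j ≤ 2 * m + 1 → (j : ResidueField (valRing q)) ≠ 0 :=
    fun j h1 h2 => natCast_residue_ne_zero (hq j h1 h2)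
  obtain ⟨P₀, hP₀, hP₀r⟩ := CongrAt.exists_lift (G := X ^ (2 * m + 1) - 1) (f := P) (q := q)
    (by simpa using hPq)
  have hP₀m : P₀.Monic := monic_of_injective (IsFractionRing.injective (valRing q) K) (hP₀ ▸ hP)
  subst hP₀
  obtain ⟨c, hc, Q₁, hQ₁, κ, hκ, hQ₁r⟩ := exists_partner_reduction hm hk hP₀m
    (by simpa using hP₀r) hR0 hRd hQd hR hW
  have hcop : IsCoprime (P₀.map (algebraMap (valRing q) K)) Q := by
    have h1 := isCoprime_of_reduction (K := K) (G := Q₁) hP₀m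
      (by rw [hQ₁r]; exact ⟨0, C κ⁻¹, by rw [zero_mul, zero_add, ← C_mul, inv_mul_cancel₀ hκ, C_1]⟩)
    rw [hQ₁] at h1
    exact h1.of_mul_right_right
  refine ⟨hcop, fun b => ?_⟩
  have hbm : algebraMap (𝓞 K) K b ∈ valRing q :=
    (mem_valRing_iff q _).2 (placeAbs_algebraMap_le_one q b)
  -- With `tQ = βQ₁`, that is `t = βc`, the pencil reduces to `X^N - 1 - βκ`; this is `X^N - b`
  -- exactly when `βκ = b - 1`.
  obtain ⟨β, hβ⟩ := residue_surjective (R := valRing q)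
    ((residue _ ⟨_, hbm⟩ - 1) / κ)
  set M := polyNorm (placeAbs (Sum.inl q)) Q
  have hM : 0 ≤ M := apply_nonneg _ _
  refine ⟨β * c, 1 / (M + 1), by positivity, fun t ht => ?_⟩
  have h1 : CongrAt q (P₀.map (algebraMap (valRing q) K) - C t * Q)
      (P₀.map (algebraMap (valRing q) K) - C ((β : K) * c) * Q) := by
    refine congrAt_of_polyNorm_lt ?_
    have : P₀.map (algebraMap (valRing q) K) - C t * Q -
        (P₀.map (algebraMap (valRing q) K) - C ((β : K) * c) * Q) = C ((β : K) * c - t) * Q := by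
      rw [C_sub]; ring
    rw [this, polyNorm_C_mul, AbsoluteValue.map_sub]
    rw [lt_div_iff₀ (by positivity)] at ht
    have := (placeAbs (Sum.inl q)).nonneg (t - β * c)
    nlinarith
  refine h1.trans ?_
  have h2 : P₀.map (algebraMap (valRing q) K) - C ((β : K) * c) * Q =
      (P₀ - C β * Q₁).map (algebraMap (valRing q) K) := by
    rw [Polynomial.map_sub, Polynomial.map_mul, map_C, hQ₁, C_mul, mul_assoc]
    rfl
  have h3 : (X ^ (2 * m + 1) - C (algebraMap (𝓞 K) K b) : K[X]) =
      (X ^ (2 * m + 1) - C (⟨_, hbm⟩ : valRing q)).map (algebraMap (valRing q) K) := by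
    simp only [Polynomial.map_sub, Polynomial.map_pow, map_X, map_C]
    rfl
  rw [h2, h3, ← map_residue_eq_iff]
  simp only [Polynomial.map_sub, Polynomial.map_mul, Polynomial.map_pow, map_X, map_C, hP₀r, hβ,
    hQ₁r, ← C_mul, div_mul_cancel₀ _ hκ, Polynomial.map_one]
  simp

end Congruence
end AnLocal

namespace AnLocal

open Polynomial IsLocalRing IsDedekindDomain

/-! ### Choosing a member of the pencil by weak approximation -/

section Step

variable {K : Type*} [Field K] [NumberField K]

lemma SquareDisc.exists_mestre {n : ℕ} (hn : Odd n) {P : K[X]} (hP : SquareDisc n P) :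
    ∃ R Q : K[X], R ≠ 0 ∧ R.degree < n ∧ Q.degree < n ∧
      P ∣ derivative (derivative P) * R - 2 * derivative P * derivative R ∧
      derivative P * Q - P * derivative Q = R ^ 2 := by
  obtain ⟨a, ha, hPa, -⟩ := hP
  obtain ⟨R, hR0, hRd, hR⟩ := exists_mestre_root hn P a ha hPa
  obtain ⟨Q, hQd, hQ⟩ := exists_mestre_partner P R (monic_of_map_eq_prod hPa)
    (natDegree_of_map_eq_prod hPa) (separable_of_map_eq_prod hPa ha) hRd hR
  exact ⟨R, Q, hR0, hRd, hQd, hR, hQ⟩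

instance (q : HeightOneSpectrum (𝓞 K)) : q.asIdeal.IsMaximal := q.isMaximal

noncomputable instance (q : HeightOneSpectrum (𝓞 K)) : Field (𝓞 K ⧸ q.asIdeal) :=
  Ideal.Quotient.field _

/-- The inclusion of `𝓞 K` into the valuation ring of `q`. -/
noncomputable def toValRing (q : HeightOneSpectrum (𝓞 K)) : 𝓞 K →+* valRing q :=
  (algebraMap (𝓞 K) K).codRestrict (valRing q).toSubring fun x =>
    (mem_valRing_iff q _).2 (placeAbs_algebraMap_le_one q x)

lemma algebraMap_comp_toValRing (q : HeightOneSpectrum (𝓞 K)) :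
    (algebraMap (valRing q) K).comp (toValRing q) = algebraMap (𝓞 K) K := rfl

/-- The embedding of residue fields `𝓞 K ⧸ q → ResidueField (valRing q)`. -/
noncomputable def quotientToResidue (q : HeightOneSpectrum (𝓞 K)) :
    𝓞 K ⧸ q.asIdeal →+* ResidueField (valRing q) :=
  Ideal.Quotient.lift _ ((residue _).comp (toValRing q)) fun x hx =>
    (residue_valRing_eq_zero_iff q _).2 ((placeAbs_algebraMap_lt_one_iff q x).2 hx)

lemma separable_of_congrAt {q : HeightOneSpectrum (𝓞 K)} {f : K[X]} (hf : f.Monic) {g : (𝓞 K)[X]}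
    (h : CongrAt q f (g.map (algebraMap (𝓞 K) K)))
    (hg : (g.map (Ideal.Quotient.mk q.asIdeal)).Separable) : f.Separable := by
  rw [← algebraMap_comp_toValRing q, ← Polynomial.map_map] at h
  obtain ⟨F, rfl, hFr⟩ := h.exists_lift
  have hFm : F.Monic := monic_of_injective (IsFractionRing.injective (valRing q) K) hf
  refine separable_of_reduction hFm ?_
  rw [hFr, Polynomial.map_map]
  have := hg.map (f := quotientToResidue q)
  rwa [Polynomial.map_map] at this

lemma exists_eps_polyNorm_C_mul (S : Finset (Place K)) (Q : K[X]) {ε : ℝ} (hε : 0 < ε) :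
    ∃ δ > 0, ∀ v ∈ S, ∀ t, placeAbs v t < δ → polyNorm (placeAbs v) (C t * Q) < ε := by
  set M := ∑ v ∈ S, polyNorm (placeAbs v) Q
  have hM : 0 ≤ M := Finset.sum_nonneg fun v _ => apply_nonneg _ _
  refine ⟨ε / (M + 1), by positivity, fun v hv t ht => ?_⟩
  have h1 : polyNorm (placeAbs v) Q ≤ M :=
    Finset.single_le_sum (f := fun v => polyNorm (placeAbs v) Q) (fun v _ => apply_nonneg _ _) hv
  rw [polyNorm_C_mul]
  rw [lt_div_iff₀ (by positivity)] at ht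
  have := (placeAbs v).nonneg t
  nlinarith

/-- Members of Mestre's pencil with prescribed local behaviour. -/
lemma SquareDisc.exists_near {m : ℕ} (hm : 0 < m) {P : K[X]} (hP : SquareDisc (2 * m + 1) P)
    (S : Finset (Place K)) (T : Finset (HeightOneSpectrum (𝓞 K))) (hT : T.Nonempty)
    (hTS : ∀ q ∈ T, Sum.inl q ∉ S)
    (hq : ∀ q ∈ T, ∀ j : ℕ, 0 < j → j ≤ 2 * m + 1 → (j : 𝓞 K) ∉ q.asIdeal)
    (hPq : ∀ q ∈ T, CongrAt q P (X ^ (2 * m + 1) - 1)) (b : HeightOneSpectrum (𝓞 K) → 𝓞 K)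
    (hb : ∀ q ∈ T, b q ∉ q.asIdeal) {ε : ℝ} (hε : 0 < ε) :
    ∃ F, SquareDisc (2 * m + 1) F ∧ (∀ v ∈ S, polyNorm (placeAbs v) (F - P) < ε) ∧
      ∀ q ∈ T, CongrAt q F (X ^ (2 * m + 1) - C (algebraMap (𝓞 K) K (b q))) := by
  classical
  obtain ⟨R, Q, hR0, hRd, hQd, hR, hW⟩ := hP.exists_mestre (odd_two_mul_add_one m)
  have hloc := fun q (hqT : q ∈ T) => exists_pencil_congrAt hm (hq q hqT) hP.monic (hPq q hqT)
    hR0 hRd hQd hR hW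
  have h1 : ∀ q : HeightOneSpectrum (𝓞 K), ∃ t₀ : K, ∃ δ > 0, q ∈ T → ∀ t : K,
      placeAbs (Sum.inl q) (t - t₀) < δ →
      CongrAt q (P - C t * Q) (X ^ (2 * m + 1) - C (algebraMap (𝓞 K) K (b q))) := fun q => by
    by_cases hqT : q ∈ T
    · obtain ⟨t₀, δ, hδ, h⟩ := (hloc q hqT).2 (b q)
      exact ⟨t₀, δ, hδ, fun _ => h⟩
    · exact ⟨0, 1, one_pos, fun h => absurd h hqT⟩
  choose t₀ δ hδ h using h1
  obtain ⟨δ', hδ', h'⟩ := exists_eps_polyNorm_C_mul S Q hε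
  obtain ⟨q₀, hq₀⟩ := hT
  set η := min δ' (T.inf' ⟨q₀, hq₀⟩ δ) with hη
  have hη0 : 0 < η := lt_min hδ' ((Finset.lt_inf'_iff _).2 fun q _ => hδ q)
  -- Near `0` on `S`, so that the member stays close to `P`; near the locally required parameter at
  -- each prime of `T`.
  obtain ⟨t, ht⟩ := exists_approx (S ∪ T.image Sum.inl)
    (fun v => if v ∈ S then 0 else Sum.elim t₀ (fun _ => 0) v) hη0
  have hTt : ∀ q ∈ T, CongrAt q (P - C t * Q)
      (X ^ (2 * m + 1) - C (algebraMap (𝓞 K) K (b q))) := fun q hqT => by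
    refine h q hqT t ?_
    have := ht (Sum.inl q) (Finset.mem_union_right _ (Finset.mem_image_of_mem _ hqT))
    rw [if_neg (hTS q hqT)] at this
    exact this.trans_le ((min_le_right _ _).trans (Finset.inf'_le _ hqT))
  have hlt : (C t * Q).degree < P.degree := by
    rw [degree_eq_natDegree hP.monic.ne_zero, hP.natDegree]
    rw [← smul_eq_C_mul]
    exact (degree_smul_le t Q).trans_lt hQd
  refine ⟨P - C t * Q, hP.pencil hW hQd (hloc q₀ hq₀).1 t ?_, fun v hv => ?_, hTt⟩
  · refine separable_of_congrAt (hP.monic.sub_of_left hlt) (q := q₀)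
      (g := X ^ (2 * m + 1) - C (b q₀)) (by simpa using hTt q₀ hq₀) ?_
    rw [Polynomial.map_sub, Polynomial.map_pow, map_X, map_C]
    refine separable_X_pow_sub_C _ ?_ ?_
    · rw [← map_natCast (Ideal.Quotient.mk q₀.asIdeal), Ne, Ideal.Quotient.eq_zero_iff_mem]
      exact hq q₀ hq₀ _ (by omega) le_rfl
    · rw [Ne, Ideal.Quotient.eq_zero_iff_mem]; exact hb q₀ hq₀
  · rw [← neg_sub, map_neg_eq_map, sub_sub_cancel]
    refine h' v hv t ?_
    have := ht v (Finset.mem_union_left _ hv)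
    rw [if_pos hv, sub_zero] at this
    exact this.trans_le (min_le_left _ _)

end Step
end AnLocal

namespace AnLocal

open Polynomial IsDedekindDomain

/-! ### Auxiliary primes and factorisation of reductions -/

section Witness

lemma natCast_quotient_ne_zero {K : Type*} [Field K] {q : HeightOneSpectrum (𝓞 K)} {j : ℕ} (h : (j : 𝓞 K) ∉ q.asIdeal) :
    (j : 𝓞 K ⧸ q.asIdeal) ≠ 0 := by
  rwa [← map_natCast (Ideal.Quotient.mk q.asIdeal), Ne, Ideal.Quotient.eq_zero_iff_mem]

variable {K : Type*} [Field K] [NumberField K]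

/-- Modulo the prime `q`, the polynomial `f` is separable and the product of an irreducible factor
of degree `k` and of linear factors. -/
def HasCycleAt (k : ℕ) (f : K[X]) (q : HeightOneSpectrum (𝓞 K)) : Prop :=
  ∃ f₀ : (𝓞 K)[X], CongrAt q f (f₀.map (algebraMap (𝓞 K) K)) ∧
    (f₀.map (Ideal.Quotient.mk q.asIdeal)).Separable ∧
    ∃ h : (𝓞 K ⧸ q.asIdeal)[X], Irreducible h ∧ h.natDegree = k ∧
      ∃ s : Multiset (𝓞 K ⧸ q.asIdeal),
        f₀.map (Ideal.Quotient.mk q.asIdeal) = h * (s.map fun c => X - C c).prod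

lemma HasCycleAt.congr {k : ℕ} {f g : K[X]} {q : HeightOneSpectrum (𝓞 K)} (h : HasCycleAt k g q)
    (hfg : CongrAt q f g) : HasCycleAt k f q :=
  let ⟨f₀, h₁, h₂⟩ := h; ⟨f₀, hfg.trans h₁, h₂⟩

lemma HasCycleAt.separable {k : ℕ} {f : K[X]} {q : HeightOneSpectrum (𝓞 K)} (h : HasCycleAt k f q)
    (hf : f.Monic) : f.Separable :=
  let ⟨_, h₁, h₂, _⟩ := h; separable_of_congrAt hf h₁ h₂

instance (q : HeightOneSpectrum (𝓞 K)) : Finite (𝓞 K ⧸ q.asIdeal) :=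
  q.asIdeal.finiteQuotientOfFreeOfNeBot q.ne_bot

lemma CongrAt.mul {q : HeightOneSpectrum (𝓞 K)} {f g : K[X]} {f₀ g₀ : (𝓞 K)[X]}
    (h : CongrAt q f (f₀.map (algebraMap (𝓞 K) K))) (h' : CongrAt q g (g₀.map (algebraMap (𝓞 K) K))) :
    CongrAt q (f * g) ((f₀ * g₀).map (algebraMap (𝓞 K) K)) := by
  rw [← algebraMap_comp_toValRing q, ← Polynomial.map_map] at h h' ⊢
  obtain ⟨F, rfl, hF⟩ := h.exists_lift
  obtain ⟨G, rfl, hG⟩ := h'.exists_lift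
  rw [← Polynomial.map_mul, ← map_residue_eq_iff, Polynomial.map_mul, hF, hG, Polynomial.map_mul,
    Polynomial.map_mul]

lemma congrAt_X_sub_C {q : HeightOneSpectrum (𝓞 K)} {x : K} {c : 𝓞 K}
    (h : placeAbs (Sum.inl q) (x - algebraMap (𝓞 K) K c) < 1) :
    CongrAt q (X - C x) ((X - C c).map (algebraMap (𝓞 K) K)) := by
  refine congrAt_of_polyNorm_lt ?_
  rw [Polynomial.map_sub, map_X, map_C, sub_sub_sub_cancel_left, ← C_sub, polyNorm_C,
    AbsoluteValue.map_sub]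
  exact h

lemma map_quotient_eq_of_congrAt {q : HeightOneSpectrum (𝓞 K)} {f : K[X]} {f₀ f₁ : (𝓞 K)[X]}
    (h₀ : CongrAt q f (f₀.map (algebraMap (𝓞 K) K)))
    (h₁ : CongrAt q f (f₁.map (algebraMap (𝓞 K) K))) :
    f₀.map (Ideal.Quotient.mk q.asIdeal) = f₁.map (Ideal.Quotient.mk q.asIdeal) := by
  ext i
  rw [coeff_map, coeff_map, Ideal.Quotient.eq, ← placeAbs_algebraMap_lt_one_iff]
  simpa using (h₀.symm.trans h₁) i

/-- Multiplying by a new linear factor preserves cycles. -/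
lemma HasCycleAt.exists_mul {f : K[X]} {q : HeightOneSpectrum (𝓞 K)}
    (hd : f.natDegree < Nat.card (𝓞 K ⧸ q.asIdeal)) :
    ∃ c : 𝓞 K, ∀ x : K, placeAbs (Sum.inl q) (x - algebraMap (𝓞 K) K c) < 1 →
      ∀ k, HasCycleAt k f q → HasCycleAt k (f * (X - C x)) q := by
  classical
  by_cases hall : ∀ k, ¬HasCycleAt k f q
  · exact ⟨0, fun _ _ k h => absurd h (hall k)⟩
  push Not at hall
  obtain ⟨-, f₀, h₁, h₂, -⟩ := hall
  have hne : f₀.map (Ideal.Quotient.mk q.asIdeal) ≠ 0 := h₂.ne_zero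
  have hdeg : (f₀.map (Ideal.Quotient.mk q.asIdeal)).natDegree ≤ f.natDegree := by
    rw [natDegree_le_iff_coeff_eq_zero]
    intro N hN
    rw [coeff_map, Ideal.Quotient.eq_zero_iff_mem, ← placeAbs_algebraMap_lt_one_iff]
    have := h₁ N
    rwa [coeff_sub, coeff_eq_zero_of_natDegree_lt hN, zero_sub, AbsoluteValue.map_neg,
      coeff_map] at this
  have := Fintype.ofFinite (𝓞 K ⧸ q.asIdeal)
  obtain ⟨c', hc'⟩ : ∃ c', c' ∉ (f₀.map (Ideal.Quotient.mk q.asIdeal)).roots.toFinset := by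
    by_contra! hall
    have h3 := Finset.card_le_card (fun x _ => hall x : Finset.univ ⊆
      (f₀.map (Ideal.Quotient.mk q.asIdeal)).roots.toFinset)
    rw [Finset.card_univ, ← Nat.card_eq_fintype_card] at h3
    have h4 := (Multiset.toFinset_card_le _).trans
      (card_roots' (f₀.map (Ideal.Quotient.mk q.asIdeal)))
    omega
  obtain ⟨c, rfl⟩ := Ideal.Quotient.mk_surjective c'
  refine ⟨c, fun x hx k hk => ?_⟩
  obtain ⟨f₁, h₁', -, h, hh, hk, s, hs⟩ := hk
  rw [map_quotient_eq_of_congrAt h₁' h₁] at hs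
  refine ⟨f₀ * (X - C c), h₁.mul (congrAt_X_sub_C hx), ?_, h, hh, hk, Ideal.Quotient.mk _ c ::ₘ s, ?_⟩
  · rw [Polynomial.map_mul, Polynomial.map_sub, map_X, map_C]
    refine h₂.mul (separable_X_sub_C) ?_
    refine IsCoprime.symm ((irreducible_X_sub_C _).coprime_iff_not_dvd.2 fun hd => hc' ?_)
    rw [Multiset.mem_toFinset, mem_roots hne]
    exact dvd_iff_isRoot.1 hd
  · rw [Polynomial.map_mul, hs, Polynomial.map_sub, map_X, map_C, Multiset.map_cons,
      Multiset.prod_cons]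
    ring

lemma hasCycleAt_X_pow_sub_C {n : ℕ} {q : HeightOneSpectrum (𝓞 K)} (hn : (n : 𝓞 K) ∉ q.asIdeal)
    {b : 𝓞 K} (hb : b ∉ q.asIdeal)
    (hirr : Irreducible (X ^ n - C (Ideal.Quotient.mk q.asIdeal b))) {f : K[X]}
    (hf : CongrAt q f (X ^ n - C (algebraMap (𝓞 K) K b))) : HasCycleAt n f q := by
  refine ⟨X ^ n - C b, by simpa using hf, ?_, _, hirr, natDegree_X_pow_sub_C, 0, by simp⟩
  rw [Polynomial.map_sub, Polynomial.map_pow, map_X, map_C]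
  exact separable_X_pow_sub_C _ (natCast_quotient_ne_zero hn)
    (by rwa [Ne, Ideal.Quotient.eq_zero_iff_mem])

/-- A finite field with `card ≡ 1 [MOD n]` contains an element `b` with `X ^ n - b` irreducible. -/
lemma exists_irreducible_X_pow_sub_C {k : Type*} [Field k] [Finite k] {n : ℕ} (hn : Odd n)
    (h : Nat.card k ≡ 1 [MOD n]) : ∃ b : k, b ≠ 0 ∧ Irreducible (X ^ n - C b) := by
  obtain ⟨g, hg⟩ := IsCyclic.exists_generator (α := kˣ)
  -- A generator of the unit group is not a `p`-th power for any prime `p ∣ n`, because such `p`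
  -- divides the order of that group. For odd `n` this is enough for `X^n - g` to be irreducible.
  refine ⟨g, g.ne_zero, X_pow_sub_C_irreducible_of_odd hn fun p hp hpn b hb => ?_⟩
  have hcard : Nat.card kˣ = Nat.card k - 1 := Nat.card_units k
  have hpd : p ∣ Nat.card kˣ := by
    rw [hcard]
    exact (Nat.modEq_iff_dvd' Nat.card_pos).1 ((h.of_dvd hpn).symm)
  have hb0 : b ≠ 0 := by
    rintro rfl
    rw [zero_pow hp.ne_zero] at hb
    exact g.ne_zero hb.symm
  obtain ⟨d, hd⟩ := hpd
  have h1 : g ^ d = 1 := by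
    have : g = Units.mk0 b hb0 ^ p := Units.ext hb.symm
    rw [this, ← pow_mul, ← hd]; exact pow_card_eq_one'
  have h2 := orderOf_dvd_of_pow_eq_one h1
  rw [orderOf_eq_card_of_forall_mem_zpowers hg, hd] at h2
  have hd0 : 0 < d := Nat.pos_of_ne_zero fun h => by
    have : 0 < Nat.card kˣ := Nat.card_pos
    rw [hd, h] at this; simp at this
  have := Nat.le_of_dvd hd0 h2
  have := hp.two_le
  nlinarith

lemma card_quotient_eq_pow {ℓ : ℕ} (hℓ : ℓ.Prime) {q : HeightOneSpectrum (𝓞 K)}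
    (h : (ℓ : 𝓞 K) ∈ q.asIdeal) : ∃ e ≠ 0, Nat.card (𝓞 K ⧸ q.asIdeal) = ℓ ^ e := by
  have := Fintype.ofFinite (𝓞 K ⧸ q.asIdeal)
  obtain ⟨p, hp, n, hpp, hn⟩ := FiniteField.card' (𝓞 K ⧸ q.asIdeal)
  have h1 : (ℓ : 𝓞 K ⧸ q.asIdeal) = 0 := by
    rwa [← map_natCast (Ideal.Quotient.mk q.asIdeal), Ideal.Quotient.eq_zero_iff_mem]
  have h2 := (Nat.prime_dvd_prime_iff_eq hpp hℓ).1 ((CharP.cast_eq_zero_iff _ p ℓ).1 h1)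
  exact ⟨n, n.ne_zero, by rw [Nat.card_eq_fintype_card, hn, h2]⟩

lemma exists_prime_above {ℓ : ℕ} (hℓ : ℓ.Prime) : ∃ q : HeightOneSpectrum (𝓞 K),
    (ℓ : 𝓞 K) ∈ q.asIdeal := by
  have h : Ideal.span {(ℓ : 𝓞 K)} ≠ ⊤ := by
    rw [Ne, Ideal.span_singleton_eq_top]
    intro hu
    have h2 := hu.map (Algebra.norm ℤ)
    rw [← map_natCast (algebraMap ℤ (𝓞 K)), Algebra.norm_algebraMap] at h2
    rw [isUnit_pow_iff (finrank_pos (R := ℤ) (M := 𝓞 K)).ne'] at h2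
    exact (Nat.prime_iff_prime_int.1 hℓ).not_isUnit h2
  obtain ⟨M, hM, hle⟩ := Ideal.exists_le_maximal _ h
  have hmem : (ℓ : 𝓞 K) ∈ M := hle (Ideal.mem_span_singleton_self _)
  refine ⟨⟨M, hM.isPrime, fun hb => ?_⟩, hmem⟩
  rw [hb, Ideal.mem_bot] at hmem
  exact hℓ.ne_zero (by exact_mod_cast hmem)

/-- A supply of rational primes all of whose prime factors in `K` are new and have
residue fields with many elements, containing the `N`-th roots of unity. -/
lemma exists_rational_prime {N : ℕ} (hN : N ≠ 0) (S : Finset (Place K)) (M : ℕ) :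
    ∃ ℓ : ℕ, ℓ.Prime ∧ M < ℓ ∧ ∀ q : HeightOneSpectrum (𝓞 K), (ℓ : 𝓞 K) ∈ q.asIdeal →
      Sum.inl q ∉ S ∧ Nat.card (𝓞 K ⧸ q.asIdeal) ≡ 1 [MOD N] ∧ M < Nat.card (𝓞 K ⧸ q.asIdeal) ∧
      ∀ j : ℕ, 0 < j → j ≤ M → (j : 𝓞 K) ∉ q.asIdeal := by
  set B := ∑ v ∈ S, Sum.elim (fun q : HeightOneSpectrum (𝓞 K) => Nat.card (𝓞 K ⧸ q.asIdeal))
    (fun _ => 0) v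
  -- `B` bounds the residue fields of all finite primes in `S`, and a prime above `ℓ` has residue
  -- field of order `ℓ^e ≥ ℓ > B`. From `ℓ ≡ 1` modulo `N` follows `ℓ^e ≡ 1`.
  obtain ⟨ℓ, hℓ, hgt, hmod⟩ := Nat.exists_prime_gt_modEq_one (max B M) hN
  refine ⟨ℓ, hℓ, (le_max_right _ _).trans_lt hgt, fun q hq => ?_⟩
  obtain ⟨e, he, hcard⟩ := card_quotient_eq_pow hℓ hq
  have hle : ℓ ≤ Nat.card (𝓞 K ⧸ q.asIdeal) := hcard ▸ Nat.le_self_pow he ℓ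
  refine ⟨fun hqS => ?_, ?_, ((le_max_right _ _).trans_lt hgt).trans_le hle, fun j hj hjM hjq => ?_⟩
  · have h1 : Nat.card (𝓞 K ⧸ q.asIdeal) ≤ B :=
      Finset.single_le_sum (f := Sum.elim (fun q : HeightOneSpectrum (𝓞 K) =>
        Nat.card (𝓞 K ⧸ q.asIdeal)) (fun _ => 0)) (fun _ _ => Nat.zero_le _) hqS
    have := le_max_left B M
    omega
  · rw [hcard]; simpa using hmod.pow e
  · have hcop : IsCoprime (j : ℤ) (ℓ : ℤ) := by
      rw [Nat.isCoprime_iff_coprime]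
      refine Nat.Coprime.symm ((Nat.Prime.coprime_iff_not_dvd hℓ).2 fun hd => ?_)
      have := Nat.le_of_dvd hj hd
      have := le_max_right B M
      omega
    have hcop' := hcop.map (Int.castRingHom (𝓞 K))
    simp only [eq_intCast, Int.cast_natCast] at hcop'
    obtain ⟨u, w, huw⟩ := hcop'
    refine q.isPrime.ne_top ((Ideal.eq_top_iff_one _).2 ?_)
    rw [← huw]
    exact Ideal.add_mem _ (Ideal.mul_mem_left _ _ hjq) (Ideal.mul_mem_left _ _ hq)

end Witness
end AnLocal

namespace AnLocal

open Polynomial IsDedekindDomain Matrix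

/-! ### Quartics with square discriminant from cubics -/

section Quartic

/-- The quartic polynomial with cubic resolvent related to `g`, translated by `s`. -/
noncomputable def quarticOf {R : Type*} [CommRing R] (g : R[X]) (s : R) : R[X] :=
  (X - C s) ^ 4 - C (2 * g.coeff 1) * (X - C s) ^ 2 + C (8 * g.coeff 0) * (X - C s) +
    C (g.coeff 1 ^ 2 - 4 * g.coeff 2 * g.coeff 0)

lemma quarticOf_map {R S : Type*} [CommRing R] [CommRing S] (φ : R →+* S) (g : R[X]) (s : R) :
    (quarticOf g s).map φ = quarticOf (g.map φ) (φ s) := by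
  simp only [quarticOf, Polynomial.map_add, Polynomial.map_sub, Polynomial.map_mul,
    Polynomial.map_pow, map_X, map_C, coeff_map, map_mul, map_sub, map_pow, map_ofNat,
    Polynomial.map_ofNat]

lemma prod_three_coeff {R : Type*} [CommRing R] (γ : Fin 3 → R) :
    (∏ i, (X - C (γ i))).coeff 0 = -(γ 0 * γ 1 * γ 2) ∧
    (∏ i, (X - C (γ i))).coeff 1 = γ 0 * γ 1 + γ 0 * γ 2 + γ 1 * γ 2 ∧
    (∏ i, (X - C (γ i))).coeff 2 = -(γ 0 + γ 1 + γ 2) := by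
  have h : ∏ i, (X - C (γ i)) = X ^ 3 + C (-(γ 0 + γ 1 + γ 2)) * X ^ 2 +
      C (γ 0 * γ 1 + γ 0 * γ 2 + γ 1 * γ 2) * X + C (-(γ 0 * γ 1 * γ 2)) := by
    rw [Fin.prod_univ_three]
    simp only [C_add, C_mul, C_neg]
    ring
  rw [h]
  refine ⟨?_, ?_, ?_⟩ <;>
    simp only [coeff_add, coeff_C_mul, coeff_X, coeff_C, coeff_X_pow] <;> norm_num

/-- The four numbers attached to three square roots. -/
def quarticRoot {R : Type*} [CommRing R] (s : R) (u : Fin 3 → R) : Fin 4 → R :=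
  ![s + u 0 + u 1 + u 2, s + u 0 - u 1 - u 2, s - u 0 + u 1 - u 2, s - u 0 - u 1 + u 2]

/-- If `uᵢ² = γⱼγₖ`, the elementary symmetric functions of the `uᵢ²` are polynomials in the
coefficients of the cubic, so the quartic with roots `s ± u₀ ± u₁ ± u₂` (an even number of minus
signs) is determined by them and by `u₀u₁u₂`. The last hypothesis fixes the sign of that product. -/
lemma quarticOf_eq_prod {R : Type*} [CommRing R] (γ u : Fin 3 → R) (s : R)
    (h0 : u 0 ^ 2 = γ 1 * γ 2) (h1 : u 1 ^ 2 = γ 0 * γ 2) (h2 : u 2 ^ 2 = γ 0 * γ 1)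
    (h : u 0 * u 1 * u 2 = γ 0 * γ 1 * γ 2) :
    quarticOf (∏ i, (X - C (γ i))) s = ∏ i, (X - C (quarticRoot s u i)) := by
  obtain ⟨c0, c1, c2⟩ := prod_three_coeff γ
  rw [quarticOf, c0, c1, c2, Fin.prod_univ_four]
  have g0 := congrArg (C : R → R[X]) h0
  have g1 := congrArg (C : R → R[X]) h1
  have g2 := congrArg (C : R → R[X]) h2
  have g := congrArg (C : R → R[X]) h
  simp only [quarticRoot, Matrix.cons_val, C_add, C_sub, C_neg, C_mul, C_pow, C_ofNat] at *
  linear_combination (exp := 1) (2 * (X - C s) ^ 2) * (g0 + g1 + g2) + 8 * (X - C s) * g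
    - (C (u 0) ^ 2 + C (γ 1) * C (γ 2) - 2 * C (u 1) ^ 2 - 2 * C (u 2) ^ 2) * g0
    - (C (u 1) ^ 2 + C (γ 0) * C (γ 2) - 2 * (C (γ 1) * C (γ 2)) - 2 * C (u 2) ^ 2) * g1
    - (C (u 2) ^ 2 + C (γ 0) * C (γ 1) - 2 * (C (γ 1) * C (γ 2)) - 2 * (C (γ 0) * C (γ 2))) * g2

/-- The six differences of roots are `±2(uᵢ ± uⱼ)`, so their product is `64` times that of the `uᵢ²
- uⱼ²`, and `uᵢ² - uⱼ² = γₖ(γⱼ - γᵢ)`. -/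
lemma vandermonde_quarticRoot {R : Type*} [CommRing R] (γ u : Fin 3 → R) (s : R)
    (h0 : u 0 ^ 2 = γ 1 * γ 2) (h1 : u 1 ^ 2 = γ 0 * γ 2) (h2 : u 2 ^ 2 = γ 0 * γ 1) :
    (vandermonde (quarticRoot s u)).det =
      64 * (γ 0 * γ 1 * γ 2) * (vandermonde γ).det := by
  have e1 : (vandermonde (quarticRoot s u)).det =
      64 * ((u 0 ^ 2 - u 1 ^ 2) * (u 0 ^ 2 - u 2 ^ 2) * (u 1 ^ 2 - u 2 ^ 2)) := by
    rw [det_vandermonde]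
    simp [Fin.prod_univ_succ, quarticRoot, Fin.prod_Ioi_succ]
    ring
  rw [e1, h0, h1, h2, det_vandermonde]
  simp [Fin.prod_univ_succ, Fin.prod_Ioi_succ]
  ring

lemma SquareDisc.quarticOf {K : Type*} [Field K] [CharZero K] {g : K[X]} (hg : SquareDisc 3 g)
    (h0 : g.coeff 0 ≠ 0) (s : K) : SquareDisc 4 (quarticOf g s) := by
  obtain ⟨γ, hγ, hgγ, δ, hδ⟩ := hg
  have hc : algebraMap K (AlgebraicClosure K) (g.coeff 0) = -(γ 0 * γ 1 * γ 2) := by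
    rw [← coeff_map, hgγ, (prod_three_coeff γ).1]
  have hne : γ 0 * γ 1 * γ 2 ≠ 0 := by
    intro h
    rw [h, neg_zero] at hc
    exact h0 (by simpa using hc)
  have hγ0 : γ 0 ≠ 0 := left_ne_zero_of_mul (left_ne_zero_of_mul hne)
  have hγ1 : γ 1 ≠ 0 := right_ne_zero_of_mul (left_ne_zero_of_mul hne)
  have hγ2 : γ 2 ≠ 0 := right_ne_zero_of_mul hne
  obtain ⟨u0, h0⟩ := IsAlgClosed.exists_pow_nat_eq (γ 1 * γ 2) (n := 2) two_pos
  obtain ⟨u1, h1⟩ := IsAlgClosed.exists_pow_nat_eq (γ 0 * γ 2) (n := 2) two_pos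
  have hu0 : u0 ≠ 0 := by rintro rfl; simp [hγ1, hγ2] at h0
  have hu1 : u1 ≠ 0 := by rintro rfl; simp [hγ0, hγ2] at h1
  -- Two square roots are arbitrary; the third is dictated by the condition on the product.
  let u : Fin 3 → AlgebraicClosure K := ![u0, u1, γ 0 * γ 1 * γ 2 / (u0 * u1)]
  have e0 : u 0 ^ 2 = γ 1 * γ 2 := h0
  have e1 : u 1 ^ 2 = γ 0 * γ 2 := h1
  have e2 : u 2 ^ 2 = γ 0 * γ 1 := by
    change (γ 0 * γ 1 * γ 2 / (u0 * u1)) ^ 2 = γ 0 * γ 1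
    rw [div_pow, mul_pow u0, h0, h1]
    field_simp
  have e : u 0 * u 1 * u 2 = γ 0 * γ 1 * γ 2 := by
    change u0 * u1 * (γ 0 * γ 1 * γ 2 / (u0 * u1)) = γ 0 * γ 1 * γ 2
    field_simp
  have hV := vandermonde_quarticRoot γ u (algebraMap K _ s) e0 e1 e2
  refine ⟨quarticRoot (algebraMap K _ s) u, ?_, ?_, -64 * g.coeff 0 * δ, ?_⟩
  · rw [← det_vandermonde_ne_zero_iff, hV]
    exact mul_ne_zero (mul_ne_zero (by norm_num) hne) (vandermonde_det_ne_zero hγ)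
  · rw [quarticOf_map, hgγ]
    exact quarticOf_eq_prod γ u _ e0 e1 e2 e
  · rw [hV, map_mul, map_mul, hc, hδ, map_neg, map_ofNat]
    ring

end Quartic

/-! ### Local targets and their dependence on parameters -/

section Target

variable {K : Type*} [Field K]

/-- Local data: the roots of a cubic resolvent, a translation, and further roots. -/
structure Target (K : Type*) where
  /-- the roots of the cubic resolvent -/
  γ : Fin 3 → K
  /-- the translation -/
  s : K
  /-- the further roots -/
  c : ℕ → K

/-- The polynomial of degree `k + 4` described by a target. -/
noncomputable def Target.poly (d : Target K) (k : ℕ) : K[X] :=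
  quarticOf (∏ i, (X - C (d.γ i))) d.s * ∏ j ∈ Finset.range k, (X - C (d.c j))

lemma Target.poly_succ (d : Target K) (k : ℕ) :
    d.poly (k + 1) = d.poly k * (X - C (d.c k)) := by
  rw [Target.poly, Target.poly, Finset.prod_range_succ, mul_assoc]

lemma exists_delta_mul (v : AbsoluteValue K ℝ) (f g : K[X]) {ε : ℝ} (hε : 0 < ε) :
    ∃ δ > 0, ∀ f' g', polyNorm v (f' - f) < δ → polyNorm v (g' - g) < δ →
      polyNorm v (f' * g' - f * g) < ε := by
  obtain ⟨δ, hδ, h⟩ := exists_delta_eval (polyNorm v)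
    (MvPolynomial.X 0 * MvPolynomial.X 1 : MvPolynomial (Fin 2) K[X]) ![f, g] hε
  refine ⟨δ, hδ, fun f' g' hf hg => ?_⟩
  have := h ![f', g'] (fun i => by fin_cases i <;> simpa)
  simpa using this

lemma exists_delta_mul_X_sub_C (v : AbsoluteValue K ℝ) (f : K[X]) (c : K) {ε : ℝ} (hε : 0 < ε) :
    ∃ δ > 0, ∀ f' c', polyNorm v (f' - f) < δ → v (c' - c) < δ →
      polyNorm v (f' * (X - C c') - f * (X - C c)) < ε := by
  obtain ⟨δ, hδ, h⟩ := exists_delta_mul v f (X - C c) hε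
  refine ⟨δ, hδ, fun f' c' hf hc => h _ _ hf ?_⟩
  rwa [sub_sub_sub_cancel_left, ← C_sub, polyNorm_C, AbsoluteValue.map_sub]

lemma exists_delta_prod_X_sub_C {n : ℕ} (v : AbsoluteValue K ℝ) (a : Fin n → K) {ε : ℝ}
    (hε : 0 < ε) : ∃ δ > 0, ∀ a' : Fin n → K, (∀ i, v (a' i - a i) < δ) →
      polyNorm v (∏ i, (X - C (a' i)) - ∏ i, (X - C (a i))) < ε := by
  obtain ⟨δ, hδ, h⟩ := exists_delta_eval (polyNorm v)
    (∏ i, (MvPolynomial.C X - MvPolynomial.X i) : MvPolynomial (Fin n) K[X]) (fun i => C (a i)) hε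
  refine ⟨δ, hδ, fun a' ha => ?_⟩
  have := h (fun i => C (a' i)) (fun i => by rw [← C_sub, polyNorm_C]; exact ha i)
  simpa using this

lemma exists_delta_quarticOf (v : AbsoluteValue K ℝ) (g : K[X]) (s : K) {ε : ℝ} (hε : 0 < ε) :
    ∃ δ > 0, ∀ g' s', polyNorm v (g' - g) < δ → v (s' - s) < δ →
      polyNorm v (quarticOf g' s' - quarticOf g s) < ε := by
  let y : K[X] → K → Fin 4 → K[X] := fun g s =>
    ![C (g.coeff 0), C (g.coeff 1), C (g.coeff 2), C s]
  let Φ : MvPolynomial (Fin 4) K[X] :=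
    (MvPolynomial.C X - MvPolynomial.X 3) ^ 4
      - 2 * MvPolynomial.X 1 * (MvPolynomial.C X - MvPolynomial.X 3) ^ 2
      + 8 * MvPolynomial.X 0 * (MvPolynomial.C X - MvPolynomial.X 3)
      + (MvPolynomial.X 1 ^ 2 - 4 * MvPolynomial.X 2 * MvPolynomial.X 0)
  have hΦ : ∀ g s, quarticOf g s = MvPolynomial.eval (y g s) Φ := fun g s => by
    simp [quarticOf, Φ, y, C_ofNat]
  obtain ⟨δ, hδ, h⟩ := exists_delta_eval (polyNorm v) Φ (y g s) hε
  refine ⟨δ, hδ, fun g' s' hg hs => ?_⟩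
  rw [hΦ, hΦ]
  have hc : ∀ i, polyNorm v (C (g'.coeff i) - C (g.coeff i)) < δ := fun i => by
    rw [← C_sub, polyNorm_C, ← coeff_sub]
    exact (coeff_le_polyNorm _ _ i).trans_lt hg
  refine h _ fun i => ?_
  fin_cases i
  · exact hc 0
  · exact hc 1
  · exact hc 2
  · change polyNorm v (C s' - C s) < δ
    rwa [← C_sub, polyNorm_C]

end Target
end AnLocal

namespace AnLocal

open Polynomial IsDedekindDomain Matrix

/-! ### Split polynomials as targets -/

section Induction

/-- The `n`-th roots of unity exist in residue fields. -/
lemma exists_roots_of_unity {k : Type*} [Field k] [Finite k] {n : ℕ} (hn : n ≠ 0)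
    (h : Nat.card k ≡ 1 [MOD n]) : ∃ z : ℕ → k, Set.InjOn z (Finset.range n) ∧
      ∏ i ∈ Finset.range n, (X - C (z i)) = (X ^ n - 1 : k[X]) := by
  classical
  obtain ⟨g, hg⟩ := IsCyclic.exists_generator (α := kˣ)
  have hcard : Nat.card kˣ = Nat.card k - 1 := Nat.card_units k
  have hnd : n ∣ Nat.card kˣ := hcard ▸ (Nat.modEq_iff_dvd' Nat.card_pos).1 h.symm
  obtain ⟨d, hd⟩ := hnd
  have hord : orderOf g = n * d := by rw [orderOf_eq_card_of_forall_mem_zpowers hg, hd]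
  have hpos : 0 < n * d := hd ▸ Nat.card_pos
  have hd0 : d ≠ 0 := by rintro rfl; simp at hpos
  have h1 : orderOf (g ^ d) = n := by
    rw [orderOf_pow_of_dvd hd0 (hord ▸ dvd_mul_left d n), hord, Nat.mul_div_cancel _ (by omega)]
  have hp : IsPrimitiveRoot ((g ^ d : kˣ) : k) n := by
    rw [IsPrimitiveRoot.coe_units_iff, ← h1]; exact IsPrimitiveRoot.orderOf _
  refine ⟨fun i => ((g ^ d : kˣ) : k) ^ i, fun i hi j hj hij => ?_, ?_⟩
  · exact hp.pow_inj (by simpa using hi) (by simpa using hj) hij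
  · have := X_pow_sub_one_eq_prod (R := k) (Nat.pos_of_ne_zero hn) hp
    have himg : (Finset.range n).image (fun i => ((g ^ d : kˣ) : k) ^ i) =
        nthRootsFinset n (1 : k) := by
      refine Finset.eq_of_subset_of_card_le (fun x hx => ?_) ?_
      · obtain ⟨i, -, rfl⟩ := Finset.mem_image.1 hx
        rw [mem_nthRootsFinset (Nat.pos_of_ne_zero hn), ← pow_mul, mul_comm, pow_mul, hp.pow_eq_one,
          one_pow]
      · rw [hp.card_nthRootsFinset, Finset.card_image_of_injOn, Finset.card_range]
        exact fun i hi j hj hij => hp.pow_inj (by simpa using hi) (by simpa using hj) hij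
    rw [this, ← himg, Finset.prod_image]
    exact fun i hi j hj hij => hp.pow_inj (by simpa using hi) (by simpa using hj) hij

lemma exists_uniform_delta {ι : Type*} (S : Finset ι) (p : ι → ℝ → Prop)
    (hmono : ∀ v δ δ', δ' ≤ δ → p v δ → p v δ') (h : ∀ v ∈ S, ∃ δ > 0, p v δ) :
    ∃ δ > 0, ∀ v ∈ S, p v δ := by
  classical
  induction S using Finset.induction_on with
  | empty => exact ⟨1, one_pos, by simp⟩
  | insert a s ha ih =>
    obtain ⟨δ, hδ, h1⟩ := ih fun v hv => h v (Finset.mem_insert_of_mem hv)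
    obtain ⟨δ', hδ', h2⟩ := h a (Finset.mem_insert_self _ _)
    refine ⟨min δ δ', lt_min hδ hδ', fun v hv => ?_⟩
    rcases Finset.mem_insert.1 hv with rfl | hv
    · exact hmono _ _ _ (min_le_right _ _) h2
    · exact hmono _ _ _ (min_le_left _ _) (h1 v hv)

variable {K : Type*} [Field K]

lemma squareDisc_prod {n : ℕ} {a : Fin n → K} (ha : Function.Injective a) :
    SquareDisc n (∏ i, (X - C (a i))) := by
  refine ⟨fun i => algebraMap K _ (a i), (algebraMap K _).injective.comp ha, ?_,
    (vandermonde a).det, ?_⟩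
  · simp [Polynomial.map_prod]
  · rw [det_vandermonde, det_vandermonde]; simp

lemma SquareDisc.mul_X_sub_C {n : ℕ} {f : K[X]} (hf : SquareDisc n f) {c : K}
    (hs : (f * (X - C c)).Separable) : SquareDisc (n + 1) (f * (X - C c)) := by
  obtain ⟨θ, hθ, h, δ, hδ⟩ := hf
  have hmap : (f * (X - C c)).map (algebraMap K (AlgebraicClosure K)) =
      ∏ i, (X - C ((Fin.cons (algebraMap K _ c) θ : Fin (n + 1) → AlgebraicClosure K) i)) := by
    rw [Fin.prod_univ_succ, Polynomial.map_mul, h, mul_comm]; simp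
  refine ⟨_, injective_of_separable hmap hs, hmap, (-1) ^ n * f.eval c * δ, ?_⟩
  have h1 : algebraMap K (AlgebraicClosure K) (f.eval c) = ∏ i, (algebraMap K _ c - θ i) := by
    rw [← aeval_eq_prod h, aeval_algebraMap_apply, coe_aeval_eq_eval]
  have h2 : ∏ i, (θ i - algebraMap K _ c) = (-1) ^ n * ∏ i, (algebraMap K _ c - θ i) := by
    have : ∀ i, θ i - algebraMap K _ c = (-1) * (algebraMap K _ c - θ i) := fun i => by ring
    simp only [this, Finset.prod_mul_distrib, Finset.prod_const, Finset.card_univ, Fintype.card_fin]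
  rw [det_vandermonde, Fin.prod_univ_succ]
  simp only [Fin.prod_Ioi_zero, Fin.cons_zero, Fin.cons_succ, Fin.prod_Ioi_succ]
  rw [h2, ← det_vandermonde, map_mul, map_mul, h1, hδ]
  simp

variable [NumberField K]

/-- Four prescribed roots determine `s` and the `uᵢ` linearly, and `γᵢ = uⱼuₖ/uᵢ` recovers `γⱼγₖ =
uᵢ²`. The three inequalities say that no `uᵢ` vanishes. -/
lemma exists_target (ρ : ℕ → K) (k : ℕ) (h0 : ρ 0 + ρ 1 - ρ 2 - ρ 3 ≠ 0)
    (h1 : ρ 0 - ρ 1 + ρ 2 - ρ 3 ≠ 0) (h2 : ρ 0 - ρ 1 - ρ 2 + ρ 3 ≠ 0) :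
    ∃ d : Target K, d.poly k = ∏ i ∈ Finset.range (k + 4), (X - C (ρ i)) := by
  set u0 := (ρ 0 + ρ 1 - ρ 2 - ρ 3) / 4
  set u1 := (ρ 0 - ρ 1 + ρ 2 - ρ 3) / 4
  set u2 := (ρ 0 - ρ 1 - ρ 2 + ρ 3) / 4
  have e0 : u0 ≠ 0 := div_ne_zero h0 (by norm_num)
  have e1 : u1 ≠ 0 := div_ne_zero h1 (by norm_num)
  have e2 : u2 ≠ 0 := div_ne_zero h2 (by norm_num)
  refine ⟨⟨![u1 * u2 / u0, u0 * u2 / u1, u0 * u1 / u2], (ρ 0 + ρ 1 + ρ 2 + ρ 3) / 4,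
    fun j => ρ (j + 4)⟩, ?_⟩
  rw [Target.poly, add_comm k 4, Finset.prod_range_add, quarticOf_eq_prod _ ![u0, u1, u2]]
  · have key : ∀ i : Fin 4, quarticRoot ((ρ 0 + ρ 1 + ρ 2 + ρ 3) / 4) ![u0, u1, u2] i = ρ i := by
      intro i
      fin_cases i <;> simp [quarticRoot, u0, u1, u2] <;> ring
    simp only [key]
    rw [← Finset.prod_range fun i => (X - C (ρ i))]
    simp [add_comm]
  · simp; field_simp
  · simp; field_simp
  · simp; field_simp
  · simp; field_simp

lemma congrAt_of_map_quotient_eq {q : HeightOneSpectrum (𝓞 K)} {f g : (𝓞 K)[X]}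
    (h : f.map (Ideal.Quotient.mk q.asIdeal) = g.map (Ideal.Quotient.mk q.asIdeal)) :
    CongrAt q (f.map (algebraMap (𝓞 K) K)) (g.map (algebraMap (𝓞 K) K)) := fun i => by
  have h3 := congrArg (coeff · i) h
  simp only [coeff_map, Ideal.Quotient.eq] at h3
  rwa [← placeAbs_algebraMap_lt_one_iff, map_sub, ← coeff_map, ← coeff_map, ← coeff_sub] at h3

/-- Targets approximating a split polynomial at a finite prime. -/
lemma exists_target_congrAt {q : HeightOneSpectrum (𝓞 K)} (ρ : ℕ → 𝓞 K) (k : ℕ) :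
    ∃ d : Target K, CongrAt q (d.poly k)
      ((∏ i ∈ Finset.range (k + 4), (X - C (ρ i))).map (algebraMap (𝓞 K) K)) := by
  classical
  obtain ⟨π, hπ, hπ0⟩ := Submodule.exists_mem_ne_zero_of_ne_bot q.ne_bot
  -- Shifting the first root by multiples of `π ∈ q` does not change the reduction and leaves
  -- infinitely many values, so the three that make some `uᵢ` vanish can be avoided.
  have hinf : Set.Infinite (Set.range fun j : ℕ => (algebraMap (𝓞 K) K (ρ 0 + j * π))) := by
    refine Set.infinite_range_of_injective fun i j hij => ?_
    have h1 := RingOfIntegers.coe_injective hij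
    exact_mod_cast mul_right_cancel₀ hπ0 (add_left_cancel h1)
  set r : ℕ → K := fun i => algebraMap (𝓞 K) K (ρ i)
  obtain ⟨x, ⟨j, hj⟩, hx⟩ := hinf.exists_notMem_finset
    {-(r 1 - r 2 - r 3), -(-r 1 + r 2 - r 3), -(-r 1 - r 2 + r 3)}
  simp only [Finset.mem_insert, Finset.mem_singleton, not_or] at hx
  let ρ' : ℕ → 𝓞 K := fun i => if i = 0 then ρ 0 + j * π else ρ i
  have h0 : algebraMap (𝓞 K) K (ρ' 0) = x := hj
  have h1 : ∀ i, algebraMap (𝓞 K) K (ρ' (i + 1)) = r (i + 1) := fun i => rfl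
  have r1 := h1 0
  have r2 := h1 1
  have r3 := h1 2
  simp only [zero_add, Nat.reduceAdd] at r1 r2 r3
  obtain ⟨d, hd⟩ := exists_target (fun i => algebraMap (𝓞 K) K (ρ' i)) k
    (fun h => hx.1 (by rw [← h0]; linear_combination h - r1 + r2 + r3))
    (fun h => hx.2.1 (by rw [← h0]; linear_combination h + r1 - r2 + r3))
    (fun h => hx.2.2 (by rw [← h0]; linear_combination h + r1 + r2 - r3))
  refine ⟨d, ?_⟩
  have h2 : (∏ i ∈ Finset.range (k + 4), (X - C (ρ' i))).map (Ideal.Quotient.mk q.asIdeal) =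
      (∏ i ∈ Finset.range (k + 4), (X - C (ρ i))).map (Ideal.Quotient.mk q.asIdeal) := by
    rw [Polynomial.map_prod, Polynomial.map_prod]
    refine Finset.prod_congr rfl fun i _ => ?_
    simp only [Polynomial.map_sub, map_X, map_C, ρ']
    split_ifs with hi
    · rw [hi, map_add, map_mul, Ideal.Quotient.eq_zero_iff_mem.2 hπ, mul_zero, add_zero]
    · rfl
  rw [hd]
  have h3 := congrAt_of_map_quotient_eq h2
  rw [Polynomial.map_prod] at h3
  simpa using h3

end Induction
end AnLocal

namespace AnLocal

open Polynomial IsDedekindDomain Matrix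

/-! ### The induction hypothesis and quartic polynomials -/

section Reach

variable {K : Type*} [Field K] [NumberField K]

/-- `q` lies outside `S` and has more than `M` residue classes. -/
def IsNew (S : Finset (Place K)) (M : ℕ) (q : HeightOneSpectrum (𝓞 K)) : Prop :=
  Sum.inl q ∉ S ∧ M < Nat.card (𝓞 K ⧸ q.asIdeal)

lemma IsNew.mono {S S' : Finset (Place K)} {M M' : ℕ} {q : HeightOneSpectrum (𝓞 K)}
    (h : IsNew S' M' q) (hS : S ⊆ S') (hM : M ≤ M') : IsNew S M q :=
  ⟨fun hq => h.1 (hS hq), hM.trans_lt h.2⟩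

/-- The global properties which force the Galois group of a polynomial of degree `k + 4` to be the
alternating group, witnessed at primes outside `S`. -/
structure IsAlternating (k : ℕ) (S : Finset (Place K)) (M : ℕ) (f : K[X]) : Prop where
  squareDisc : SquareDisc (k + 4) f
  three : ∃ q, IsNew S M q ∧ HasCycleAt 3 f q
  even : Even k → ∃ q, IsNew S M q ∧ HasCycleAt (k + 3) f q
  odd : Odd k → ∃ q, IsNew S M q ∧ HasCycleAt (k + 2) f q
  full : Odd k → ∃ q, IsNew S M q ∧ HasCycleAt (k + 4) f q
  eval_ne_zero : Even k → k ≠ 0 → ∀ x, f.eval x ≠ 0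

variable (K) in
/-- All targets in degree `k + 4` are approximated by polynomials with alternating group. -/
def Reach (k : ℕ) : Prop :=
  ∀ (S : Finset (Place K)) (d : Place K → Target K) (ε : ℝ) (M : ℕ), 0 < ε →
    ∃ f, IsAlternating k S M f ∧ ∀ v ∈ S, polyNorm (placeAbs v) (f - (d v).poly k) < ε

lemma map_prod_X_sub_C {R S ι : Type*} [CommRing R] [CommRing S] (φ : R →+* S) (s : Finset ι)
    (z : ι → R) : (∏ i ∈ s, (X - C (z i))).map φ = ∏ i ∈ s, (X - C (φ (z i))) := by
  simp [Polynomial.map_prod]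

/-- Integers lifting the roots of unity of a residue field. -/
lemma exists_lift_roots_of_unity {q : HeightOneSpectrum (𝓞 K)} {n : ℕ} (hn : n ≠ 0)
    (h : Nat.card (𝓞 K ⧸ q.asIdeal) ≡ 1 [MOD n]) : ∃ z : ℕ → 𝓞 K,
      (∏ i ∈ Finset.range n, (X - C (z i))).map (Ideal.Quotient.mk q.asIdeal) = X ^ n - 1 := by
  obtain ⟨z, -, hz⟩ := exists_roots_of_unity hn h
  choose w hw using fun i => Ideal.Quotient.mk_surjective (I := q.asIdeal) (z i)
  exact ⟨w, by rw [map_prod_X_sub_C]; simpa [hw] using hz⟩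

lemma congrAt_X_pow_sub_one {q : HeightOneSpectrum (𝓞 K)} {n : ℕ} {g : (𝓞 K)[X]}
    (h : g.map (Ideal.Quotient.mk q.asIdeal) = X ^ n - 1) :
    CongrAt q (g.map (algebraMap (𝓞 K) K)) (X ^ n - 1) := by
  have := congrAt_of_map_quotient_eq (q := q) (f := g) (g := X ^ n - 1) (by simpa using h)
  simpa using this

lemma separable_of_congrAt_X_pow_sub_one {q : HeightOneSpectrum (𝓞 K)} {n : ℕ}
    (hn : (n : 𝓞 K) ∉ q.asIdeal) {f : K[X]} (hf : f.Monic) (h : CongrAt q f (X ^ n - 1)) :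
    f.Separable := by
  refine separable_of_congrAt hf (g := X ^ n - 1) (by simpa using h) ?_
  have := separable_X_pow_sub_C (n := n) (1 : 𝓞 K ⧸ q.asIdeal) (natCast_quotient_ne_zero hn)
    one_ne_zero
  simpa using this

lemma exists_lift_irreducible {q : HeightOneSpectrum (𝓞 K)} {n : ℕ} (hn : Odd n)
    (h : Nat.card (𝓞 K ⧸ q.asIdeal) ≡ 1 [MOD n]) : ∃ b : 𝓞 K, b ∉ q.asIdeal ∧
      Irreducible (X ^ n - C (Ideal.Quotient.mk q.asIdeal b)) := by
  obtain ⟨b, hb, hirr⟩ := exists_irreducible_X_pow_sub_C hn h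
  obtain ⟨b, rfl⟩ := Ideal.Quotient.mk_surjective b
  exact ⟨b, by rwa [Ne, Ideal.Quotient.eq_zero_iff_mem] at hb, hirr⟩

/-- The base of the induction: quartic polynomials. -/
lemma reach_zero : Reach K 0 := by
  classical
  intro S d ε M hε
  obtain ⟨ℓ, hℓ, -, h⟩ := exists_rational_prime (N := 3) (by norm_num) S (max M 8)
  obtain ⟨q, hq⟩ := exists_prime_above (K := K) hℓ
  obtain ⟨hqS, hmod, hcard, hj⟩ := h q hq
  obtain ⟨z, hz⟩ := exists_lift_roots_of_unity (by norm_num) hmod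
  obtain ⟨b₈, hb₈, hirr⟩ := exists_lift_irreducible (by decide) hmod
  have h8 : (8 : 𝓞 K ⧸ q.asIdeal) ≠ 0 := by
    exact_mod_cast natCast_quotient_ne_zero (hj 8 (by norm_num) (le_max_right _ _))
  -- The quartic attached to `X³ - b` with `s = 0` is `X(X³ - 8b)`; so `b` is chosen with `8b ≡ b₈`,
  -- where `X³ - b₈` is irreducible modulo `q`.
  obtain ⟨b, hb⟩ := Ideal.Quotient.mk_surjective (I := q.asIdeal)
    (Ideal.Quotient.mk q.asIdeal b₈ / 8)
  have hb8 : 8 * Ideal.Quotient.mk q.asIdeal b = Ideal.Quotient.mk q.asIdeal b₈ := by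
    rw [hb, mul_div_cancel₀ _ h8]
  have hbq : b ∉ q.asIdeal := by
    rw [← Ideal.Quotient.eq_zero_iff_mem] at hb₈ ⊢
    intro h0; rw [h0, mul_zero] at hb8; exact hb₈ hb8.symm
  have h3q : ((3 : ℕ) : 𝓞 K) ∉ q.asIdeal := hj 3 (by norm_num) (by omega)
  obtain ⟨δ₁, hδ₁, h₁⟩ := exists_uniform_delta S (fun v δ => ∀ g' s',
      polyNorm (placeAbs v) (g' - ∏ i, (X - C ((d v).γ i))) < δ → placeAbs v (s' - (d v).s) < δ →
      polyNorm (placeAbs v) (quarticOf g' s' - quarticOf (∏ i, (X - C ((d v).γ i))) (d v).s) < ε)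
    (fun v δ δ' hle h g' s' hg hs => h g' s' (hg.trans_le hle) (hs.trans_le hle))
    (fun v _ => exists_delta_quarticOf _ _ _ hε)
  obtain ⟨δ₂, hδ₂, h₂⟩ := exists_uniform_delta S (fun v δ => ∀ a' : Fin 3 → K,
      (∀ i, placeAbs v (a' i - (d v).γ i) < δ) →
      polyNorm (placeAbs v) (∏ i, (X - C (a' i)) - ∏ i, (X - C ((d v).γ i))) < δ₁ / 2)
    (fun v δ δ' hle h a' ha => h a' fun i => (ha i).trans_le hle)
    (fun v _ => exists_delta_prod_X_sub_C _ _ (half_pos hδ₁))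
  set η := min (min δ₁ δ₂) 1 with hη
  have hη0 : 0 < η := lt_min (lt_min hδ₁ hδ₂) one_pos
  have hqv : ∀ v ∈ S, v ≠ Sum.inl q := fun v hv h => hqS (h ▸ hv)
  have hqmem : (Sum.inl q : Place K) ∈ insert (Sum.inl q) S := Finset.mem_insert_self _ _
  -- The split cubic has roots close to the target's `γ` on `S` and congruent to the cube roots of
  -- unity at `q`, ready for the pencil.
  choose a ha using fun i : Fin 3 => exists_approx (insert (Sum.inl q) S)
    (fun v => if v = Sum.inl q then algebraMap (𝓞 K) K (z i) else (d v).γ i) hη0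
  obtain ⟨s, hs⟩ := exists_approx (insert (Sum.inl q) S)
    (fun v => if v = Sum.inl q then 0 else (d v).s) hη0
  have hPq : CongrAt q (∏ i, (X - C (a i))) (X ^ 3 - 1) := by
    refine CongrAt.trans ?_ (congrAt_X_pow_sub_one hz)
    have h1 : ∀ i : Fin 3, CongrAt q (X - C (a i)) ((X - C (z i)).map (algebraMap (𝓞 K) K)) :=
      fun i => congrAt_X_sub_C (by
        have := ha i _ hqmem
        rw [if_pos rfl] at this
        exact this.trans_le (min_le_right _ _))
    have h2 := ((h1 0).mul (h1 1)).mul (h1 2)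
    rw [Fin.prod_univ_three, Finset.prod_range_succ, Finset.prod_range_succ, Finset.prod_range_one]
    exact h2
  have hPm : (∏ i, (X - C (a i))).Monic := monic_prod_of_monic _ _ fun i _ => monic_X_sub_C _
  have hP : SquareDisc 3 (∏ i, (X - C (a i))) := squareDisc_prod
    (separable_prod_X_sub_C_iff.1 (separable_of_congrAt_X_pow_sub_one h3q hPm hPq))
  obtain ⟨g, hg, hgS, hgq⟩ := hP.exists_near (m := 1) one_pos S {q} (Finset.singleton_nonempty q)
    (by simpa using hqS) (by
      intro q' hq' j hj0 hj3
      rw [Finset.mem_singleton.1 hq']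
      exact hj j hj0 (by omega)) (by simpa using hPq) (fun _ => b) (by simpa using hbq)
    (half_pos hδ₁)
  replace hgq := hgq q (Finset.mem_singleton_self q)
  have hsq : placeAbs (Sum.inl q) s < 1 := by
    have := hs _ hqmem
    rw [if_pos rfl, sub_zero] at this
    exact this.trans_le (min_le_right _ _)
  have hg0 : g.coeff 0 ≠ 0 := by
    intro h0
    have := hgq 0
    simp only [coeff_sub, h0, coeff_X_pow, coeff_C_zero] at this
    norm_num at this
    exact hbq ((placeAbs_algebraMap_lt_one_iff q b).1 this)
  have hf : SquareDisc 4 (quarticOf g s) := hg.quarticOf hg0 s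
  have hcyc : HasCycleAt 3 (quarticOf g s) q := by
    refine ⟨X * (X ^ 3 - C (8 * b)), ?_, ?_, X ^ 3 - C (8 * Ideal.Quotient.mk q.asIdeal b), ?_,
      natDegree_X_pow_sub_C, {0}, ?_⟩
    · obtain ⟨G, rfl, hG⟩ := CongrAt.exists_lift (f := g) (q := q)
        (G := X ^ 3 - C (toValRing q b)) (by
          simp only [Polynomial.map_sub, Polynomial.map_pow, map_X, map_C]; exact hgq)
      let s₀ : valRing q := ⟨s, (mem_valRing_iff q s).2 hsq.le⟩
      have hs₀ : IsLocalRing.residue _ s₀ = 0 := (residue_valRing_eq_zero_iff q s₀).2 hsq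
      have e1 : quarticOf (G.map (algebraMap (valRing q) K)) s =
          (quarticOf G s₀).map (algebraMap (valRing q) K) := by rw [quarticOf_map]; rfl
      rw [e1, ← algebraMap_comp_toValRing q, ← Polynomial.map_map, ← map_residue_eq_iff,
        quarticOf_map, hG, hs₀]
      have e8 : toValRing q 8 = 8 := map_ofNat _ 8
      have e8' : IsLocalRing.residue (valRing q) 8 = 8 := map_ofNat _ 8
      simp [quarticOf, coeff_X_pow, coeff_C, e8, e8']
      ring
    · rw [Polynomial.map_mul, Polynomial.map_sub, Polynomial.map_pow, map_X, map_C, map_mul,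
        map_ofNat, hb8]
      refine (separable_X).mul (separable_X_pow_sub_C _ (natCast_quotient_ne_zero h3q) ?_) ?_
      · rwa [Ne, Ideal.Quotient.eq_zero_iff_mem]
      · have hne : Ideal.Quotient.mk q.asIdeal b₈ ≠ 0 := by
          rwa [Ne, Ideal.Quotient.eq_zero_iff_mem]
        refine ⟨C (Ideal.Quotient.mk q.asIdeal b₈)⁻¹ * X ^ 2,
          -C (Ideal.Quotient.mk q.asIdeal b₈)⁻¹, ?_⟩
        have : C (Ideal.Quotient.mk q.asIdeal b₈)⁻¹ * C (Ideal.Quotient.mk q.asIdeal b₈) = 1 := by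
          rw [← C_mul, inv_mul_cancel₀ hne, C_1]
        linear_combination this
    · rw [hb8]; exact hirr
    · have e8 : Ideal.Quotient.mk q.asIdeal 8 = 8 := map_ofNat _ 8
      simp [e8, mul_comm]
  refine ⟨quarticOf g s, ⟨hf, ⟨q, ⟨hqS, (le_max_left _ _).trans_lt hcard⟩, hcyc⟩,
    fun _ => ⟨q, ⟨hqS, (le_max_left _ _).trans_lt hcard⟩, hcyc⟩, by simp, by simp, by simp⟩, ?_⟩
  intro v hv
  have hne := hqv v hv
  have hvm : v ∈ insert (Sum.inl q) S := Finset.mem_insert_of_mem hv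
  rw [Target.poly, Finset.range_zero, Finset.prod_empty, mul_one]
  refine h₁ v hv g s ?_ ?_
  · have e1 := hgS v hv
    have e2 := h₂ v hv a fun i => by
      have := ha i v hvm
      rw [if_neg hne] at this
      exact this.trans_le ((min_le_left _ _).trans (min_le_right _ _))
    have := map_add_le_add (polyNorm (placeAbs v)) (g - ∏ i, (X - C (a i)))
      (∏ i, (X - C (a i)) - ∏ i, (X - C ((d v).γ i)))
    rw [sub_add_sub_cancel] at this
    linarith
  · have := hs v hvm
    rw [if_neg hne] at this
    exact this.trans_le ((min_le_left _ _).trans (min_le_left _ _))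

end Reach
end AnLocal

namespace AnLocal

open Polynomial IsDedekindDomain Matrix

/-! ### From even degree to odd degree -/

section OddStep

variable {K : Type*} [Field K]

lemma polyNorm_sub_lt (v : AbsoluteValue K ℝ) {f g h : K[X]} {ε : ℝ}
    (h₁ : polyNorm v (f - g) < ε / 2) (h₂ : polyNorm v (g - h) < ε / 2) :
    polyNorm v (f - h) < ε := by
  have := map_add_le_add (polyNorm v) (f - g) (g - h)
  rw [sub_add_sub_cancel] at this
  linarith

variable [NumberField K]

/-- Adding a root to a polynomial and deforming, in odd degree `k + 5`. -/
lemma reach_succ_of_even {k : ℕ} (hk : Even k) (hr : Reach K k) : Reach K (k + 1) := by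
  classical
  intro S d ε M hε
  have hN : Odd (k + 5) := by obtain ⟨j, rfl⟩ := hk; exact ⟨j + 2, by ring⟩
  obtain ⟨m, hm⟩ := hN
  have hm0 : 0 < m := by omega
  obtain ⟨ℓ, hℓ, -, hq⟩ := exists_rational_prime (N := k + 5) (by omega) S (max M (k + 5))
  obtain ⟨q₀, hq₀⟩ := exists_prime_above (K := K) hℓ
  set T : Finset (HeightOneSpectrum (𝓞 K)) := {q₀} with hTdef
  have hTp : ∀ q ∈ T, Sum.inl q ∉ S ∧ Nat.card (𝓞 K ⧸ q.asIdeal) ≡ 1 [MOD (k + 5)] ∧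
      M < Nat.card (𝓞 K ⧸ q.asIdeal) ∧ ∀ j : ℕ, 0 < j → j ≤ k + 5 → (j : 𝓞 K) ∉ q.asIdeal := by
    intro q hqT
    rw [Finset.mem_singleton.1 hqT]
    obtain ⟨a, b, c, e⟩ := hq q₀ hq₀
    exact ⟨a, b, by omega, fun j h0 hj => e j h0 (by omega)⟩
  have hTne : T.Nonempty := Finset.singleton_nonempty q₀
  have hz : ∀ q : HeightOneSpectrum (𝓞 K), ∃ z : ℕ → 𝓞 K, q ∈ T →
      (∏ i ∈ Finset.range (k + 5), (X - C (z i))).map (Ideal.Quotient.mk q.asIdeal) =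
        X ^ (k + 5) - 1 := by
    intro q
    by_cases hq : q ∈ T
    · obtain ⟨z, hz⟩ := exists_lift_roots_of_unity (by omega) (hTp q hq).2.1
      exact ⟨z, fun _ => hz⟩
    · exact ⟨0, fun h => absurd h hq⟩
  choose z hz using hz
  have hb : ∀ q : HeightOneSpectrum (𝓞 K), ∃ b : 𝓞 K, q ∈ T → b ∉ q.asIdeal ∧
      Irreducible (X ^ (k + 5) - C (Ideal.Quotient.mk q.asIdeal b)) := by
    intro q
    by_cases hq : q ∈ T
    · obtain ⟨b, hb⟩ := exists_lift_irreducible ⟨m, hm⟩ (hTp q hq).2.1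
      exact ⟨b, fun _ => hb⟩
    · exact ⟨0, fun h => absurd h hq⟩
  choose b hb using hb
  choose dT hdT using fun q : HeightOneSpectrum (𝓞 K) => exists_target_congrAt (q := q) (z q) k
  obtain ⟨δ, hδ, hδS⟩ := exists_uniform_delta S (fun v δ => ∀ f' c',
      polyNorm (placeAbs v) (f' - (d v).poly k) < δ → placeAbs v (c' - (d v).c k) < δ →
      polyNorm (placeAbs v) (f' * (X - C c') - (d v).poly k * (X - C ((d v).c k))) < ε / 2)
    (fun v δ δ' hle h f' c' hf hc => h f' c' (hf.trans_le hle) (hc.trans_le hle))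
    (fun v _ => exists_delta_mul_X_sub_C _ _ _ (half_pos hε))
  have hη : 0 < min δ 1 := lt_min hδ one_pos
  -- At `q₀` the induction hypothesis is used to make `f₀` reduce to the product of `X - ζ` over all
  -- but one of the `(k + 5)`-th roots of unity; the last one is left for the new factor.
  obtain ⟨f₀, hf₀, hf₀S⟩ := hr (S ∪ T.image Sum.inl)
    (Sum.elim (fun q => if q ∈ T then dT q else d (Sum.inl q)) (fun v => d (Sum.inr v)))
    (min δ 1) (max M (k + 4)) hη
  obtain ⟨q₃, hq₃, hc₃⟩ := hf₀.three
  obtain ⟨q₄, hq₄, hc₄⟩ := hf₀.even hk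
  have hdeg := hf₀.squareDisc.natDegree
  have hW : ∀ q : HeightOneSpectrum (𝓞 K), ∃ c : 𝓞 K, q = q₃ ∨ q = q₄ → ∀ x : K,
      placeAbs (Sum.inl q) (x - algebraMap (𝓞 K) K c) < 1 →
      ∀ k, HasCycleAt k f₀ q → HasCycleAt k (f₀ * (X - C x)) q := by
    intro q
    by_cases hq : q = q₃ ∨ q = q₄
    · obtain ⟨c, hc⟩ := HasCycleAt.exists_mul (f := f₀) (q := q) (by
        rw [hdeg]; rcases hq with rfl | rfl
        · exact (le_max_right _ _).trans_lt hq₃.2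
        · exact (le_max_right _ _).trans_lt hq₄.2)
      exact ⟨c, fun _ => hc⟩
    · exact ⟨0, fun h => absurd h hq⟩
  choose c hc using hW
  have hWn : ∀ q, q = q₃ ∨ q = q₄ → IsNew (S ∪ T.image Sum.inl) M q := by
    rintro q (rfl | rfl)
    · exact hq₃.mono subset_rfl (le_max_left _ _)
    · exact hq₄.mono subset_rfl (le_max_left _ _)
  have hWT : ∀ q, q = q₃ ∨ q = q₄ → q ∉ T := fun q hq hqT =>
    (hWn q hq).1 (Finset.mem_union_right _ (Finset.mem_image_of_mem _ hqT))
  have hWS : ∀ q, q = q₃ ∨ q = q₄ → Sum.inl q ∉ S := fun q hq hqT =>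
    (hWn q hq).1 (Finset.mem_union_left _ hqT)
  -- The new root has three tasks: the missing root of unity at `q₀`, a residue class not meeting
  -- the roots of `f₀` at `q₃` and `q₄` (so their factorisation patterns survive), and the next
  -- prescribed root on `S`.
  obtain ⟨x, hx⟩ := exists_approx (S ∪ T.image Sum.inl ∪ {Sum.inl q₃, Sum.inl q₄})
    (Sum.elim (fun q => if q ∈ T then algebraMap (𝓞 K) K (z q (k + 4)) else
      if q = q₃ ∨ q = q₄ then algebraMap (𝓞 K) K (c q) else (d (Sum.inl q)).c k)
      (fun v => (d (Sum.inr v)).c k)) hη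
  have hcyc : ∀ q, q = q₃ ∨ q = q₄ → ∀ k, HasCycleAt k f₀ q →
      HasCycleAt k (f₀ * (X - C x)) q := by
    intro q hq
    refine hc q hq x ?_
    have := hx (Sum.inl q) (by rcases hq with rfl | rfl <;> simp)
    rw [Sum.elim_inl, if_neg (hWT q hq), if_pos hq] at this
    exact this.trans_le (min_le_right _ _)
  have hPm : (f₀ * (X - C x)).Monic := hf₀.squareDisc.monic.mul (monic_X_sub_C x)
  have hP : SquareDisc (2 * m + 1) (f₀ * (X - C x)) := by
    have := hf₀.squareDisc.mul_X_sub_C ((hcyc _ (Or.inl rfl) _ hc₃).separable hPm)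
    rwa [show k + 4 + 1 = 2 * m + 1 by omega] at this
  have hPT : ∀ q ∈ T, CongrAt q (f₀ * (X - C x)) (X ^ (2 * m + 1) - 1) := by
    intro q hq
    have hqm : (Sum.inl q : Place K) ∈ S ∪ T.image Sum.inl :=
      Finset.mem_union_right _ (Finset.mem_image_of_mem _ hq)
    have e1 := hf₀S _ hqm
    rw [Sum.elim_inl, if_pos hq] at e1
    have e2 := hx _ (Finset.mem_union_left _ hqm)
    rw [Sum.elim_inl, if_pos hq] at e2
    have e3 := ((congrAt_of_polyNorm_lt (e1.trans_le (min_le_right _ _))).trans (hdT q)).mul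
      (congrAt_X_sub_C (e2.trans_le (min_le_right _ _)))
    rw [← Finset.prod_range_succ (fun i => X - C (z q i))] at e3
    rw [← hm]
    exact e3.trans (congrAt_X_pow_sub_one (hz q hq))
  -- The primes `q₃` and `q₄` are held fixed along with `S`; the bound by `1` there means that the
  -- reduction does not change. At `q₀` the polynomial becomes the irreducible `X^N - b`.
  obtain ⟨F, hF, hFS, hFT⟩ := hP.exists_near hm0 (S ∪ {Sum.inl q₃, Sum.inl q₄}) T hTne
    (by
      intro q hq h
      simp only [Finset.mem_union, Finset.mem_insert, Finset.mem_singleton, Sum.inl.injEq] at h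
      rcases h with h | h
      · exact (hTp q hq).1 h
      · exact hWT q h hq)
    (by rw [← hm]; exact fun q hq => (hTp q hq).2.2.2) hPT b (fun q hq => (hb q hq).1)
    (lt_min (half_pos hε) one_pos)
  have hFW : ∀ q, q = q₃ ∨ q = q₄ → ∀ k, HasCycleAt k f₀ q → HasCycleAt k F q := by
    intro q hq k h
    refine (hcyc q hq k h).congr (congrAt_of_polyNorm_lt ?_)
    exact (hFS (Sum.inl q) (by rcases hq with rfl | rfl <;> simp)).trans_le (min_le_right _ _)
  have hodd : ¬ Even (k + 1) := by rw [Nat.even_add_one]; exact not_not.2 hk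
  have hqT : q₀ ∈ T := Finset.mem_singleton_self q₀
  -- The pattern of length `k + 3` carried by `f₀` at `q₄` now leaves out two points, since the
  -- degree is `k + 5`.
  refine ⟨F, ⟨by rwa [show k + 1 + 4 = 2 * m + 1 by omega],
    ⟨q₃, (hWn _ (Or.inl rfl)).mono Finset.subset_union_left le_rfl, hFW _ (Or.inl rfl) _ hc₃⟩,
    fun h => absurd h hodd,
    fun _ => ⟨q₄, (hWn _ (Or.inr rfl)).mono Finset.subset_union_left le_rfl,
      hFW _ (Or.inr rfl) _ hc₄⟩,
    fun _ => ⟨q₀, ⟨(hTp q₀ hqT).1, (hTp q₀ hqT).2.2.1⟩, ?_⟩, fun h => absurd h hodd⟩, ?_⟩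
  · have := hFT q₀ hqT
    rw [← hm] at this
    exact hasCycleAt_X_pow_sub_C ((hTp q₀ hqT).2.2.2 _ (by omega) le_rfl) (hb q₀ hqT).1
      (hb q₀ hqT).2 this
  · intro v hv
    have hvm : v ∈ S ∪ T.image Sum.inl := Finset.mem_union_left _ hv
    refine polyNorm_sub_lt _ ((hFS v (Finset.mem_union_left _ hv)).trans_le (min_le_left _ _)) ?_
    rw [Target.poly_succ]
    have e1 := hf₀S v hvm
    have e2 := hx v (Finset.mem_union_left _ hvm)
    have e3 : (Sum.elim (fun q => if q ∈ T then dT q else d (Sum.inl q))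
        (fun v => d (Sum.inr v)) v : Target K) = d v := by
      rcases v with q | v
      · rw [Sum.elim_inl, if_neg fun hq => (hTp q hq).1 hv]
      · rfl
    have e4 : (Sum.elim (fun q => if q ∈ T then algebraMap (𝓞 K) K (z q (k + 4)) else
        if q = q₃ ∨ q = q₄ then algebraMap (𝓞 K) K (c q) else (d (Sum.inl q)).c k)
        (fun v => (d (Sum.inr v)).c k) v : K) = (d v).c k := by
      rcases v with q | v
      · rw [Sum.elim_inl, if_neg fun hq => (hTp q hq).1 hv, if_neg fun hq => hWS q hq hv]
      · rfl
    rw [e3] at e1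
    rw [e4] at e2
    exact hδS v hv f₀ x (e1.trans_le (min_le_left _ _)) (e2.trans_le (min_le_left _ _))

end OddStep
end AnLocal

namespace AnLocal

open Polynomial Matrix IsLocalRing

/-! ### Removing a linear factor -/

section Vandermonde

variable {K : Type*} [Field K]

/-- Up to the sign of the numbering, the Vandermonde determinant of the roots of `f(X - c)` is
`(-1)ⁿ f(c)` times that of `f`, and `f(c)` is a nonzero element of `K`. -/
lemma SquareDisc.of_mul_X_sub_C {n : ℕ} {f : K[X]} {c : K} (hf : f.Monic) (hn : f.natDegree = n)
    (h : SquareDisc (n + 1) (f * (X - C c))) : SquareDisc n f := by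
  have hsep := h.separable
  obtain ⟨θ, hθ, h, δ, hδ⟩ := h
  obtain ⟨ψ, hψ⟩ := exists_roots (L := AlgebraicClosure K) hf hn
  set ψ' : Fin (n + 1) → AlgebraicClosure K := Fin.cons (algebraMap K _ c) ψ with hψ'
  have hmap : (f * (X - C c)).map (algebraMap K (AlgebraicClosure K)) = ∏ i, (X - C (ψ' i)) := by
    rw [Fin.prod_univ_succ, Polynomial.map_mul, hψ, mul_comm]; simp [hψ']
  have hinj := injective_of_separable hmap hsep
  have hroot : ∀ i, ∃ j, ψ' i = θ j := fun i =>
    (aeval_eq_zero_iff h _).1 ((aeval_eq_zero_iff hmap _).2 ⟨i, rfl⟩)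
  choose π hπ using hroot
  have hπi : Function.Injective π := fun i j hij => hinj (by rw [hπ, hπ, hij])
  let p : Equiv.Perm (Fin (n + 1)) := Equiv.ofBijective π (Finite.injective_iff_bijective.1 hπi)
  have h1 : (vandermonde ψ').det = (Equiv.Perm.sign p : ℤ) * (vandermonde θ).det := by
    rw [← det_permute]
    congr 1
    ext i j
    simp [vandermonde_apply, hπ, p]
  have h2 : (vandermonde ψ').det = (∏ i, (ψ i - algebraMap K _ c)) * (vandermonde ψ).det := by
    rw [det_vandermonde, Fin.prod_univ_succ]
    simp only [hψ', Fin.prod_Ioi_zero, Fin.cons_zero, Fin.cons_succ, Fin.prod_Ioi_succ]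
    rw [← det_vandermonde]
  have h3 : algebraMap K (AlgebraicClosure K) (f.eval c) = ∏ i, (algebraMap K _ c - ψ i) := by
    rw [← aeval_eq_prod hψ, aeval_algebraMap_apply, coe_aeval_eq_eval]
  have h4 : ∏ i, (ψ i - algebraMap K _ c) = (-1) ^ n * algebraMap K _ (f.eval c) := by
    have : ∀ i, ψ i - algebraMap K _ c = (-1) * (algebraMap K _ c - ψ i) := fun i => by ring
    rw [h3]
    simp only [this, Finset.prod_mul_distrib, Finset.prod_const, Finset.card_univ, Fintype.card_fin]
  have h5 : (-1 : AlgebraicClosure K) ^ n * algebraMap K _ (f.eval c) ≠ 0 := by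
    rw [← h4]
    intro h0
    exact vandermonde_det_ne_zero hinj (by rw [h2, h0, zero_mul])
  refine ⟨ψ, injective_of_separable hψ (hsep.of_mul_left), hψ,
    ((Equiv.Perm.sign p : ℤ) : K) * δ / ((-1) ^ n * f.eval c), ?_⟩
  rw [map_div₀, map_mul, map_intCast, hδ, ← h1, h2, h4, map_mul, map_pow, map_neg, map_one,
    mul_div_cancel_left₀ _ h5]

/-- Division by `X - x` is bounded: the coefficients of `e = (X - x)h` satisfy `hᵢ = eᵢ₊₁ + x hᵢ₊₁`,
which is solved downwards from the top degree. -/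
lemma polyNorm_le_of_mul_X_sub_C (v : AbsoluteValue K ℝ) {h : K[X]} {n : ℕ} (hn : h.natDegree < n)
    {x : K} {B : ℝ} (hB : 1 ≤ B) (hx : v x ≤ B) :
    polyNorm v h ≤ n * (B ^ n * polyNorm v ((X - C x) * h)) := by
  set e := (X - C x) * h with he
  have hco : ∀ i, h.coeff i = e.coeff (i + 1) + x * h.coeff (i + 1) := fun i => by
    rw [he, sub_mul, coeff_sub, coeff_X_mul, coeff_C_mul]; ring
  have key : ∀ j i, n ≤ i + j → v (h.coeff i) ≤
      B ^ j * ∑ l ∈ Finset.Icc (i + 1) n, v (e.coeff l) := by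
    intro j
    induction j with
    | zero =>
      intro i hi
      rw [coeff_eq_zero_of_natDegree_lt (by omega), map_zero]
      positivity
    | succ j ih =>
      intro i hi
      by_cases hin : n ≤ i
      · rw [coeff_eq_zero_of_natDegree_lt (by omega), map_zero]
        positivity
      have h0 : 0 ≤ ∑ l ∈ Finset.Icc (i + 1 + 1) n, v (e.coeff l) :=
        Finset.sum_nonneg fun _ _ => v.nonneg _
      have h1 := v.add_le (e.coeff (i + 1)) (x * h.coeff (i + 1))
      rw [← hco, map_mul] at h1
      have h2 := mul_le_mul hx (ih (i + 1) (by omega)) (v.nonneg _) (by linarith)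
      have h3 : v (e.coeff (i + 1)) ≤ B ^ (j + 1) * v (e.coeff (i + 1)) :=
        le_mul_of_one_le_left (v.nonneg _) (one_le_pow₀ hB)
      rw [← Finset.add_sum_Ioc_eq_sum_Icc (by omega), mul_add, ← Finset.Icc_add_one_left_eq_Ioc]
      have h4 : B * (B ^ j * ∑ l ∈ Finset.Icc (i + 1 + 1) n, v (e.coeff l)) =
        B ^ (j + 1) * ∑ l ∈ Finset.Icc (i + 1 + 1) n, v (e.coeff l) := by ring
      linarith
  have hsum : ∀ i, ∑ l ∈ Finset.Icc (i + 1) n, v (e.coeff l) ≤ polyNorm v e := by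
    intro i
    rw [polyNorm_eq]
    calc _ ≤ ∑ l ∈ Finset.Icc (i + 1) n ∪ e.support, v (e.coeff l) :=
          Finset.sum_le_sum_of_subset_of_nonneg Finset.subset_union_left fun _ _ _ => v.nonneg _
      _ = _ := by
        refine (Finset.sum_subset Finset.subset_union_right fun l _ hl => ?_).symm
        rw [notMem_support_iff.1 hl, map_zero]
  have h5 : ∀ i, v (h.coeff i) ≤ B ^ n * polyNorm v e := fun i =>
    (key n i (by omega)).trans (mul_le_mul_of_nonneg_left (hsum i) (by positivity))
  calc polyNorm v h = h.sum fun _ c => v c := rfl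
    _ = ∑ i ∈ Finset.range n, v (h.coeff i) := sum_coeff_eq_sum_range v h hn
    _ ≤ ∑ i ∈ Finset.range n, B ^ n * polyNorm v e := Finset.sum_le_sum fun i _ => h5 i
    _ = _ := by simp

end Vandermonde

/-! ### The Newton polygon excluding rational roots -/

section NoRoot

variable {A K : Type*} [CommRing A] [IsDomain A] [ValuationRing A] [Field K] [Algebra A K]
  [IsFractionRing A K]

/-- The Mestre equation over a valuation ring. -/
lemma exists_integral_pencil {m : ℕ} (hm : 0 < m)
    (hk : ∀ j : ℕ, 0 < j → j ≤ 2 * m + 1 → (j : ResidueField A) ≠ 0)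
    {P : A[X]} (hP : P.Monic) (hPr : P.map (residue A) = X ^ (2 * m + 1) - 1)
    {R Q : K[X]} (hR0 : R ≠ 0)
    (hRd : R.degree < (2 * m + 1 : ℕ)) (hQd : Q.degree < (2 * m + 1 : ℕ))
    (hR : P.map (algebraMap A K) ∣ derivative (derivative (P.map (algebraMap A K))) * R -
      2 * derivative (P.map (algebraMap A K)) * derivative R)
    (hW : derivative (P.map (algebraMap A K)) * Q - P.map (algebraMap A K) * derivative Q = R ^ 2) :
    ∃ c : K, c ≠ 0 ∧ ∃ (Q₁ R₁ : A[X]) (c₁ : A) (κ ρ : ResidueField A),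
      Q₁.map (algebraMap A K) = C c * Q ∧ Q₁.map (residue A) = C κ ∧ κ ≠ 0 ∧
      R₁.map (residue A) = C ρ * X ^ m ∧ ρ ≠ 0 ∧ residue A c₁ ≠ 0 ∧
      Q₁.degree < (2 * m + 1 : ℕ) ∧ R₁.degree < (2 * m + 1 : ℕ) ∧
      derivative P * Q₁ - P * derivative Q₁ = C c₁ * R₁ ^ 2 := by
  have hinj := IsFractionRing.injective A K
  obtain ⟨c, hc, Q₁, hQ₁, κ, hκ, hQκ⟩ :=
    exists_partner_reduction hm hk hP hPr hR0 hRd hQd hR hW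
  obtain ⟨c₂, hc₂, R₁, hR₁, hR₁0⟩ := exists_primitive_scaling (A := A) hR0
  have hQ₁d : Q₁.degree < (2 * m + 1 : ℕ) := by
    rw [← degree_map_eq_of_injective hinj, hQ₁, degree_C_mul hc]; exact hQd
  have hR₁d : R₁.degree < (2 * m + 1 : ℕ) := by
    rw [← degree_map_eq_of_injective hinj, hR₁, degree_C_mul hc₂]; exact hRd
  set W := derivative P * Q₁ - P * derivative Q₁ with hWdef
  have hWK : W.map (algebraMap A K) = C c * R ^ 2 := by
    rw [hWdef, ← hW]
    simp only [Polynomial.map_sub, Polynomial.map_mul, ← derivative_map, hQ₁, derivative_C_mul]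
    ring
  have hWr : W.map (residue A) = C (((2 * m + 1 : ℕ) : ResidueField A) * κ) * X ^ (2 * m) := by
    rw [hWdef]
    simp only [Polynomial.map_sub, Polynomial.map_mul, ← derivative_map, hPr, hQκ, derivative_sub,
      derivative_one, derivative_C, derivative_X_pow, C_mul, sub_zero, mul_zero, add_tsub_cancel_right]
    ring
  have hNκ : ((2 * m + 1 : ℕ) : ResidueField A) * κ ≠ 0 := mul_ne_zero (hk _ (by omega) le_rfl) hκ
  -- `W` and `R₁²` are proportional over `K` and both have nonzero reduction, so the factor is a
  -- unit.
  obtain ⟨c₁, hc₁, hWR⟩ : ∃ c₁ : A, residue A c₁ ≠ 0 ∧ W = C c₁ * R₁ ^ 2 := by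
    have e : C (c₂ ^ 2) * W.map (algebraMap A K) = C c * (R₁ ^ 2).map (algebraMap A K) := by
      rw [hWK, Polynomial.map_pow, hR₁, C_pow]; ring
    rcases ValuationRing.isInteger_or_isInteger A (c₂ ^ 2 / c) with ⟨a, ha⟩ | ⟨a, ha⟩
    · have e1 : C a * W = R₁ ^ 2 := by
        refine map_injective _ hinj ?_
        rw [Polynomial.map_mul, map_C, ha, div_eq_mul_inv, mul_comm (c₂ ^ 2), C_mul, mul_assoc, e,
          ← mul_assoc, ← C_mul, inv_mul_cancel₀ hc, C_1, one_mul]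
      have ha0 : residue A a ≠ 0 := by
        intro h0
        have := congrArg (Polynomial.map (residue A)) e1
        rw [Polynomial.map_mul, map_C, h0, C_0, zero_mul, Polynomial.map_pow] at this
        exact hR₁0 ((pow_eq_zero_iff two_ne_zero).1 this.symm)
      obtain ⟨b, hb⟩ := (residue_ne_zero_iff_isUnit a).1 ha0
      refine ⟨(b⁻¹ : Aˣ), (residue_ne_zero_iff_isUnit _).2 (b⁻¹).isUnit, ?_⟩
      rw [← e1, ← hb, ← mul_assoc, ← C_mul]; simp
    · have e1 : W = C a * R₁ ^ 2 := by
        refine map_injective _ hinj ?_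
        rw [Polynomial.map_mul, map_C, ha, inv_div, div_eq_mul_inv, mul_comm c, C_mul, mul_assoc, ← e,
          ← mul_assoc, ← C_mul, inv_mul_cancel₀ (pow_ne_zero 2 hc₂), C_1, one_mul]
      refine ⟨a, fun h0 => ?_, e1⟩
      have := congrArg (Polynomial.map (residue A)) e1
      rw [hWr, Polynomial.map_mul, map_C, h0, C_0, zero_mul, C_mul_X_pow_eq_monomial,
        monomial_eq_zero_iff] at this
      exact hNκ this
  obtain ⟨ρ, hρ⟩ : ∃ ρ, R₁.map (residue A) = C ρ * X ^ m := by
    have e1 : C (residue A c₁) * (R₁.map (residue A)) ^ 2 =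
        C (((2 * m + 1 : ℕ) : ResidueField A) * κ) * X ^ (2 * m) := by
      rw [← hWr, hWR]; simp
    have e2 : R₁.map (residue A) ∣ X ^ (2 * m) := by
      have : R₁.map (residue A) ∣ C (((2 * m + 1 : ℕ) : ResidueField A) * κ) * X ^ (2 * m) := by
        rw [← e1, sq]; exact (dvd_mul_right _ _).mul_left _
      exact (isUnit_C.2 hNκ.isUnit).dvd_mul_left.1 this
    obtain ⟨i, hi, h⟩ := (dvd_prime_pow prime_X _).1 e2
    obtain ⟨w, hw⟩ := h.symm
    obtain ⟨r, hr, hrw⟩ := Polynomial.isUnit_iff.1 w.isUnit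
    have e3 : R₁.map (residue A) = C r * X ^ i := by rw [← hw, ← hrw, mul_comm]
    have e4 := congrArg natDegree e1
    rw [e3, natDegree_C_mul hc₁, natDegree_pow, natDegree_C_mul_X_pow _ _ hr.ne_zero,
      natDegree_C_mul_X_pow _ _ hNκ] at e4
    exact ⟨r, by rw [e3]; congr 2; omega⟩
  exact ⟨c, hc, Q₁, R₁, c₁, κ, ρ, hQ₁, hQκ, hκ, hρ, by rintro rfl; simp [hρ] at hR₁0, hc₁, hQ₁d,
    hR₁d, hWR⟩

omit [IsDomain A] [ValuationRing A] in
lemma exists_eq_add_C_mul [IsLocalRing A] {π : A} (hπ : ∀ a : A, residue A a = 0 ↔ π ∣ a)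
    {f g : A[X]} (h : f.map (residue A) = g.map (residue A)) : ∃ e, f = g + C π * e := by
  obtain ⟨e, he⟩ : C π ∣ f - g := by
    rw [C_dvd_iff_dvd_coeff]
    intro i
    rw [← hπ, coeff_sub, map_sub, ← coeff_map, ← coeff_map, h, sub_self]
  exact ⟨e, by rw [← he]; ring⟩

omit [ValuationRing A] in
/-- The Newton polygon of the member `F` of a Mestre pencil with `F 0 = 0`. -/
lemma coeff_of_pencil [IsLocalRing A] {π : A} (hπ : ∀ a : A, residue A a = 0 ↔ π ∣ a) (hπ0 : π ≠ 0) {m : ℕ}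
    (hm : 2 ≤ m) (hk : ∀ j : ℕ, 0 < j → j ≤ 2 * m + 1 → (j : ResidueField A) ≠ 0)
    {F Q R : A[X]} {c s u : A} {κ ρ : ResidueField A} (hFd : F.Monic)
    (hF : F.map (residue A) = X ^ (2 * m + 1)) (hF0 : F.coeff 0 = 0)
    (hFm : F.coeff (m + 1) = π * u - s * Q.coeff (m + 1)) (hu : residue A u ≠ 0)
    (hQ : Q.map (residue A) = C κ) (hκ : κ ≠ 0)
    (hR : R.map (residue A) = C ρ * X ^ m) (hρ : ρ ≠ 0) (hc : residue A c ≠ 0)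
    (hRd : R.degree < (2 * m + 1 : ℕ))
    (hW : derivative F * Q - F * derivative Q = C c * R ^ 2) :
    (∃ a, residue A a ≠ 0 ∧ F.coeff 1 = π ^ 2 * a) ∧
      (∀ i, i ≤ m → π ^ 2 ∣ F.coeff i) ∧ ∀ i, i < 2 * m + 1 → π ∣ F.coeff i := by
  have hnd : F.natDegree = 2 * m + 1 := by
    rw [← hFd.natDegree_map (residue A), hF, natDegree_X_pow]
  obtain ⟨E, hE⟩ := exists_eq_add_C_mul hπ (g := X ^ (2 * m + 1)) (by simpa using hF)
  obtain ⟨κ, rfl⟩ := residue_surjective κ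
  obtain ⟨ρ, rfl⟩ := residue_surjective ρ
  obtain ⟨Q', hQ'⟩ := exists_eq_add_C_mul hπ (g := C κ) (by simpa using hQ)
  obtain ⟨R', hR'⟩ := exists_eq_add_C_mul hπ (g := C ρ * X ^ m) (by simpa using hR)
  have hEc : ∀ i, 2 * m + 1 ≤ i → E.coeff i = 0 := by
    intro i hi
    have h1 := congrArg (coeff · i) hE
    simp only [coeff_add, coeff_X_pow, coeff_C_mul] at h1
    rcases hi.eq_or_lt with rfl | hlt
    · have h2 : F.coeff (2 * m + 1) = 1 := by rw [← hnd]; exact hFd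
      rw [h2, if_pos rfl] at h1
      simpa [hπ0] using h1
    · rw [if_neg hlt.ne', coeff_eq_zero_of_natDegree_lt (by omega)] at h1
      simpa [hπ0] using h1
  have hRc : ∀ i, 2 * m + 1 ≤ i → R'.coeff i = 0 := by
    intro i hi
    have h1 := congrArg (coeff · i) hR'
    rw [coeff_eq_zero_of_degree_lt (hRd.trans_le (by exact_mod_cast hi))] at h1
    simp only [coeff_add, coeff_X_pow, coeff_C_mul] at h1
    rw [if_neg (by omega)] at h1
    simpa [hπ0] using h1
  have hFE : ∀ i, i < 2 * m + 1 → F.coeff i = π * E.coeff i := by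
    intro i hi
    have h1 := congrArg (coeff · i) hE
    simp only [coeff_add, coeff_X_pow, coeff_C_mul] at h1
    rwa [if_neg (by omega), zero_add] at h1
  have hE0 : E.coeff 0 = 0 := by
    have := hFE 0 (by omega)
    rw [hF0] at this
    simpa [hπ0] using this.symm
  -- The Wronskian identity expanded in powers of `π` after substituting `F = X^N + πE`, `Q = κ +
  -- πQ'`, `R = ρX^m + πR'`. The part free of `π` lives only in degree `2m`, so in every other
  -- degree the linear part vanishes modulo `π`.
  have key : C (((2 * m + 1 : ℕ) : A) * κ - c * ρ ^ 2) * X ^ (2 * m) +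
      C π * (C κ * derivative E + C ((2 * m + 1 : ℕ) : A) * (Q' * X ^ (2 * m)) -
        derivative Q' * X ^ (2 * m + 1) - C (2 * c * ρ) * (R' * X ^ m)) +
      C (π ^ 2) * (derivative E * Q' - E * derivative Q' - C c * R' ^ 2) = 0 := by
    have h1 := hW
    rw [hE, hQ', hR'] at h1
    simp only [derivative_add, derivative_X_pow, derivative_C_mul, derivative_C, zero_add,
      add_tsub_cancel_right] at h1
    simp only [C_mul, C_sub, C_pow, map_ofNat]
    linear_combination h1
  have coef : ∀ i, i ≠ 2 * m → residue A ((C κ * derivative E + C ((2 * m + 1 : ℕ) : A) *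
      (Q' * X ^ (2 * m)) - derivative Q' * X ^ (2 * m + 1) - C (2 * c * ρ) * (R' * X ^ m)).coeff i)
      = 0 := by
    intro i hi
    have h1 := congrArg (coeff · i) key
    rw [hπ]
    simp only [coeff_add, coeff_C_mul, coeff_X_pow, if_neg hi, coeff_zero, mul_zero, zero_add] at h1 ⊢
    refine ⟨-(derivative E * Q' - E * derivative Q' - C c * R' ^ 2).coeff i, ?_⟩
    refine mul_left_cancel₀ hπ0 ?_
    simp only [coeff_C_mul, coeff_add, coeff_sub] at h1 ⊢
    linear_combination h1
  simp only [coeff_add, coeff_sub, coeff_C_mul, coeff_derivative, coeff_mul_X_pow'] at coef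
  simp only [map_add, map_sub, map_mul, map_ofNat, map_natCast, map_one] at coef
  have hκ' : residue A κ ≠ 0 := hκ
  -- Below degree `m` only `κE'` contributes to the linear part.
  have h1 : ∀ j, j < m → residue A (E.coeff (j + 1)) = 0 := by
    intro j hj
    have h := coef j (by omega)
    rw [if_neg (by omega), if_neg (by omega), if_neg (by omega)] at h
    simp only [map_zero, mul_zero, add_zero, sub_zero] at h
    have h0 := hk (j + 1) (by omega) (by omega)
    push_cast at h0
    simpa [hκ', h0] using h
  -- In degree `3m + 1` the terms in `E` and `R'` have run out, leaving `(2m + 1) - (m + 1) = m`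
  -- times this coefficient.
  have h2 : residue A (Q'.coeff (m + 1)) = 0 := by
    have h := coef (3 * m + 1) (by omega)
    rw [if_pos (by omega), if_pos (by omega), if_pos (by omega), hEc _ (by omega), hRc _ (by omega),
      show 3 * m + 1 - 2 * m = m + 1 by omega, show 3 * m + 1 - (2 * m + 1) = m by omega] at h
    have h0 := hk m (by omega) (by omega)
    have h : (m : ResidueField A) * residue A (Q'.coeff (m + 1)) = 0 := by
      simp only [map_zero, map_mul, map_add, map_natCast, map_one] at h
      push_cast at h
      linear_combination h
    exact (mul_eq_zero.1 h).resolve_left h0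
  -- So the correction `sQ` does not disturb the coefficient of `X^(m+1)` to first order, and it
  -- remains a unit times `π`.
  have h3 : residue A (E.coeff (m + 1)) ≠ 0 := by
    have h : E.coeff (m + 1) = u - s * Q'.coeff (m + 1) := by
      refine mul_left_cancel₀ hπ0 ?_
      rw [← hFE _ (by omega), hFm, hQ', coeff_add, coeff_C_succ, coeff_C_mul]
      ring
    rwa [h, map_sub, map_mul, h2, mul_zero, sub_zero]
  -- In degree `m` the linear part reads `(m + 1)κE_{m+1} ≡ 2cρR'₀`.
  have h4 : residue A (R'.coeff 0) ≠ 0 := by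
    intro h0
    have h := coef m (by omega)
    rw [if_neg (by omega), if_neg (by omega), if_pos le_rfl, Nat.sub_self, h0] at h
    simp only [map_zero, mul_zero, add_zero, sub_zero] at h
    have h5 := hk (m + 1) (by omega) (by omega)
    push_cast at h5
    simp [hκ', h3, h5] at h
  -- The constant term of the Wronskian identity, with `F₀ = 0` and `R₀ = πR'₀`; it makes the linear
  -- coefficient of `F` exactly divisible by `π²`.
  have h5 : F.coeff 1 * Q.coeff 0 = c * (π * R'.coeff 0) ^ 2 := by
    have h := congrArg (coeff · 0) hW
    simp only [coeff_sub, mul_coeff_zero, coeff_derivative, hF0, coeff_C_zero, sq] at h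
    have h6 : R.coeff 0 = π * R'.coeff 0 := by
      rw [hR']; simp [coeff_X_pow]; omega
    rw [h6] at h
    simp at h
    linear_combination h
  have h6 : IsUnit (Q.coeff 0) := by
    rw [← residue_ne_zero_iff_isUnit, ← coeff_map, hQ, coeff_C_zero]; exact hκ
  obtain ⟨b, hb⟩ := h6
  refine ⟨⟨c * R'.coeff 0 ^ 2 * (b⁻¹ : Aˣ), ?_, ?_⟩, ?_, fun i hi => ⟨_, hFE i hi⟩⟩
  · simp only [map_mul, map_pow]
    exact mul_ne_zero (mul_ne_zero hc (pow_ne_zero 2 h4))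
      ((residue_ne_zero_iff_isUnit _).2 (b⁻¹).isUnit)
  · rw [← hb] at h5
    calc F.coeff 1 = F.coeff 1 * b * (b⁻¹ : Aˣ) := by simp
      _ = _ := by rw [h5]; ring
  · intro i hi
    rcases i with _ | i
    · rw [hF0]; exact dvd_zero _
    · rw [hFE _ (by omega), sq]
      exact mul_dvd_mul_left _ ((hπ _).1 (h1 i (by omega)))

/-- The roots of a polynomial whose Newton polygon is a segment of slope `1 / m`. -/
lemma eval_ne_zero_of_coeff {π : A} (hπ : ∀ a : A, residue A a = 0 ↔ π ∣ a) (hπ0 : π ≠ 0) {m : ℕ}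
    (hm : 2 ≤ m) {f : A[X]} (hf : f.Monic) (hd : f.natDegree = 2 * m)
    (h0 : ∃ a, residue A a ≠ 0 ∧ π ^ 3 ∣ f.coeff 0 - π ^ 2 * a)
    (h1 : ∀ i, i < m → π ^ 2 ∣ f.coeff i) (h2 : ∀ i, i < 2 * m → π ∣ f.coeff i) (y : K) :
    (f.map (algebraMap A K)).eval y ≠ 0 := by
  intro hy
  have hint : IsIntegral A y := ⟨f, hf, by rw [← eval_map]; exact hy⟩
  obtain ⟨y, rfl⟩ := IsIntegrallyClosed.isIntegral_iff.1 hint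
  rw [eval_map_algebraMap, aeval_algebraMap_apply, coe_aeval_eq_eval,
    FaithfulSMul.algebraMap_eq_zero_iff, eval_eq_sum_range, hd] at hy
  have hy1 : π ∣ y := by
    rw [← hπ]
    have h3 := congrArg (residue A) hy
    rw [Finset.sum_range_succ, map_add, map_sum, Finset.sum_eq_zero, zero_add, map_zero] at h3
    · have : f.coeff (2 * m) = 1 := by rw [← hd]; exact hf
      rw [this, one_mul, map_pow] at h3
      exact eq_zero_of_pow_eq_zero h3
    · intro i hi
      rw [map_mul, (hπ _).2 (h2 i (Finset.mem_range.1 hi)), zero_mul]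
  obtain ⟨a, ha, h0⟩ := h0
  rw [Finset.sum_range_succ', pow_zero, mul_one] at hy
  -- Since `π ∣ y`, all nonconstant terms are divisible by `π³`: below index `m` as `π²·π`, from `m`
  -- on as `π·π²` because `m ≥ 2`, and in top degree since `2m ≥ 3`. The constant term is not.
  have h3 : π ^ 3 ∣ ∑ i ∈ Finset.range (2 * m), f.coeff (i + 1) * y ^ (i + 1) := by
    refine Finset.dvd_sum fun i hi => ?_
    have hi := Finset.mem_range.1 hi
    rcases lt_or_ge (i + 1) m with h | h
    · rw [show 3 = 2 + 1 by norm_num, pow_add]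
      refine mul_dvd_mul (h1 _ h) ?_
      rw [pow_one]
      exact hy1.trans (dvd_pow_self y (Nat.succ_ne_zero i))
    · rcases (show i + 1 ≤ 2 * m by omega).eq_or_lt with h' | h'
      · exact ((pow_dvd_pow_of_dvd hy1 3).trans (pow_dvd_pow y (by omega))).mul_left _
      · rw [show 3 = 1 + 2 by norm_num, pow_add, pow_one]
        exact mul_dvd_mul (h2 _ h') ((pow_dvd_pow_of_dvd hy1 2).trans (pow_dvd_pow y (by omega)))
  have h4 : π ^ 3 ∣ π ^ 2 * a := by
    have h5 := (dvd_add_right h3).1 (hy ▸ dvd_zero _)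
    simpa using dvd_sub h5 h0
  rw [pow_succ, mul_dvd_mul_iff_left (pow_ne_zero 2 hπ0), ← hπ] at h4
  exact ha h4

/-- Members of a Mestre pencil of odd degree with exactly one rational root. -/
lemma eval_ne_zero_of_pencil {π : A} (hπ : ∀ a : A, residue A a = 0 ↔ π ∣ a) {m : ℕ} (hm : 2 ≤ m)
    (hk : ∀ j : ℕ, 0 < j → j ≤ 2 * m + 1 → (j : ResidueField A) ≠ 0) (hπ0 : π ≠ 0)
    {P : A[X]} (hP : P.Monic)
    (hPr : P.map (residue A) = X ^ (2 * m + 1) - 1) {u : A} (hu : residue A u ≠ 0)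
    (hPu : P.coeff (m + 1) = π * u) {R Q : K[X]} (hR0 : R ≠ 0)
    (hRd : R.degree < (2 * m + 1 : ℕ)) (hQd : Q.degree < (2 * m + 1 : ℕ))
    (hR : P.map (algebraMap A K) ∣ derivative (derivative (P.map (algebraMap A K))) * R -
      2 * derivative (P.map (algebraMap A K)) * derivative R)
    (hW : derivative (P.map (algebraMap A K)) * Q - P.map (algebraMap A K) * derivative Q = R ^ 2)
    {x : A} (hx : π ^ 3 ∣ x) {t : K} {f : K[X]}
    (hf : (X - C (algebraMap A K x)) * f = P.map (algebraMap A K) - C t * Q) (y : K) :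
    f.eval y ≠ 0 := by
  have hinj := IsFractionRing.injective A K
  obtain ⟨c, hc, Q₁, R₁, c₁, κ, ρ, hQ₁, hQκ, hκ, hRρ, hρ, hc₁, hQ₁d, hR₁d, hWR⟩ :=
    exists_integral_pencil (by omega) hk hP hPr hR0 hRd hQd hR hW
  have hunit : ∀ z, IsUnit (Q₁.eval z) := by
    intro z
    have h := eval₂_at_apply (p := Q₁) (residue A) z
    rw [← eval_map, hQκ, eval_C] at h
    rwa [← residue_ne_zero_iff_isUnit, ← h]
  obtain ⟨b, hb⟩ := hunit 0
  rw [← coeff_zero_eq_eval_zero] at hb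
  set s := P.coeff 0 * (b⁻¹ : Aˣ) with hs
  set F := P - C s * Q₁ with hFdef
  have hF0 : F.coeff 0 = 0 := by
    rw [hFdef, coeff_sub, coeff_C_mul, ← hb, hs, mul_assoc, Units.inv_mul, mul_one, sub_self]
  have hPd : P.degree = (2 * m + 1 : ℕ) := by
    rw [← hP.degree_map (residue A), hPr]
    exact degree_X_pow_sub_C (Nat.succ_pos _) (1 : ResidueField A)
  have hCQ : ∀ s, (C s * Q₁).degree < ((2 * m + 1 : ℕ) : WithBot ℕ) := fun s =>
    ((smul_eq_C_mul s).symm ▸ degree_smul_le s Q₁).trans_lt hQ₁d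
  have hmonic : ∀ s, (P - C s * Q₁).Monic := fun s =>
    hP.sub_of_left (by rw [hPd]; exact hCQ _)
  have hFr : F.map (residue A) = X ^ (2 * m + 1) := by
    have h1 : residue A s * κ = -1 := by
      have h2 := congrArg (residue A) hF0
      rw [hFdef, coeff_sub, coeff_C_mul, map_sub, map_mul, ← coeff_map, ← coeff_map, hPr, hQκ] at h2
      simp at h2
      linear_combination -h2
    rw [hFdef, Polynomial.map_sub, Polynomial.map_mul, hPr, hQκ, map_C, ← C_mul, h1]
    simp
  obtain ⟨⟨a, ha, h1⟩, h2, h3⟩ := coeff_of_pencil (F := F) (s := s) hπ hπ0 hm hk (hmonic s) hFr hF0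
    (by rw [hFdef, coeff_sub, coeff_C_mul, hPu]) hu hQκ hκ hRρ hρ hc₁ hR₁d (by
      rw [hFdef]; simp only [derivative_sub, derivative_C_mul]; linear_combination hWR)
  obtain ⟨e, he⟩ := hunit x
  -- `F` is the member vanishing at `0`; `r` is the further shift of the parameter moving that root
  -- to `x`. As `π³ ∣ x` and `F(0) = 0`, also `π³ ∣ r`, so the cofactor agrees with `F/X` modulo
  -- `π³`, which suffices for the Newton polygon.
  set r := F.eval x * (e⁻¹ : Aˣ) with hr
  have hr3 : π ^ 3 ∣ r := by
    refine (hx.trans ?_).mul_right _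
    have h := sub_dvd_eval_sub x 0 F
    rwa [← coeff_zero_eq_eval_zero, hF0, sub_zero, sub_zero] at h
  set G := F - C r * Q₁ with hG
  have hG' : G = P - C (s + r) * Q₁ := by rw [hG, hFdef, C_add]; ring
  have hGx : G.eval x = 0 := by
    rw [hG, eval_sub, eval_mul, eval_C, ← he, hr, mul_assoc, Units.inv_mul, mul_one, sub_self]
  obtain ⟨f₁, hf₁⟩ := dvd_iff_isRoot.2 hGx
  have hf₁m : f₁.Monic := by
    have h := hmonic (s + r)
    rw [← hG', hf₁] at h
    exact (monic_X_sub_C x).of_mul_monic_left h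
  have hGd : G.natDegree = 2 * m + 1 := by
    have : G.degree = P.degree := by
      rw [hG']; exact degree_sub_eq_left_of_degree_lt
        (by rw [hPd]; exact hCQ _)
    exact natDegree_eq_of_degree_eq_some (this.trans hPd)
  have hf₁d : f₁.natDegree = 2 * m := by
    rw [hf₁, (monic_X_sub_C x).natDegree_mul hf₁m, natDegree_X_sub_C] at hGd
    omega
  have hQ0 : (Q.eval (algebraMap A K x)) ≠ 0 := by
    have h : algebraMap A K (Q₁.eval x) = c * Q.eval (algebraMap A K x) := by
      rw [← coe_aeval_eq_eval, ← aeval_algebraMap_apply, ← eval_map_algebraMap, hQ₁, eval_mul, eval_C]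
    intro h0
    rw [h0, mul_zero, ← he] at h
    exact e.ne_zero (hinj (by rw [h, map_zero]))
  have hcoef : ∀ i, π ^ 3 ∣ f₁.coeff i - F.coeff (i + 1) := by
    intro i
    have h := congrArg (coeff · (i + 1)) hf₁
    simp only [hG, coeff_sub, sub_mul, coeff_X_mul, coeff_C_mul] at h
    have h' : f₁.coeff i - F.coeff (i + 1) = x * f₁.coeff (i + 1) - r * Q₁.coeff (i + 1) := by
      linear_combination -h
    rw [h']
    exact dvd_sub (hx.mul_right _) (hr3.mul_right _)
  have hfin : f = f₁.map (algebraMap A K) := by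
    have h4 : (P - C (s + r) * Q₁).map (algebraMap A K) =
        P.map (algebraMap A K) - C (algebraMap A K (s + r) * c) * Q := by
      rw [Polynomial.map_sub, Polynomial.map_mul, hQ₁, map_C, C_mul, mul_assoc]
    have h5 := congrArg (Polynomial.map (algebraMap A K)) hf₁
    rw [hG', h4, Polynomial.map_mul, Polynomial.map_sub, map_X, map_C] at h5
    have h6 : t = algebraMap A K (s + r) * c := by
      have e1 := congrArg (eval (algebraMap A K x)) hf
      have e2 := congrArg (eval (algebraMap A K x)) h5
      simp only [eval_mul, eval_sub, eval_X, eval_C, sub_self, zero_mul] at e1 e2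
      refine mul_right_cancel₀ hQ0 ?_
      linear_combination e1 + e2
    rw [← h6, ← hf] at h5
    exact mul_left_cancel₀ (X_sub_C_ne_zero _) h5
  rw [hfin]
  have hlow : ∀ n, n ≤ 3 → ∀ i, π ^ n ∣ F.coeff (i + 1) → π ^ n ∣ f₁.coeff i := fun n hn i h => by
    simpa using dvd_add ((pow_dvd_pow π hn).trans (hcoef i)) h
  refine eval_ne_zero_of_coeff hπ hπ0 hm hf₁m hf₁d ⟨a, ha, ?_⟩ (fun i hi => ?_) (fun i hi => ?_) y
  · rw [← h1]; exact hcoef 0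
  · exact hlow 2 (by norm_num) i (h2 (i + 1) (by omega))
  · have := hlow 1 (by norm_num) i (by rw [pow_one]; exact h3 (i + 1) (by omega))
    rwa [pow_one] at this

end NoRoot
end AnLocal

namespace AnLocal

open Polynomial IsDedekindDomain IsLocalRing

/-! ### The cofactor of a rational root in a pencil -/

section LocalPencil

variable {K : Type*} [Field K]

/-- The middle coefficients of `X^N - 1` vanish, so `gⱼ = z gⱼ₊₁` there; a zero coefficient would
propagate down to `g₀`, but `z g₀ = 1`. -/
lemma coeff_ne_zero_of_mul_eq {g : K[X]} {z : K} {N : ℕ} (hN : N ≠ 0)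
    (h : g * (X - C z) = X ^ N - 1) {j : ℕ} (hj : j < N) : g.coeff j ≠ 0 := by
  induction j with
  | zero =>
    intro h0
    have := congrArg (coeff · 0) h
    simp [h0, coeff_X_pow, hN.symm] at this
  | succ j ih =>
    intro h0
    have := congrArg (coeff · (j + 1)) h
    simp [mul_sub, h0, coeff_X_pow, hj.ne, coeff_one] at this
    exact ih (by omega) this

lemma exists_delta_polynomial_eval (v : AbsoluteValue K ℝ) (f : K[X]) (a : K) {ε : ℝ} (hε : 0 < ε) :
    ∃ δ > 0, ∀ x, v (x - a) < δ → v (f.eval x - f.eval a) < ε := by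
  obtain ⟨δ, hδ, h⟩ := exists_delta_eval (absSeminorm v)
    (aeval (MvPolynomial.X () : MvPolynomial Unit K) f) (fun _ => a) hε
  refine ⟨δ, hδ, fun x hx => ?_⟩
  have e : ∀ z : K, MvPolynomial.eval (fun _ : Unit => z)
      (aeval (MvPolynomial.X () : MvPolynomial Unit K) f) = f.eval z := by
    intro z
    have := aeval_algHom_apply (MvPolynomial.aeval (fun _ : Unit => z)) (MvPolynomial.X ()) f
    rw [MvPolynomial.aeval_X] at this
    simpa [MvPolynomial.aeval_eq_eval] using this.symm
  have := h (fun _ => x) (fun _ => hx)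
  rwa [e, e] at this

/-- The cofactor of a root `x` in a pencil depends continuously on `x`. -/
lemma exists_delta_pencil (v : AbsoluteValue K ℝ) (P Q : K[X]) {a : K} (hQ : Q.eval a ≠ 0)
    {ε : ℝ} (hε : 0 < ε) : ∃ δ > 0, ∀ x, v (x - a) < δ → Q.eval x ≠ 0 ∧ ∀ f : K[X],
      f.natDegree ≤ P.natDegree →
      (X - C x) * f = P * (X - C a) - C ((P * (X - C a)).eval x / Q.eval x) * Q →
      polyNorm v (f - P) < ε ∧ polyNorm v ((X - C x) * f - P * (X - C a)) < ε := by
  obtain ⟨δ₁, hδ₁, h₁⟩ := exists_delta_polynomial_eval v P a one_pos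
  have hQ' : 0 < v (Q.eval a) := v.pos hQ
  obtain ⟨δ₂, hδ₂, h₂⟩ := exists_delta_polynomial_eval v Q a (half_pos hQ')
  set n : ℝ := P.natDegree + 1
  set B := (v (P.eval a) + 1) / (v (Q.eval a) / 2) with hB
  have hB0 : 0 < B := by positivity
  have hQn : 0 ≤ polyNorm v Q := apply_nonneg _ _
  have hPn : 0 ≤ polyNorm v P := apply_nonneg _ _
  set D := B * polyNorm v Q + polyNorm v P + 1 with hD
  have hD0 : 0 < D := by positivity
  set E := n * (v a + 1) ^ (P.natDegree + 1) * D + D with hE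
  have hE0 : 0 < E := by positivity
  refine ⟨min (min δ₁ δ₂) (min 1 (ε / E)), lt_min (lt_min hδ₁ hδ₂) (lt_min one_pos (by positivity)),
    fun x hx => ?_⟩
  rw [lt_min_iff, lt_min_iff, lt_min_iff] at hx
  obtain ⟨⟨hx1, hx2⟩, hx3, hx4⟩ := hx
  have hQx : v (Q.eval a) / 2 ≤ v (Q.eval x) := by
    have h := h₂ x hx2
    have := v.add_le (Q.eval x) (-(Q.eval x - Q.eval a))
    rw [v.map_neg, show Q.eval x + -(Q.eval x - Q.eval a) = Q.eval a by ring] at this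
    linarith
  have hPx : v (P.eval x) ≤ v (P.eval a) + 1 := by
    have h := h₁ x hx1
    have := v.add_le (P.eval a) (P.eval x - P.eval a)
    rw [add_sub_cancel] at this
    linarith
  have hQx0 : Q.eval x ≠ 0 := v.pos_iff.1 ((half_pos hQ').trans_le hQx)
  refine ⟨hQx0, fun f hf h => ?_⟩
  set t := (P * (X - C a)).eval x / Q.eval x with ht
  -- The parameter is `t = P(x)(x - a)/Q(x)`, which is of the order of `x - a` because `Q` does not
  -- vanish near `a`.
  have htv : v t ≤ v (x - a) * B := by
    rw [ht, eval_mul, map_div₀, map_mul, eval_sub, eval_X, eval_C, hB, mul_comm, mul_div_assoc]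
    gcongr
  have hn : ∀ c : K, ∀ g, polyNorm v (C c * g) = v c * polyNorm v g := fun c g => polyNorm_C_mul v c g
  have h3 : polyNorm v ((X - C x) * f - P * (X - C a)) ≤ v (x - a) * (B * polyNorm v Q) := by
    rw [h, show P * (X - C a) - C t * Q - P * (X - C a) = -(C t * Q) by ring, map_neg_eq_map, hn,
      ← mul_assoc]
    gcongr
  have h4 : polyNorm v ((X - C x) * (f - P)) ≤ v (x - a) * D := by
    -- Both terms are of order `x - a`; the bounded division by `X - x` then controls `f - P`.
    have e : (X - C x) * (f - P) = ((X - C x) * f - P * (X - C a)) + C (x - a) * P := by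
      rw [C_sub]; ring
    have h5 := map_add_le_add (polyNorm v) ((X - C x) * f - P * (X - C a)) (C (x - a) * P)
    rw [← e, hn] at h5
    have h6 := v.nonneg (x - a)
    rw [hD]
    nlinarith
  have hxa : v x ≤ v a + 1 := by
    have := v.add_le (x - a) a
    rw [sub_add_cancel] at this
    linarith
  have h5 := polyNorm_le_of_mul_X_sub_C v (h := f - P) (n := P.natDegree + 1)
    (by have := natDegree_sub_le f P; omega) (B := v a + 1)
    (by have := v.nonneg a; linarith) hxa
  have h6 : v (x - a) * E < ε := (lt_div_iff₀ hE0).1 hx4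
  have h7 := v.nonneg (x - a)
  constructor
  · refine lt_of_le_of_lt (h5.trans ?_) h6
    push_cast
    have : n * ((v a + 1) ^ (P.natDegree + 1) * polyNorm v ((X - C x) * (f - P))) ≤
        n * ((v a + 1) ^ (P.natDegree + 1) * (v (x - a) * D)) := by gcongr
    refine this.trans ?_
    rw [hE]
    nlinarith [mul_nonneg h7 hD0.le]
  · refine lt_of_le_of_lt (h3.trans (mul_le_mul_of_nonneg_left ?_ h7)) h6
    rw [hE]
    have : 0 ≤ n * (v a + 1) ^ (P.natDegree + 1) * D := by positivity
    linarith

end LocalPencil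

/-! ### Uniformizers and the root-free cofactor at a finite prime -/

section Uniformizer

variable {K : Type*} [Field K] [NumberField K]

lemma exp_neg_one_lt_one : WithZero.exp (-1 : ℤ) < 1 := by
  rw [← WithZero.exp_zero, WithZero.exp_lt_exp]; norm_num

lemma le_exp_neg_one_of_lt_one {x : WithZero (Multiplicative ℤ)} (h : x < 1) :
    x ≤ WithZero.exp (-1 : ℤ) := by
  rcases eq_or_ne x 0 with rfl | h0
  · exact zero_le
  · rw [← WithZero.exp_log h0] at h ⊢
    rw [← WithZero.exp_zero, WithZero.exp_lt_exp] at h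
    rw [WithZero.exp_le_exp]
    omega

lemma residue_valRing_eq_zero_iff_dvd {q : HeightOneSpectrum (𝓞 K)} {π : valRing q}
    (hπ : q.valuation K (π : K) = WithZero.exp (-1 : ℤ)) (a : valRing q) :
    residue _ a = 0 ↔ π ∣ a := by
  have h0 : (π : K) ≠ 0 := by
    intro h; rw [h, map_zero] at hπ; exact absurd hπ.symm WithZero.exp_ne_zero
  rw [residue_valRing_eq_zero_iff, placeAbs_finite_lt_one_iff]
  constructor
  · intro h
    have h1 : q.valuation K (a : K) ≤ q.valuation K (π : K) := by
      rw [hπ]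
      exact le_exp_neg_one_of_lt_one h
    refine ⟨⟨(a : K) / π, ?_⟩, ?_⟩
    · rw [mem_valRing_iff, placeAbs_finite_le_one_iff, map_div₀]
      exact div_le_one_of_le₀ h1 zero_le
    · ext
      simp [mul_div_cancel₀ _ h0]
  · rintro ⟨b, rfl⟩
    have hb := (placeAbs_finite_le_one_iff q _).1 ((mem_valRing_iff q b).1 b.2)
    have : q.valuation K (π : K) < 1 := by rw [hπ]; exact exp_neg_one_lt_one
    push_cast
    rw [map_mul]
    exact mul_lt_one_of_lt_of_le this hb

/-- Rational roots of the cofactor of a root `x` in a pencil, for small `x`. -/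
lemma exists_delta_eval_ne_zero {m : ℕ} (hm : 2 ≤ m) {q : HeightOneSpectrum (𝓞 K)}
    (hq : ∀ j : ℕ, 0 < j → j ≤ 2 * m + 1 → (j : 𝓞 K) ∉ q.asIdeal) {π : K}
    (hπ : q.valuation K π = WithZero.exp (-1 : ℤ)) {P R Q : K[X]} (hP : P.Monic)
    (hPq : CongrAt q P (X ^ (2 * m + 1) - 1))
    (hPπ : placeAbs (Sum.inl q) (P.coeff (m + 1)) = placeAbs (Sum.inl q) π) (hR0 : R ≠ 0)
    (hRd : R.degree < (2 * m + 1 : ℕ)) (hQd : Q.degree < (2 * m + 1 : ℕ))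
    (hR : P ∣ derivative (derivative P) * R - 2 * derivative P * derivative R)
    (hW : derivative P * Q - P * derivative Q = R ^ 2) :
    ∃ δ > 0, ∀ x, placeAbs (Sum.inl q) x < δ → ∀ t f, (X - C x) * f = P - C t * Q →
      ∀ y, f.eval y ≠ 0 := by
  have h0 : π ≠ 0 := by
    intro h; rw [h, map_zero] at hπ; exact absurd hπ.symm WithZero.exp_ne_zero
  have hπ1 : placeAbs (Sum.inl q) π ≤ 1 := by
    rw [placeAbs_finite_le_one_iff, hπ]; exact exp_neg_one_lt_one.le
  let ϖ : valRing q := ⟨π, (mem_valRing_iff q _).2 hπ1⟩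
  have hϖ := residue_valRing_eq_zero_iff_dvd (q := q) (π := ϖ) hπ
  obtain ⟨P, rfl, hPr⟩ := CongrAt.exists_lift (f := P) (q := q) (G := X ^ (2 * m + 1) - 1)
    (by simpa using hPq)
  have hPm : P.Monic := monic_of_injective (IsFractionRing.injective (valRing q) K) hP
  have hu1 : placeAbs (Sum.inl q) ((P.coeff (m + 1) : K) / π) = 1 := by
    rw [coeff_map] at hPπ
    have h1 : placeAbs (Sum.inl q) π ≠ 0 := by simpa using h0
    rw [map_div₀, show placeAbs (Sum.inl q) (P.coeff (m + 1) : K) = _ from hPπ, div_self h1]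
  refine ⟨placeAbs (Sum.inl q) π ^ 3, by have := (placeAbs (Sum.inl q)).pos h0; positivity,
    fun x hx t f hf y => ?_⟩
  have hx3 : placeAbs (Sum.inl q) (x / π ^ 3) ≤ 1 := by
    rw [map_div₀, map_pow]
    exact div_le_one_of_le₀ hx.le (by positivity)
  let x' : valRing q := ϖ ^ 3 * ⟨x / π ^ 3, (mem_valRing_iff q _).2 hx3⟩
  have hxx : algebraMap (valRing q) K x' = x := by
    change π ^ 3 * (x / π ^ 3) = x
    field_simp
  refine eval_ne_zero_of_pencil hϖ hm (fun j hj hjm => natCast_residue_ne_zero (hq j hj hjm))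
    (fun h => h0 (congrArg Subtype.val h)) hPm (by simpa using hPr)
    (u := ⟨(P.coeff (m + 1) : K) / π, (mem_valRing_iff q _).2 hu1.le⟩) ?_ ?_ hR0 hRd hQd hR hW
    (x := x') (Dvd.intro _ rfl) (t := t) (by rw [hxx]; exact hf) y
  · rw [Ne, residue_valRing_eq_zero_iff]
    exact hu1.not_lt
  · ext
    change (P.coeff (m + 1) : K) = π * (P.coeff (m + 1) / π)
    field_simp

end Uniformizer
end AnLocal

namespace AnLocal

open Polynomial IsDedekindDomain

/-! ### From odd degree to even degree -/

section EvenStep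

variable {K : Type*} [Field K] [NumberField K]

/-- A last root making the coefficient of `X ^ j` a uniformizer. -/
lemma exists_root_coeff {q : HeightOneSpectrum (𝓞 K)} {π : K}
    (hπ : q.valuation K π = WithZero.exp (-1 : ℤ)) {N j : ℕ} (hj : j + 1 < N)
    {f : K[X]} {g : (𝓞 K)[X]} {z : 𝓞 K} (hf : CongrAt q f (g.map (algebraMap (𝓞 K) K)))
    (hg : (g * (X - C z)).map (Ideal.Quotient.mk q.asIdeal) = X ^ N - 1) :
    ∃ a : K, placeAbs (Sum.inl q) (a - algebraMap (𝓞 K) K z) < 1 ∧ ∀ x,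
      placeAbs (Sum.inl q) (x - a) < placeAbs (Sum.inl q) π →
      placeAbs (Sum.inl q) (x - algebraMap (𝓞 K) K z) < 1 ∧
      placeAbs (Sum.inl q) ((f * (X - C x)).coeff (j + 1)) = placeAbs (Sum.inl q) π := by
  set v := placeAbs (Sum.inl q) with hv
  have hna : ∀ x y, v (x + y) ≤ max (v x) (v y) := placeAbs_finite_add_le q
  have hπ1 : v π < 1 := by
    rw [placeAbs_finite_lt_one_iff, hπ]; exact exp_neg_one_lt_one
  have hgj : v (algebraMap (𝓞 K) K (g.coeff (j + 1))) = 1 := by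
    refine le_antisymm (placeAbs_algebraMap_le_one q _) (not_lt.1 fun h => ?_)
    rw [placeAbs_algebraMap_lt_one_iff, ← Ideal.Quotient.eq_zero_iff_mem, ← coeff_map] at h
    refine coeff_ne_zero_of_mul_eq (N := N) (z := Ideal.Quotient.mk q.asIdeal z) (by omega) ?_ hj h
    simpa using hg
  have hfi : ∀ i, v (f.coeff i - algebraMap (𝓞 K) K (g.coeff i)) < 1 := fun i => by
    have := hf i
    rwa [coeff_sub, coeff_map] at this
  have hfj : v (f.coeff (j + 1)) = 1 := by
    refine le_antisymm ?_ (not_lt.1 fun h => ?_)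
    · have := hna (f.coeff (j + 1) - algebraMap (𝓞 K) K (g.coeff (j + 1)))
        (algebraMap (𝓞 K) K (g.coeff (j + 1)))
      rw [sub_add_cancel] at this
      exact this.trans (max_le (hfi _).le hgj.le)
    · have := hna (f.coeff (j + 1)) (-(f.coeff (j + 1) - algebraMap (𝓞 K) K (g.coeff (j + 1))))
      rw [v.map_neg, neg_sub, add_sub_cancel, hgj] at this
      exact absurd (max_lt h (hfi _)) (not_lt.2 this)
  have hfj0 : f.coeff (j + 1) ≠ 0 := fun h => by rw [h, map_zero] at hfj; exact zero_ne_one hfj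
  have hgz : v (algebraMap (𝓞 K) K (g.coeff j - z * g.coeff (j + 1))) < 1 := by
    rw [placeAbs_algebraMap_lt_one_iff, ← Ideal.Quotient.eq_zero_iff_mem]
    have := congrArg (coeff · (j + 1)) hg
    simp [mul_sub, coeff_X_pow, hj.ne, coeff_one] at this
    simpa [mul_comm] using this
  -- The value solves `fⱼ - a fⱼ₊₁ = π`, the left side being the coefficient of `X^(j+1)` in `f(X -
  -- a)`. It lies in the class of `z` because `fⱼ₊₁` is a unit and `gⱼ ≡ z gⱼ₊₁`.
  have ha : v ((f.coeff j - π) / f.coeff (j + 1) - algebraMap (𝓞 K) K z) < 1 := by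
    have e : (f.coeff j - π) / f.coeff (j + 1) - algebraMap (𝓞 K) K z =
        (((f.coeff j - algebraMap (𝓞 K) K (g.coeff j)) + -(algebraMap (𝓞 K) K z *
          (f.coeff (j + 1) - algebraMap (𝓞 K) K (g.coeff (j + 1))))) +
          (algebraMap (𝓞 K) K (g.coeff j - z * g.coeff (j + 1)) + -π)) / f.coeff (j + 1) := by
      rw [map_sub, map_mul]
      field_simp
      ring
    rw [e, map_div₀, hfj, div_one]
    refine (hna _ _).trans_lt (max_lt ((hna _ _).trans_lt (max_lt (hfi j) ?_))
      ((hna _ _).trans_lt (max_lt hgz ?_)))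
    · rw [v.map_neg, map_mul]
      exact mul_lt_one_of_nonneg_of_lt_one_right (placeAbs_algebraMap_le_one q z) (v.nonneg _)
        (hfi _)
    · rwa [v.map_neg]
  refine ⟨(f.coeff j - π) / f.coeff (j + 1), ha, fun x hx => ⟨?_, ?_⟩⟩
  · have := hna (x - (f.coeff j - π) / f.coeff (j + 1))
      ((f.coeff j - π) / f.coeff (j + 1) - algebraMap (𝓞 K) K z)
    rw [sub_add_sub_cancel] at this
    exact this.trans_lt (max_lt (hx.trans hπ1) ha)
  · have e : (f * (X - C x)).coeff (j + 1) =
        π + -((x - (f.coeff j - π) / f.coeff (j + 1)) * f.coeff (j + 1)) := by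
      rw [mul_sub, coeff_sub, coeff_mul_X, coeff_mul_C]
      field_simp
      ring
    have hs : v (-((x - (f.coeff j - π) / f.coeff (j + 1)) * f.coeff (j + 1))) < v π := by
      rw [v.map_neg, map_mul, hfj, mul_one]; exact hx
    rw [e]
    refine le_antisymm ((hna _ _).trans (max_le le_rfl hs.le)) (not_lt.1 fun h => ?_)
    have := hna (π + -((x - (f.coeff j - π) / f.coeff (j + 1)) * f.coeff (j + 1)))
      ((x - (f.coeff j - π) / f.coeff (j + 1)) * f.coeff (j + 1))
    rw [neg_add_cancel_right] at this
    rw [v.map_neg] at hs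
    exact absurd (max_lt h hs) (not_lt.2 this)

/-- Adding a root to a polynomial and deforming, in even degree `k + 5`. -/
lemma reach_succ_of_odd {k : ℕ} (hk : Odd k) (hr : Reach K k) : Reach K (k + 1) := by
  classical
  intro S d ε M hε
  -- Mestre's construction needs odd degree, so to reach `k + 5` two roots are added to degree `k +
  -- 4` and one rational root is divided out after the deformation.
  obtain ⟨m, hm⟩ : Odd (k + 6) := by obtain ⟨j, rfl⟩ := hk; exact ⟨j + 3, by ring⟩
  have hm2 : 2 ≤ m := by omega
  obtain ⟨ℓ, hℓ, -, h⟩ := exists_rational_prime (N := k + 6) (by omega) S (max M (k + 6))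
  obtain ⟨r, hrℓ⟩ := exists_prime_above (K := K) hℓ
  obtain ⟨hrS, hrN, hrM, hrj⟩ := h r hrℓ
  obtain ⟨z, hz⟩ := exists_lift_roots_of_unity (by omega) hrN
  obtain ⟨dr, hdr⟩ := exists_target_congrAt (q := r) z k
  obtain ⟨π, hπ⟩ := r.valuation_exists_uniformizer K
  have hπ0 : π ≠ 0 := by
    intro h; rw [h, map_zero] at hπ; exact absurd hπ.symm WithZero.exp_ne_zero
  obtain ⟨δ, hδ, hδS⟩ := exists_uniform_delta S (fun v δ => ∀ f' c',
      polyNorm (placeAbs v) (f' - (d v).poly k) < δ → placeAbs v (c' - (d v).c k) < δ →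
      polyNorm (placeAbs v) (f' * (X - C c') - (d v).poly k * (X - C ((d v).c k))) < ε / 2)
    (fun v δ δ' hle h f' c' hf hc => h f' c' (hf.trans_le hle) (hc.trans_le hle))
    (fun v _ => exists_delta_mul_X_sub_C _ _ _ (half_pos hε))
  have hη : 0 < min δ 1 := lt_min hδ one_pos
  obtain ⟨f₀, hf₀, hf₀S⟩ := hr (insert (Sum.inl r) S)
    (fun v => if v = Sum.inl r then dr else d v) (min δ 1) (max M (k + 5)) hη
  obtain ⟨q₃, hq₃, hc₃⟩ := hf₀.three
  obtain ⟨q₄, hq₄, hc₄⟩ := hf₀.full hk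
  have hdeg := hf₀.squareDisc.natDegree
  have hWn : ∀ q, q = q₃ ∨ q = q₄ → IsNew (insert (Sum.inl r) S) (max M (k + 5)) q := by
    rintro q (rfl | rfl)
    · exact hq₃
    · exact hq₄
  have hWr : ∀ q, q = q₃ ∨ q = q₄ → q ≠ r := by
    rintro q hq rfl
    exact (hWn q hq).1 (Finset.mem_insert_self _ _)
  have hWS : ∀ q, q = q₃ ∨ q = q₄ → Sum.inl q ∉ S := fun q hq hqT =>
    (hWn q hq).1 (Finset.mem_insert_of_mem hqT)
  have hW : ∀ f : K[X], f.natDegree ≤ k + 5 → ∀ q : HeightOneSpectrum (𝓞 K), ∃ c : 𝓞 K,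
      q = q₃ ∨ q = q₄ → ∀ x : K, placeAbs (Sum.inl q) (x - algebraMap (𝓞 K) K c) < 1 →
      ∀ k, HasCycleAt k f q → HasCycleAt k (f * (X - C x)) q := by
    intro f hf q
    by_cases hq : q = q₃ ∨ q = q₄
    · obtain ⟨c, hc⟩ := HasCycleAt.exists_mul (f := f) (q := q)
        ((hf.trans (le_max_right _ _)).trans_lt (hWn q hq).2)
      exact ⟨c, fun _ => hc⟩
    · exact ⟨0, fun h => absurd h hq⟩
  choose c hc using hW f₀ (by omega)
  set U : Finset (Place K) := insert (Sum.inl r) (S ∪ {Sum.inl q₃, Sum.inl q₄}) with hU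
  have hrU : Sum.inl r ∈ U := Finset.mem_insert_self _ _
  have hWU : ∀ q, q = q₃ ∨ q = q₄ → (Sum.inl q : Place K) ∈ U := by
    rintro q (rfl | rfl) <;> simp [hU]
  have hSU : S ⊆ U := fun v hv => by simp [hU, hv]
  obtain ⟨x, hx⟩ := exists_approx U
    (Sum.elim (fun q => if q = r then algebraMap (𝓞 K) K (z (k + 4)) else
      if q = q₃ ∨ q = q₄ then algebraMap (𝓞 K) K (c q) else (d (Sum.inl q)).c k)
      (fun v => (d (Sum.inr v)).c k)) hη
  have hcyc : ∀ q, q = q₃ ∨ q = q₄ → ∀ k, HasCycleAt k f₀ q →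
      HasCycleAt k (f₀ * (X - C x)) q := by
    intro q hq
    refine hc q hq x ?_
    have := hx (Sum.inl q) (hWU q hq)
    rw [Sum.elim_inl, if_neg (hWr q hq), if_pos hq] at this
    exact this.trans_le (min_le_right _ _)
  set P₀ := f₀ * (X - C x) with hP₀
  have hP₀m : P₀.Monic := hf₀.squareDisc.monic.mul (monic_X_sub_C x)
  have hP₀d : P₀.natDegree = k + 5 := by
    rw [hP₀, hf₀.squareDisc.monic.natDegree_mul (monic_X_sub_C x), hdeg, natDegree_X_sub_C]
  have hP₀r : CongrAt r P₀ ((∏ i ∈ Finset.range (k + 5), (X - C (z i))).map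
      (algebraMap (𝓞 K) K)) := by
    have e1 := hf₀S _ (Finset.mem_insert_self _ _)
    rw [if_pos rfl] at e1
    have e2 := hx _ hrU
    rw [Sum.elim_inl, if_pos rfl] at e2
    have e3 := ((congrAt_of_polyNorm_lt (e1.trans_le (min_le_right _ _))).trans hdr).mul
      (congrAt_X_sub_C (e2.trans_le (min_le_right _ _)))
    rwa [← Finset.prod_range_succ (fun i => X - C (z i))] at e3
  have hP₀S : ∀ v ∈ S, polyNorm (placeAbs v) (P₀ - (d v).poly (k + 1)) < ε / 2 := by
    intro v hv
    have e1 := hf₀S v (Finset.mem_insert_of_mem hv)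
    have e2 := hx v (hSU hv)
    rw [if_neg (by rintro rfl; exact hrS hv)] at e1
    have e4 : (Sum.elim (fun q => if q = r then algebraMap (𝓞 K) K (z (k + 4)) else
        if q = q₃ ∨ q = q₄ then algebraMap (𝓞 K) K (c q) else (d (Sum.inl q)).c k)
        (fun v => (d (Sum.inr v)).c k) v : K) = (d v).c k := by
      rcases v with q | v
      · rw [Sum.elim_inl, if_neg (by rintro rfl; exact hrS hv), if_neg fun hq => hWS q hq hv]
      · rfl
    rw [e4] at e2
    rw [Target.poly_succ]
    exact hδS v hv f₀ x (e1.trans_le (min_le_left _ _)) (e2.trans_le (min_le_left _ _))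
  rw [Finset.prod_range_succ] at hz
  -- The last root is adjusted within its residue class at `r` so that the coefficient of `X^(m+1)`
  -- becomes a uniformizer, as the Newton polygon argument requires.
  obtain ⟨ar, -, har⟩ := exists_root_coeff hπ (j := m) (by omega) hP₀r hz
  choose c' hc' using hW P₀ hP₀d.le
  obtain ⟨a, ha⟩ := exists_approx U
    (Sum.elim (fun q => if q = r then ar else algebraMap (𝓞 K) K (c' q)) (fun _ => 0))
    (lt_min ((placeAbs (Sum.inl r)).pos hπ0) one_pos)
  have ha₃ : HasCycleAt 3 (P₀ * (X - C a)) q₃ := by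
    refine hc' q₃ (Or.inl rfl) a ?_ 3 (hcyc q₃ (Or.inl rfl) 3 hc₃)
    have := ha (Sum.inl q₃) (hWU _ (Or.inl rfl))
    rw [Sum.elim_inl, if_neg (hWr _ (Or.inl rfl))] at this
    exact this.trans_le (min_le_right _ _)
  obtain ⟨har1, har2⟩ := har a (by
    have := ha (Sum.inl r) hrU
    rw [Sum.elim_inl, if_pos rfl] at this
    exact this.trans_le (min_le_left _ _))
  set P := P₀ * (X - C a) with hP
  have hPm : P.Monic := hP₀m.mul (monic_X_sub_C a)
  have hPd : P.natDegree = 2 * m + 1 := by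
    rw [hP, hP₀m.natDegree_mul (monic_X_sub_C a), hP₀d, natDegree_X_sub_C]; omega
  have hPsd : SquareDisc (2 * m + 1) P := by
    have h1 := hf₀.squareDisc.mul_X_sub_C ((hcyc q₃ (Or.inl rfl) 3 hc₃).separable hP₀m)
    have h2 := h1.mul_X_sub_C (ha₃.separable hPm)
    rwa [show k + 4 + 1 + 1 = 2 * m + 1 by omega] at h2
  have hPr : CongrAt r P (X ^ (2 * m + 1) - 1) := by
    rw [← hm]
    exact (hP₀r.mul (congrAt_X_sub_C har1)).trans (congrAt_X_pow_sub_one hz)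
  have hrj' : ∀ j : ℕ, 0 < j → j ≤ 2 * m + 1 → (j : 𝓞 K) ∉ r.asIdeal :=
    fun j h0 hj => hrj j h0 (by omega)
  obtain ⟨R, Q, hR0, hRd, hQd, hR, hWr'⟩ := hPsd.exists_mestre ⟨m, rfl⟩
  have hPQ := (exists_pencil_congrAt (by omega) hrj' hPm hPr hR0 hRd hQd hR hWr').1
  have hQa : Q.eval a ≠ 0 := by
    intro h0
    obtain ⟨A, B, hAB⟩ := hPQ
    have := congrArg (eval a) hAB
    simp [hP, h0] at this
  obtain ⟨δr, hδr, hnoroot⟩ :=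
    exists_delta_eval_ne_zero hm2 hrj' hπ hPm hPr har2 hR0 hRd hQd hR hWr'
  obtain ⟨δ', hδ', hδU⟩ := exists_uniform_delta U (fun v δ => ∀ x, placeAbs v (x - a) < δ →
      Q.eval x ≠ 0 ∧ ∀ f : K[X], f.natDegree ≤ P₀.natDegree →
      (X - C x) * f = P - C (P.eval x / Q.eval x) * Q →
      polyNorm (placeAbs v) (f - P₀) < min (ε / 2) 1 ∧
        polyNorm (placeAbs v) ((X - C x) * f - P) < min (ε / 2) 1)
    (fun v δ δ' hle h x hx => h x (hx.trans_le hle))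
    (fun v _ => exists_delta_pencil (placeAbs v) P₀ Q hQa (lt_min (half_pos hε) one_pos))
  -- The rational root of the new member: near `a` away from `r`, so that the cofactor stays near
  -- `P₀`; near `0` at `r`, where the cofactor then has no root in `K`.
  obtain ⟨y, hy⟩ := exists_approx U (fun v => if v = Sum.inl r then 0 else a) (lt_min hδr hδ')
  have hyU : ∀ v ∈ U, v ≠ Sum.inl r → placeAbs v (y - a) < δ' := by
    intro v hv hvr
    have := hy v hv
    rw [if_neg hvr] at this
    exact this.trans_le (min_le_right _ _)
  have hne₃ : (Sum.inl q₃ : Place K) ≠ Sum.inl r := fun h => hWr _ (Or.inl rfl) (Sum.inl_injective h)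
  have hne₄ : (Sum.inl q₄ : Place K) ≠ Sum.inl r := fun h => hWr _ (Or.inr rfl) (Sum.inl_injective h)
  have hQy := (hδU _ (hWU q₃ (Or.inl rfl)) y (hyU _ (hWU q₃ (Or.inl rfl)) hne₃)).1
  set t := P.eval y / Q.eval y with ht
  have hroot : (P - C t * Q).IsRoot y := by
    rw [IsRoot, eval_sub, eval_mul (p := C t), eval_C, ht, div_mul_cancel₀ _ hQy, sub_self]
  obtain ⟨f, hf⟩ := dvd_iff_isRoot.2 hroot
  have hdlt : (C t * Q).degree < P.degree := by
    rw [degree_eq_natDegree hPm.ne_zero, hPd]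
    exact ((smul_eq_C_mul t).symm ▸ degree_smul_le t Q).trans_lt hQd
  have hFm : (P - C t * Q).Monic := hPm.sub_of_left hdlt
  have hfm : f.Monic := (monic_X_sub_C y).of_mul_monic_left (hf ▸ hFm)
  have hFd : (P - C t * Q).natDegree = 2 * m + 1 := by
    rw [natDegree_eq_of_degree_eq (degree_sub_eq_left_of_degree_lt hdlt), hPd]
  have hfd : f.natDegree = k + 5 := by
    rw [hf, (monic_X_sub_C y).natDegree_mul hfm, natDegree_X_sub_C] at hFd
    omega
  have hclose := fun v hv hvr => (hδU v hv y (hyU v hv hvr)).2 f (by rw [hfd, hP₀d]) hf.symm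
  have hF₃ : HasCycleAt 3 (P - C t * Q) q₃ := by
    refine ha₃.congr (congrAt_of_polyNorm_lt ?_)
    rw [hf]
    exact (hclose _ (hWU q₃ (Or.inl rfl)) hne₃).2.trans_le (min_le_right _ _)
  have hFsd : SquareDisc (2 * m + 1) (P - C t * Q) :=
    hPsd.pencil hWr' hQd hPQ t (hF₃.separable hFm)
  have hfsd : SquareDisc (k + 5) f := by
    refine SquareDisc.of_mul_X_sub_C (c := y) hfm hfd ?_
    rwa [mul_comm, ← hf, show k + 5 + 1 = 2 * m + 1 by omega]
  have hcong : ∀ q, q = q₃ ∨ q = q₄ → CongrAt q f P₀ := by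
    intro q hq
    refine congrAt_of_polyNorm_lt ?_
    exact (hclose _ (hWU q hq) fun h => hWr q hq (Sum.inl_injective h)).1.trans_le (min_le_right _ _)
  have hnew : ∀ q, q = q₃ ∨ q = q₄ → IsNew S M q := fun q hq =>
    (hWn q hq).mono (Finset.subset_insert _ _) (le_max_left _ _)
  have heven : ¬ Odd (k + 1) := by rw [Nat.odd_add_one]; exact not_not.2 hk
  -- The pattern of length `k + 4` at `q₄`, transitive for `f₀`, leaves out exactly one point in
  -- degree `k + 5`.
  refine ⟨f, ⟨hfsd, ⟨q₃, hnew _ (Or.inl rfl),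
      (hcyc q₃ (Or.inl rfl) 3 hc₃).congr (hcong _ (Or.inl rfl))⟩,
    fun _ => ⟨q₄, hnew _ (Or.inr rfl), (hcyc q₄ (Or.inr rfl) _ hc₄).congr (hcong _ (Or.inr rfl))⟩,
    fun h => absurd h heven, fun h => absurd h heven, fun _ _ w => ?_⟩, ?_⟩
  · refine hnoroot y ?_ t f hf.symm w
    have := hy _ hrU
    rw [if_pos rfl, sub_zero] at this
    exact this.trans_le (min_le_left _ _)
  · intro v hv
    refine polyNorm_sub_lt _ ((hclose v (hSU hv) ?_).1.trans_le (min_le_left _ _)) (hP₀S v hv)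
    rintro rfl
    exact hrS hv

/-- All targets are approximated by polynomials with alternating group. -/
theorem reach (k : ℕ) : Reach K k := by
  induction k with
  | zero => exact reach_zero
  | succ k ih =>
    rcases Nat.even_or_odd k with hk | hk
    · exact reach_succ_of_even hk ih
    · exact reach_succ_of_odd hk ih

end EvenStep
end AnLocal

namespace AnLocal

open Polynomial Matrix

/-! ### The Galois action on roots and its parity -/

section RootPerm

variable {K L : Type*} [Field K] [Field L] [Algebra K L] {n : ℕ} {f : K[X]} {θ : Fin n → L}

/-- The permutation of the roots of a polynomial induced by an automorphism. -/
noncomputable def rootPerm (h : f.map (algebraMap K L) = ∏ i, (X - C (θ i)))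
    (hθ : Function.Injective θ) : Gal(L/K) →* Equiv.Perm (Fin n) where
  toFun σ := (exists_perm h hθ (σ : L →ₐ[K] L)).choose
  map_one' := by
    ext i
    have := (exists_perm h hθ ((1 : Gal(L/K)) : L →ₐ[K] L)).choose_spec i
    exact congrArg Fin.val (hθ this).symm
  map_mul' σ τ := by
    ext i
    refine congrArg Fin.val (hθ ?_)
    rw [← (exists_perm h hθ ((σ * τ : Gal(L/K)) : L →ₐ[K] L)).choose_spec i, Equiv.Perm.mul_apply,
      ← (exists_perm h hθ (σ : L →ₐ[K] L)).choose_spec,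
      ← (exists_perm h hθ (τ : L →ₐ[K] L)).choose_spec]
    rfl

lemma rootPerm_spec (h : f.map (algebraMap K L) = ∏ i, (X - C (θ i)))
    (hθ : Function.Injective θ) (σ : Gal(L/K)) (i : Fin n) :
    σ (θ i) = θ (rootPerm h hθ σ i) :=
  (exists_perm h hθ (σ : L →ₐ[K] L)).choose_spec i

lemma rootPerm_eq_iff (h : f.map (algebraMap K L) = ∏ i, (X - C (θ i)))
    (hθ : Function.Injective θ) (σ : Gal(L/K)) (i j : Fin n) :
    rootPerm h hθ σ i = j ↔ σ (θ i) = θ j := by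
  rw [rootPerm_spec h hθ, hθ.eq_iff]

/-- Two enumerations of the roots differ by a permutation. -/
lemma exists_perm_of_map_eq_prod {ψ : Fin n → L}
    (h : f.map (algebraMap K L) = ∏ i, (X - C (θ i)))
    (hψ : f.map (algebraMap K L) = ∏ i, (X - C (ψ i))) (hi : Function.Injective ψ) :
    ∃ p : Equiv.Perm (Fin n), ∀ i, ψ i = θ (p i) := by
  have hroot : ∀ i, ∃ j, ψ i = θ j := fun i =>
    (aeval_eq_zero_iff h _).1 ((aeval_eq_zero_iff hψ _).2 ⟨i, rfl⟩)
  choose π hπ using hroot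
  have hπi : Function.Injective π := fun i j hij => hi (by rw [hπ, hπ, hij])
  exact ⟨Equiv.ofBijective π (Finite.injective_iff_bijective.1 hπi), hπ⟩

lemma det_vandermonde_perm {p : Equiv.Perm (Fin n)} {ψ : Fin n → L} (hp : ∀ i, ψ i = θ (p i)) :
    (vandermonde ψ).det = (Equiv.Perm.sign p : ℤ) * (vandermonde θ).det := by
  rw [← det_permute]
  congr 1
  ext i j
  simp [vandermonde_apply, hp]

/-- Embedding `L` into the algebraic closure and renumbering changes the Vandermonde determinant
only by a sign. -/
lemma SquareDisc.det_mem_range [Algebra.IsAlgebraic K L] (hf : SquareDisc n f)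
    (h : f.map (algebraMap K L) = ∏ i, (X - C (θ i))) :
    ∃ δ : K, algebraMap K L δ = (vandermonde θ).det := by
  have hsep := hf.separable
  obtain ⟨ψ, hψ, hψf, δ, hδ⟩ := hf
  let ι : L →ₐ[K] AlgebraicClosure K := IsAlgClosed.lift
  have hι : f.map (algebraMap K (AlgebraicClosure K)) = ∏ i, (X - C (ι (θ i))) := by
    have := congrArg (Polynomial.map (ι : L →+* AlgebraicClosure K)) h
    rw [Polynomial.map_map, AlgHom.comp_algebraMap] at this
    simpa [Polynomial.map_prod] using this
  obtain ⟨p, hp⟩ := exists_perm_of_map_eq_prod hψf hι (injective_of_separable hι hsep)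
  refine ⟨(Equiv.Perm.sign p : ℤ) * δ, ι.injective ?_⟩
  change ι _ = ι _
  have h1 : ι (vandermonde θ).det = (vandermonde fun i => ι (θ i)).det := by
    rw [det_vandermonde, det_vandermonde]; simp
  rw [h1, det_vandermonde_perm hp, ι.commutes, map_mul, map_intCast, hδ]

/-- An automorphism multiplies the Vandermonde determinant by the sign of its permutation but fixes
it, since it lies in `K` and is nonzero. -/
lemma rootPerm_mem_alternatingGroup [CharZero K] [Algebra.IsAlgebraic K L] (hf : SquareDisc n f)
    (h : f.map (algebraMap K L) = ∏ i, (X - C (θ i))) (hθ : Function.Injective θ) (σ : Gal(L/K)) :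
    rootPerm h hθ σ ∈ alternatingGroup (Fin n) := by
  obtain ⟨δ, hδ⟩ := hf.det_mem_range h
  have h1 := det_vandermonde_perm (θ := θ) (p := rootPerm h hθ σ) (ψ := fun i => σ (θ i))
    (rootPerm_spec h hθ σ)
  have h2 : (vandermonde fun i => σ (θ i)).det = σ (vandermonde θ).det := by
    rw [det_vandermonde, det_vandermonde]; simp
  have h3 := vandermonde_det_ne_zero hθ
  rw [h2, ← hδ, AlgEquiv.commutes, hδ] at h1
  rw [Equiv.Perm.mem_alternatingGroup]
  rcases Int.units_eq_one_or (Equiv.Perm.sign (rootPerm h hθ σ)) with h4 | h4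
  · exact h4
  · exfalso
    have : CharZero L := charZero_of_injective_algebraMap (algebraMap K L).injective
    rw [h4] at h1
    simp at h1
    exact h3 (self_eq_neg.1 h1)

lemma rootPerm_injective (h : f.map (algebraMap K L) = ∏ i, (X - C (θ i)))
    (hθ : Function.Injective θ) (htop : Algebra.adjoin K (Set.range θ) = ⊤) :
    Function.Injective (rootPerm h hθ) := by
  intro σ τ hστ
  refine AlgEquiv.coe_toAlgHom_injective (AlgHom.ext_of_adjoin_eq_top htop ?_)
  rintro _ ⟨i, rfl⟩
  change σ (θ i) = τ (θ i)
  rw [rootPerm_spec h hθ, rootPerm_spec h hθ, hστ]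

end RootPerm
end AnLocal

namespace AnLocal

open Polynomial IsDedekindDomain

/-! ### Integral models at a prime -/

section IntegralModel

variable {K : Type*} [Field K] [NumberField K]

lemma exists_denominator {q : HeightOneSpectrum (𝓞 K)} (F : Finset K)
    (hF : ∀ x ∈ F, placeAbs (Sum.inl q) x ≤ 1) :
    ∃ s : 𝓞 K, s - 1 ∈ q.asIdeal ∧
      ∀ x ∈ F, ∃ y : 𝓞 K, algebraMap (𝓞 K) K y = x * algebraMap (𝓞 K) K s := by
  classical
  induction F using Finset.induction_on with
  | empty => exact ⟨1, by simp, by simp⟩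
  | insert a F ha ih =>
    obtain ⟨s, hs, h⟩ := ih fun x hx => hF x (Finset.mem_insert_of_mem hx)
    obtain ⟨y, d, hy⟩ := q.exists_primeCompl_mul_eq_of_integer (K := K) a
      ((placeAbs_finite_le_one_iff q a).1 (hF a (Finset.mem_insert_self _ _)))
    have hd : Ideal.Quotient.mk q.asIdeal (d : 𝓞 K) ≠ 0 := by
      rw [Ne, Ideal.Quotient.eq_zero_iff_mem]; exact d.2
    obtain ⟨e, he⟩ := Ideal.Quotient.mk_surjective (I := q.asIdeal)
      (Ideal.Quotient.mk q.asIdeal (d : 𝓞 K))⁻¹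
    refine ⟨s * (d * e), ?_, fun x hx => ?_⟩
    · rw [← Ideal.Quotient.eq_zero_iff_mem] at hs ⊢
      rw [map_sub, map_one, sub_eq_zero] at hs ⊢
      rw [map_mul, map_mul, hs, he, mul_inv_cancel₀ hd, one_mul]
    · rcases Finset.mem_insert.1 hx with rfl | hx
      · exact ⟨y * (s * e), by simp only [map_mul, ← hy]; ring⟩
      · obtain ⟨z, hz⟩ := h x hx
        exact ⟨z * (d * e), by simp only [map_mul, hz]; ring⟩

/-- `f` is integral only at `q`. Scaling its roots by a common denominator `s ≡ 1` modulo `q` makes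
it integral everywhere without changing the reduction at `q` or the action on roots. -/
lemma exists_integral_model {q : HeightOneSpectrum (𝓞 K)} {f : K[X]} (hf : f.Monic)
    {f₀ : (𝓞 K)[X]} (h : CongrAt q f (f₀.map (algebraMap (𝓞 K) K))) :
    ∃ s : 𝓞 K, s ≠ 0 ∧ ∃ G : (𝓞 K)[X], G.Monic ∧
      G.map (algebraMap (𝓞 K) K) = f.scaleRoots (algebraMap (𝓞 K) K s) ∧
      G.map (Ideal.Quotient.mk q.asIdeal) = f₀.map (Ideal.Quotient.mk q.asIdeal) := by
  classical
  have hint : ∀ i, placeAbs (Sum.inl q) (f.coeff i) ≤ 1 := by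
    intro i
    have h1 := placeAbs_finite_add_le q ((f - f₀.map (algebraMap (𝓞 K) K)).coeff i)
      (algebraMap (𝓞 K) K (f₀.coeff i))
    rw [coeff_sub, coeff_map, sub_add_cancel] at h1
    refine h1.trans (max_le ?_ (placeAbs_algebraMap_le_one q _))
    have := h i
    rw [coeff_sub, coeff_map] at this
    exact this.le
  obtain ⟨s, hs, hden⟩ := exists_denominator (q := q) (f.support.image f.coeff) (by
    intro x hx
    obtain ⟨i, -, rfl⟩ := Finset.mem_image.1 hx
    exact hint i)
  have hden' : ∀ i, ∃ y : 𝓞 K, algebraMap (𝓞 K) K y = f.coeff i * algebraMap (𝓞 K) K s := by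
    intro i
    by_cases hi : i ∈ f.support
    · exact hden _ (Finset.mem_image_of_mem _ hi)
    · exact ⟨0, by rw [notMem_support_iff.1 hi]; simp⟩
  have hs0 : s ≠ 0 := by
    rintro rfl
    exact q.isPrime.ne_top ((Ideal.eq_top_iff_one _).2 (by simpa using hs))
  have hlift : f.scaleRoots (algebraMap (𝓞 K) K s) ∈ Polynomial.lifts (algebraMap (𝓞 K) K) := by
    rw [lifts_iff_coeff_lifts]
    intro i
    rw [coeff_scaleRoots]
    rcases lt_trichotomy i f.natDegree with hi | rfl | hi
    · obtain ⟨y, hy⟩ := hden' i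
      refine ⟨y * s ^ (f.natDegree - i - 1), ?_⟩
      rw [map_mul, hy, map_pow, mul_assoc, ← pow_succ', Nat.sub_add_cancel (by omega)]
    · exact ⟨1, by rw [hf.coeff_natDegree]; simp⟩
    · exact ⟨0, by rw [coeff_eq_zero_of_natDegree_lt hi]; simp⟩
  obtain ⟨G, hG⟩ := (mem_lifts _).1 hlift
  refine ⟨s, hs0, G, monic_of_injective (IsFractionRing.injective (𝓞 K) K)
    (by rw [hG, monic_scaleRoots_iff]; exact hf), hG, ?_⟩
  refine map_quotient_eq_of_congrAt (f := f) (fun i => ?_) h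
  rw [hG, coeff_sub, coeff_scaleRoots]
  have e : f.coeff i - f.coeff i * algebraMap (𝓞 K) K s ^ (f.natDegree - i) =
      f.coeff i * algebraMap (𝓞 K) K (1 - s ^ (f.natDegree - i)) := by
    rw [map_sub, map_one, map_pow]; ring
  rw [e, map_mul]
  refine mul_lt_one_of_nonneg_of_lt_one_right (hint i) (AbsoluteValue.nonneg _ _) ?_
  rw [placeAbs_algebraMap_lt_one_iff, ← Ideal.Quotient.eq_zero_iff_mem]
  rw [← Ideal.Quotient.eq_zero_iff_mem, map_sub, map_one, sub_eq_zero] at hs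
  rw [map_sub, map_pow, hs, one_pow, map_one, sub_self]

lemma scaleRoots_prod_X_sub_C {R : Type*} [CommRing R] [IsDomain R] {n : ℕ} (θ : Fin n → R) (s : R) :
    (∏ i, (X - C (θ i))).scaleRoots s = ∏ i, (X - C (s * θ i)) := by
  have key : ∀ t : Finset (Fin n), (∏ i ∈ t, (X - C (θ i))).scaleRoots s =
      ∏ i ∈ t, (X - C (s * θ i)) := by
    intro t
    induction t using Finset.induction_on with
    | empty => simp
    | insert a t ha ih =>
      rw [Finset.prod_insert ha, Finset.prod_insert ha, mul_scaleRoots_of_noZeroDivisors, ih]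
      congr 1
      rw [sub_eq_add_neg, ← C_neg, X_add_C_scaleRoots, neg_mul, C_neg, ← sub_eq_add_neg, mul_comm]
  exact key Finset.univ

end IntegralModel

/-! ### Decomposition groups and factorisation modulo a prime -/

section Cycle

variable {K L : Type*} [Field K] [Field L] [Algebra K L] {n : ℕ} {f : K[X]} {θ : Fin n → L}

/-- Roots of the integral model. -/
lemma exists_integral_roots (h : f.map (algebraMap K L) = ∏ i, (X - C (θ i))) {s : 𝓞 K}
    {G : (𝓞 K)[X]} (hG : G.Monic)
    (hGf : G.map (algebraMap (𝓞 K) K) = f.scaleRoots (algebraMap (𝓞 K) K s)) :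
    ∃ α : Fin n → 𝓞 L, (∀ i, (α i : L) = algebraMap K L (algebraMap (𝓞 K) K s) * θ i) ∧
      G.map (algebraMap (𝓞 K) (𝓞 L)) = ∏ i, (X - C (α i)) := by
  have hf := monic_of_map_eq_prod h
  have h1 : (G.map (algebraMap (𝓞 K) (𝓞 L))).map (algebraMap (𝓞 L) L) =
      ∏ i, (X - C (algebraMap K L (algebraMap (𝓞 K) K s) * θ i)) := by
    rw [Polynomial.map_map, ← IsScalarTower.algebraMap_eq, IsScalarTower.algebraMap_eq (𝓞 K) K L,
      ← Polynomial.map_map, hGf, map_scaleRoots _ _ _ (by rw [hf.leadingCoeff]; simp), h,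
      scaleRoots_prod_X_sub_C]
  have hint : ∀ i, IsIntegral ℤ (algebraMap K L (algebraMap (𝓞 K) K s) * θ i) := by
    intro i
    refine isIntegral_trans (R := ℤ) (A := 𝓞 L) _ ⟨G.map (algebraMap (𝓞 K) (𝓞 L)), hG.map _, ?_⟩
    rw [← eval_map, h1, eval_prod]
    exact Finset.prod_eq_zero (Finset.mem_univ i) (by simp)
  have hex : ∀ i, ∃ a : 𝓞 L, (a : L) = algebraMap K L (algebraMap (𝓞 K) K s) * θ i :=
    fun i => ⟨⟨_, hint i⟩, rfl⟩
  choose α hα using hex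
  refine ⟨α, hα, map_injective _ RingOfIntegers.coe_injective ?_⟩
  rw [h1, map_prod_X_sub_C]
  exact Finset.prod_congr rfl fun i _ => by rw [← hα i]

lemma exists_finset_of_factor {k κ : Type*} [Field k] [Field κ] [Algebra k κ] {F : k[X]}
    {β : Fin n → κ} (hmap : F.map (algebraMap k κ) = ∏ i, (X - C (β i)))
    (hβ : Function.Injective β) {p : k[X]} (hp : p ≠ 0) {t : Multiset k}
    (ht : F = p * (t.map fun c => X - C c).prod) :
    ∃ s : Finset (Fin n), s.card = p.natDegree ∧ (∀ i ∈ s, aeval (β i) p = 0) ∧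
      ∀ i ∉ s, ∃ c : k, β i = algebraMap k κ c := by
  classical
  have hF := monic_of_map_eq_prod hmap
  have hroots : (p.map (algebraMap k κ)).roots + t.map (algebraMap k κ) =
      Finset.univ.val.map β := by
    have h1 : (F.map (algebraMap k κ)).roots = Finset.univ.val.map β := by
      rw [hmap]
      have := roots_multiset_prod_X_sub_C (Finset.univ.val.map β)
      rwa [Multiset.map_map] at this
    have h2 : F.map (algebraMap k κ) = p.map (algebraMap k κ) *
        ((t.map (algebraMap k κ)).map fun c => X - C c).prod := by
      rw [ht, Polynomial.map_mul, Polynomial.map_multiset_prod, Multiset.map_map, Multiset.map_map]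
      simp
    rw [← h1, h2, roots_mul (h2 ▸ (hF.map _).ne_zero), roots_multiset_prod_X_sub_C]
  have hnodup : (p.map (algebraMap k κ)).roots.Nodup :=
    Multiset.nodup_of_le (Multiset.le_add_right _ _) (hroots ▸ Finset.univ.nodup.map hβ)
  have hcard : (p.map (algebraMap k κ)).roots.card = p.natDegree := by
    have h1 := congrArg Multiset.card hroots
    have h2 := natDegree_of_map_eq_prod hmap
    have htm : (t.map fun c => X - C c).prod.Monic :=
      monic_multiset_prod_of_monic _ _ fun c _ => monic_X_sub_C c
    rw [ht, natDegree_mul hp htm.ne_zero, natDegree_multiset_prod_X_sub_C_eq_card] at h2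
    simp at h1
    omega
  refine ⟨Finset.univ.filter fun i => β i ∈ (p.map (algebraMap k κ)).roots, ?_, fun i hi => ?_,
    fun i hi => ?_⟩
  · have : (Finset.univ.filter fun i => β i ∈ (p.map (algebraMap k κ)).roots).image β =
        (p.map (algebraMap k κ)).roots.toFinset := by
      ext x
      simp only [Finset.mem_image, Finset.mem_filter, Finset.mem_univ, true_and,
        Multiset.mem_toFinset]
      constructor
      · rintro ⟨i, hi, rfl⟩; exact hi
      · intro hx
        have h1 : x ∈ Finset.univ.val.map β := hroots ▸ Multiset.mem_add.2 (Or.inl hx)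
        obtain ⟨i, -, rfl⟩ := Multiset.mem_map.1 h1
        exact ⟨i, hx, rfl⟩
    rw [← Finset.card_image_of_injective _ hβ, this, Multiset.toFinset_card_of_nodup hnodup, hcard]
  · have hi := (Finset.mem_filter.1 hi).2
    rwa [mem_roots_map hp, ← aeval_def] at hi
  · have h1 : β i ∈ Finset.univ.val.map β := Multiset.mem_map_of_mem _ (Finset.mem_univ i)
    rw [← hroots, Multiset.mem_add] at h1
    obtain ⟨c, -, hc⟩ := Multiset.mem_map.1
      (h1.resolve_left fun h2 => hi (Finset.mem_filter.2 ⟨Finset.mem_univ _, h2⟩))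
    exact ⟨c, hc.symm⟩

variable [NumberField K] [NumberField L]

/-- The residue extension is normal, so two roots of an irreducible polynomial are conjugate there,
and the decomposition group surjects onto its automorphism group. -/
lemma exists_stabilizer_of_irreducible [IsGalois K L] (q : HeightOneSpectrum (𝓞 K))
    (Q : Ideal (𝓞 L)) [Q.IsMaximal] [Q.LiesOver q.asIdeal] {p : (𝓞 K ⧸ q.asIdeal)[X]}
    (hp : Irreducible p) {x y : 𝓞 L ⧸ Q} (hx : aeval x p = 0) (hy : aeval y p = 0) :
    ∃ σ : MulAction.stabilizer Gal(L/K) Q,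
      Ideal.Quotient.stabilizerHom Q q.asIdeal Gal(L/K) σ x = y := by
  let _ : Field (𝓞 L ⧸ Q) := Ideal.Quotient.field Q
  have hnorm : Normal (𝓞 K ⧸ q.asIdeal) (𝓞 L ⧸ Q) :=
    Ideal.Quotient.normal (G := Gal(L/K)) q.asIdeal Q
  have hconj : aeval x (minpoly (𝓞 K ⧸ q.asIdeal) y) = 0 := by
    rw [← minpoly.eq_of_irreducible hp hy, map_mul, hx, zero_mul]
  obtain ⟨τ, hτ⟩ := minpoly.exists_algEquiv_of_root (hnorm.isAlgebraic _) hconj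
  obtain ⟨σ, hσ⟩ := Ideal.Quotient.stabilizerHom_surjective Gal(L/K) q.asIdeal Q τ
  exact ⟨σ, by rw [hσ, hτ]⟩

/-- A decomposition group at an unramified prime permutes transitively the roots of an irreducible
factor of the reduction. -/
lemma HasCycleAt.exists_finset [IsGalois K L] (h : f.map (algebraMap K L) = ∏ i, (X - C (θ i)))
    (hθ : Function.Injective θ) {q : HeightOneSpectrum (𝓞 K)} {k : ℕ} (hc : HasCycleAt k f q)
    (Q : Ideal (𝓞 L)) [hQ : Q.IsMaximal] [Q.LiesOver q.asIdeal] :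
    ∃ s : Finset (Fin n), s.card = k ∧
      (∀ i ∈ s, ∀ j ∈ s, ∃ σ ∈ MulAction.stabilizer Gal(L/K) Q, rootPerm h hθ σ i = j) ∧
      ∀ σ ∈ MulAction.stabilizer Gal(L/K) Q, ∀ i ∉ s, rootPerm h hθ σ i = i := by
  obtain ⟨f₀, hf₀, hsep, p, hp, rfl, t, ht⟩ := hc
  obtain ⟨a, ha, G, hGm, hGf, hGq⟩ := exists_integral_model (monic_of_map_eq_prod h) hf₀
  obtain ⟨α, hα, hGα⟩ := exists_integral_roots h hGm hGf
  let _ : Field (𝓞 L ⧸ Q) := Ideal.Quotient.field Q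
  have hmap : (f₀.map (Ideal.Quotient.mk q.asIdeal)).map
      (algebraMap (𝓞 K ⧸ q.asIdeal) (𝓞 L ⧸ Q)) =
      ∏ i, (X - C (Ideal.Quotient.mk Q (α i))) := by
    have e : (algebraMap (𝓞 K ⧸ q.asIdeal) (𝓞 L ⧸ Q)).comp (Ideal.Quotient.mk q.asIdeal) =
      (Ideal.Quotient.mk Q).comp (algebraMap (𝓞 K) (𝓞 L)) := rfl
    rw [← hGq, Polynomial.map_map, e, ← Polynomial.map_map, hGα, map_prod_X_sub_C]
  have hβi := injective_of_separable hmap hsep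
  have hstab : ∀ σ : MulAction.stabilizer Gal(L/K) Q, ∀ i,
      Ideal.Quotient.stabilizerHom Q q.asIdeal Gal(L/K) σ (Ideal.Quotient.mk Q (α i)) =
        Ideal.Quotient.mk Q (α (rootPerm h hθ σ i)) := by
    intro σ i
    have hperm : (σ : Gal(L/K)) • α i = α (rootPerm h hθ σ i) := by
      refine RingOfIntegers.ext ?_
      change (σ : Gal(L/K)) (α i : L) = _
      rw [hα, hα, map_mul, AlgEquiv.commutes, rootPerm_spec h hθ]
    rw [← hperm]
    rfl
  obtain ⟨s, hs, hs1, hs2⟩ := exists_finset_of_factor hmap hβi hp.ne_zero ht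
  refine ⟨s, hs, fun i hi j hj => ?_, fun σ hσ i hi => ?_⟩
  · obtain ⟨σ, hσ⟩ := exists_stabilizer_of_irreducible q Q hp (hs1 i hi) (hs1 j hj)
    exact ⟨σ, σ.2, hβi ((hstab σ i).symm.trans hσ)⟩
  · obtain ⟨c, hc⟩ := hs2 i hi
    refine hβi ((hstab ⟨σ, hσ⟩ i).symm.trans ?_)
    rw [hc, AlgEquiv.commutes]
    exact hc.symm

end Cycle
end AnLocal

namespace AnLocal

/-! ### Recognising the alternating group -/

section Alternating

/-- Some `k` points are permuted transitively by the elements of `G` fixing the other points. -/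
def HasTransitiveSupport {α : Type*} (G : Subgroup (Equiv.Perm α)) (k : ℕ) : Prop :=
  ∃ s : Finset α, s.card = k ∧ ∀ i ∈ s, ∀ j ∈ s, ∃ σ ∈ G, σ i = j ∧ ∀ l ∉ s, σ l = l

variable {n : ℕ} {G : Subgroup (Equiv.Perm (Fin n))}

/-- An element moving one of the three points is nontrivial with support of at most three points;
being even it is not a transposition. -/
lemma HasTransitiveSupport.exists_isThreeCycle (hG : G ≤ alternatingGroup (Fin n))
    (h : HasTransitiveSupport G 3) : ∃ σ ∈ G, σ.IsThreeCycle := by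
  obtain ⟨s, hs, h⟩ := h
  obtain ⟨a, b, c, hab, -, -, rfl⟩ := Finset.card_eq_three.1 hs
  obtain ⟨σ, hσ, hσa, hσl⟩ := h a (by simp) b (by simp)
  refine ⟨σ, hσ, ?_⟩
  have hsub : σ.support ⊆ {a, b, c} := fun l hl => by
    by_contra hl'
    exact Equiv.Perm.mem_support.1 hl (hσl l hl')
  have h3 := (Finset.card_le_card hsub).trans hs.le
  have h0 : σ.support.card ≠ 0 := by
    rw [Ne, Equiv.Perm.card_support_eq_zero]
    rintro rfl
    exact hab hσa
  have h1 := Equiv.Perm.card_support_ne_one σ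
  have h2 : σ.support.card ≠ 2 := by
    rw [Ne, Equiv.Perm.card_support_eq_two]
    intro hswap
    have := hswap.sign_eq
    rw [Equiv.Perm.mem_alternatingGroup.1 (hG hσ)] at this
    exact absurd this (by decide)
  rw [← card_support_eq_three_iff]
  omega

/-- Since `u` is moved somewhere, the group is transitive. A block through `u` is preserved by every
element fixing `u`, so as soon as it contains another point it contains all. -/
lemma isPreprimitive_of_fixed_point {u : Fin n} (hu : ∃ σ ∈ G, σ u ≠ u)
    (h : ∀ i ≠ u, ∀ j ≠ u, ∃ σ ∈ G, σ i = j ∧ σ u = u) : MulAction.IsPreprimitive G (Fin n) := by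
  have htrans : MulAction.IsPretransitive G (Fin n) := by
    rw [MulAction.isPretransitive_iff_base u]
    intro y
    by_cases hy : y = u
    · exact ⟨1, by simp [hy]⟩
    · obtain ⟨σ, hσ, hσu⟩ := hu
      obtain ⟨τ, hτ, hτy, -⟩ := h _ hσu y hy
      exact ⟨⟨τ, hτ⟩ * ⟨σ, hσ⟩, hτy⟩
  refine MulAction.IsPreprimitive.of_isTrivialBlock_base u fun {B} huB hB => ?_
  by_cases hx : ∃ x ∈ B, x ≠ u
  · obtain ⟨x, hxB, hxu⟩ := hx
    refine Or.inr (Set.eq_univ_of_forall fun y => ?_)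
    by_cases hy : y = u
    · rwa [hy]
    · obtain ⟨σ, hσ, hσx, hσu⟩ := h x hxu y hy
      have hσB : (⟨σ, hσ⟩ : G) • B = B :=
        hB.smul_eq_of_mem huB (by change σ u ∈ B; rwa [hσu])
      rw [← hσB]
      exact ⟨x, hxB, hσx⟩
  · push Not at hx
    exact Or.inl fun x hx' y hy' => (hx x hx').trans (hx y hy').symm

/-- Take a block through one of the two omitted points. If it meets the other `n - 2`, it has at
least `n - 1` elements, and its size divides `n`. Otherwise it has at most two elements, and two
does not divide the odd number `n`. -/
lemma isPreprimitive_of_odd (hn : Odd n) (hn4 : 4 ≤ n) (htrans : MulAction.IsPretransitive G (Fin n))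
    (h : HasTransitiveSupport G (n - 2)) : MulAction.IsPreprimitive G (Fin n) := by
  obtain ⟨s, hs, h⟩ := h
  have hsc : sᶜ.card = 2 := by rw [Finset.card_compl, hs, Fintype.card_fin]; omega
  obtain ⟨u, hu⟩ : sᶜ.Nonempty := Finset.card_pos.1 (by omega)
  have hus : u ∉ s := by simpa using hu
  refine MulAction.IsPreprimitive.of_isTrivialBlock_base u fun {B} huB hB => ?_
  have hdvd := hB.ncard_dvd_card ⟨u, huB⟩
  rw [Nat.card_fin] at hdvd
  by_cases hx : ∃ x ∈ B, x ∈ s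
  · obtain ⟨x, hxB, hxs⟩ := hx
    right
    have hsB : ((insert u s : Finset (Fin n)) : Set (Fin n)) ⊆ B := by
      intro y hy
      rcases Finset.mem_insert.1 (Finset.mem_coe.1 hy) with rfl | hy
      · exact huB
      · obtain ⟨σ, hσ, hσx, hσl⟩ := h x hxs y hy
        have hσB : (⟨σ, hσ⟩ : G) • B = B :=
          hB.smul_eq_of_mem huB (by change σ u ∈ B; rwa [hσl u hus])
        rw [← hσB]
        exact ⟨x, hxB, hσx⟩
    have hle := Set.ncard_le_ncard hsB
    rw [Set.ncard_coe_finset, Finset.card_insert_of_notMem hus, hs] at hle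
    have hBn : B.ncard = n := by
      obtain ⟨c, hc⟩ := hdvd
      rcases c with _ | _ | c
      · omega
      · omega
      · have := Nat.mul_le_mul_left B.ncard (show 2 ≤ c + 1 + 1 by omega)
        omega
    by_contra hB'
    exact (Set.ncard_lt_card hB').ne (by rw [hBn, Nat.card_fin])
  · left
    push Not at hx
    have hsub : B ⊆ (sᶜ : Finset (Fin n)) := fun y hy => by simpa using hx y hy
    have hle := Set.ncard_le_ncard hsub
    rw [Set.ncard_coe_finset, hsc] at hle
    have h0 : B.ncard ≠ 0 := by
      rw [Ne, Set.ncard_eq_zero]; exact Set.nonempty_iff_ne_empty.1 ⟨u, huB⟩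
    have h2 : B.ncard ≠ 2 := by
      intro h2
      rw [h2] at hdvd
      exact (Nat.not_even_iff_odd.2 hn) (even_iff_two_dvd.2 hdvd)
    exact (Set.ncard_le_one_iff_subsingleton).1 (by omega)

/-- A criterion for a group of even permutations to be the alternating group. -/
lemma eq_alternatingGroup (hn4 : 4 ≤ n) (hG : G ≤ alternatingGroup (Fin n))
    (h3 : HasTransitiveSupport G 3)
    (heven : Even n → HasTransitiveSupport G (n - 1) ∧ ∀ i, ∃ σ ∈ G, σ i ≠ i)
    (hodd : Odd n → HasTransitiveSupport G n ∧ HasTransitiveSupport G (n - 2)) :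
    G = alternatingGroup (Fin n) := by
  obtain ⟨σ, hσ, hσ3⟩ := h3.exists_isThreeCycle hG
  refine le_antisymm hG
    (Equiv.Perm.alternatingGroup_le_of_isPreprimitive_of_isThreeCycle_mem ?_ hσ3 hσ)
  rcases Nat.even_or_odd n with hn | hn
  · obtain ⟨⟨s, hs, h⟩, hfix⟩ := heven hn
    have hsc : sᶜ.card = 1 := by rw [Finset.card_compl, hs, Fintype.card_fin]; omega
    obtain ⟨u, hu⟩ := Finset.card_eq_one.1 hsc
    have hmem : ∀ i, i ∈ s ↔ i ≠ u := fun i => by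
      rw [← not_iff_not, ← Finset.mem_compl, hu, Finset.mem_singleton, not_not]
    refine isPreprimitive_of_fixed_point (hfix u) fun i hi j hj => ?_
    obtain ⟨σ, hσ, hij, hl⟩ := h i ((hmem i).2 hi) j ((hmem j).2 hj)
    exact ⟨σ, hσ, hij, hl u (by simp [hmem])⟩
  · obtain ⟨⟨s, hs, h⟩, h2⟩ := hodd hn
    have hsu : s = Finset.univ := Finset.eq_univ_of_card s (by rw [hs, Fintype.card_fin])
    refine isPreprimitive_of_odd hn hn4 ⟨fun i j => ?_⟩ h2
    obtain ⟨σ, hσ, hij, -⟩ := h i (hsu ▸ Finset.mem_univ _) j (hsu ▸ Finset.mem_univ _)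
    exact ⟨⟨σ, hσ⟩, hij⟩

end Alternating
end AnLocal

namespace AnLocal

open Polynomial IsDedekindDomain Matrix

/-! ### Krasner's argument: nearby roots -/

section Near

/-- If every `c j` has a nearby `θ i`, and different `c j` have no common neighbour, then being
near is a bijection. -/
lemma exists_perm_of_near {E : Type*} [Field E] {n : ℕ} {θ c : Fin n → E} (P : E → Prop)
    (h₁ : ∀ j, ∃ i, P (θ i - c j)) (h₂ : ∀ i j l, P (θ i - c j) → P (θ i - c l) → j = l) :
    ∃ π : Equiv.Perm (Fin n), ∀ i j, P (θ i - c j) ↔ i = π j := by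
  choose π hπ using h₁
  have hinj : Function.Injective π := fun j l hjl => h₂ (π j) j l (hπ j) (hjl ▸ hπ l)
  have hbij := Finite.injective_iff_bijective.1 hinj
  refine ⟨Equiv.ofBijective π hbij, fun i j => ⟨fun h => ?_, fun h => ?_⟩⟩
  · obtain ⟨l, rfl⟩ := hbij.2 i
    rw [h₂ _ _ _ h (hπ l)]; rfl
  · rw [h]; exact hπ j

/-- An automorphism preserving nearness carries the pairing of `θ` with `c` to itself, so its two
permutations are conjugate by the pairing. -/
lemma perm_eq_of_near {E : Type*} [Field E] {n : ℕ} {θ c : Fin n → E} {P : E → Prop}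
    {π : Equiv.Perm (Fin n)} (hπ : ∀ i j, P (θ i - c j) ↔ i = π j) {σ : E →+* E}
    (hσ : ∀ x, P x → P (σ x)) {p r : Equiv.Perm (Fin n)} (hp : ∀ i, σ (θ i) = θ (p i))
    (hr : ∀ j, σ (c j) = c (r j)) : p = π * r * π⁻¹ := by
  ext i
  have h := hσ _ ((hπ (π (π⁻¹ i)) (π⁻¹ i)).2 rfl)
  rw [map_sub, hp, hr, hπ] at h
  rw [Equiv.Perm.mul_apply, Equiv.Perm.mul_apply, ← h]
  simp

end Near

/-! ### Nearby polynomials at a finite prime -/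

section FiniteNear

variable {K E : Type*} [Field K] [Field E] [NumberField E] [Algebra K E]

lemma valuation_smul_of_mem_stabilizer {σ : Gal(E/K)} {w : HeightOneSpectrum (𝓞 E)}
    (hσ : σ ∈ MulAction.stabilizer Gal(E/K) w.asIdeal) (x : E) :
    w.valuation E (σ x) = w.valuation E x := by
  have key : ∀ τ ∈ MulAction.stabilizer Gal(E/K) w.asIdeal, ∀ y : 𝓞 E,
      w.intValuation (τ • y) ≤ w.intValuation y := by
    intro τ hτ y
    by_cases hy : y = 0
    · simp [hy]
    · obtain ⟨m, hm⟩ : ∃ m : ℕ, w.intValuation y = WithZero.exp (-(m : ℤ)) :=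
        ⟨_, w.intValuation_if_neg hy⟩
      rw [hm, w.intValuation_le_pow_iff_mem]
      have h := Ideal.smul_mem_pointwise_smul τ y _
        ((w.intValuation_le_pow_iff_mem y m).1 hm.le)
      rwa [smul_pow', MulAction.mem_stabilizer_iff.1 hτ] at h
  have key' : ∀ y : 𝓞 E, w.valuation E (σ (y : E)) = w.valuation E (y : E) := by
    intro y
    have e : σ (y : E) = ((σ • y : 𝓞 E) : E) := rfl
    rw [e, w.valuation_of_algebraMap, w.valuation_of_algebraMap]
    refine le_antisymm (key σ hσ y) ?_
    have := key σ⁻¹ (inv_mem hσ) (σ • y)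
    rwa [inv_smul_smul] at this
  obtain ⟨a, b, -, rfl⟩ := IsFractionRing.div_surjective (A := 𝓞 E) x
  rw [map_div₀, map_div₀, map_div₀]
  exact congrArg₂ _ (key' a) (key' b)

variable [NumberField K]

lemma valuation_lt_of_liesOver {q : HeightOneSpectrum (𝓞 K)} {w : HeightOneSpectrum (𝓞 E)}
    [w.asIdeal.LiesOver q.asIdeal] {x y : K} (h : q.valuation K x < q.valuation K y) :
    w.valuation E (algebraMap K E x) < w.valuation E (algebraMap K E y) := by
  rw [← q.valuation_liesOver E w, ← q.valuation_liesOver E w]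
  exact pow_lt_pow_left₀ h zero_le
    (Ideal.IsDedekindDomain.ramificationIdx'_ne_zero_of_liesOver _ q.ne_bot)

omit [NumberField E] [Algebra K E] [NumberField K] in
lemma valuation_det_vandermonde_le {Γ : Type*} [LinearOrderedCommGroupWithZero Γ]
    {v : Valuation E Γ} {n : ℕ} {c : Fin n → E} (hc : ∀ i, v (c i) ≤ 1) {i j : Fin n} (hij : i < j) :
    v (vandermonde c).det ≤ v (c j - c i) := by
  classical
  have h1 : ∀ a b, v (c a - c b) ≤ 1 := fun a b => (v.map_sub _ _).trans (max_le (hc a) (hc b))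
  rw [det_vandermonde, ← Finset.mul_prod_erase _ _ (Finset.mem_univ i),
    ← Finset.mul_prod_erase _ _ (Finset.mem_Ioi.2 hij), map_mul, map_mul, mul_assoc]
  refine mul_le_of_le_one_right zero_le (mul_le_one' ?_ ?_)
  · rw [map_prod]
    exact Finset.prod_le_one' fun b _ => h1 b i
  · rw [map_prod]
    refine Finset.prod_le_one' fun a _ => ?_
    rw [map_prod]
    exact Finset.prod_le_one' fun b _ => h1 b a

/-- The integral roots `c` of `t` differ pairwise by at least `|d|`, because the remaining factors
of the Vandermonde determinant are at most `1`. As `|f(cⱼ)| < |d|ⁿ`, some root of `f` lies within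
`|d|` of `cⱼ`, and by the ultrametric inequality it is within `|d|` of no other `c`. -/
lemma exists_perm_of_near_finite {q : HeightOneSpectrum (𝓞 K)} {w : HeightOneSpectrum (𝓞 E)}
    [w.asIdeal.LiesOver q.asIdeal] {n : ℕ} {f t : K[X]} {θ c : Fin n → E}
    (hf : f.map (algebraMap K E) = ∏ i, (X - C (θ i)))
    (ht : t.map (algebraMap K E) = ∏ i, (X - C (c i)))
    (hc : ∀ i, w.valuation E (c i) ≤ 1) {d : K}
    (hdc : algebraMap K E d = (vandermonde c).det)
    (hft : ∀ i, q.valuation K ((f - t).coeff i) < q.valuation K d ^ n) :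
    ∃ π : Equiv.Perm (Fin n), ∀ i j,
      w.valuation E (θ i - c j) < w.valuation E (algebraMap K E d) ↔ i = π j := by
  refine exists_perm_of_near (fun x => w.valuation E x < w.valuation E (algebraMap K E d)) ?_ ?_
  · intro j
    by_contra! hcon
    have h1 : w.valuation E (aeval (c j) f) < w.valuation E (algebraMap K E d) ^ n := by
      have e : aeval (c j) f = aeval (c j) (f - t) := by
        rw [map_sub, (aeval_eq_zero_iff ht _).2 ⟨j, rfl⟩, sub_zero]
      rw [e, aeval_eq_sum_range]
      refine (w.valuation E).map_sum_lt' ?_ fun i _ => ?_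
      · have := valuation_lt_of_liesOver (E := E) (w := w) (q := q) (x := 0) (y := d ^ n)
          (by rw [map_zero, map_pow]; exact zero_le.trans_lt (hft 0))
        rw [← map_pow, ← map_pow]
        exact zero_le.trans_lt this
      · rw [Algebra.smul_def, map_mul, map_pow, ← map_pow, ← map_pow, ← map_pow]
        have := valuation_lt_of_liesOver (E := E) (w := w) (q := q) (x := (f - t).coeff i)
          (y := d ^ n) (by rw [map_pow]; exact hft i)
        refine lt_of_le_of_lt ?_ this
        refine mul_le_of_le_one_right zero_le ?_
        rw [map_pow]
        exact pow_le_one₀ zero_le (hc j)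
    rw [aeval_eq_prod hf, map_prod] at h1
    refine absurd h1 (not_lt.2 ?_)
    calc w.valuation E (algebraMap K E d) ^ n
        = ∏ _i : Fin n, w.valuation E (algebraMap K E d) := by simp
      _ ≤ _ := Finset.prod_le_prod (fun _ _ => zero_le) fun i _ => by
        rw [(w.valuation E).map_sub_swap]; exact hcon i
  · intro i j l hj hl
    by_contra hjl
    have h1 : w.valuation E (c j - c l) < w.valuation E (algebraMap K E d) := by
      have : c j - c l = (θ i - c l) - (θ i - c j) := by ring
      rw [this]
      exact (w.valuation E).map_sub_lt hl hj
    refine absurd h1 (not_lt.2 ?_)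
    rw [hdc]
    rcases lt_or_gt_of_ne hjl with hjl | hjl
    · rw [(w.valuation E).map_sub_swap]
      exact valuation_det_vandermonde_le hc hjl
    · exact valuation_det_vandermonde_le hc hjl

/-- Polynomials close to a split polynomial split completely, at a finite prime. -/
lemma exists_eps_rootPerm_eq_one (q : HeightOneSpectrum (𝓞 K)) {n : ℕ} {c : Fin n → ℤ}
    (hc : Function.Injective c) : ∃ ε > 0, ∀ f : K[X],
      polyNorm (placeAbs (Sum.inl q)) (f - ∏ i, (X - C (c i : K))) < ε →
      ∀ {E : Type*} [Field E] [NumberField E] [Algebra K E] (w : HeightOneSpectrum (𝓞 E))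
        [w.asIdeal.LiesOver q.asIdeal] {θ : Fin n → E}
        (h : f.map (algebraMap K E) = ∏ i, (X - C (θ i))) (hθ : Function.Injective θ),
        ∀ σ ∈ MulAction.stabilizer Gal(E/K) w.asIdeal, rootPerm h hθ σ = 1 := by
  have hd : (vandermonde fun i => (c i : K)).det ≠ 0 :=
    vandermonde_det_ne_zero (Int.cast_injective.comp hc)
  refine ⟨placeAbs (Sum.inl q) (vandermonde fun i => (c i : K)).det ^ n,
    pow_pos ((placeAbs (Sum.inl q)).pos hd) n, fun f hf E _ _ _ w _ θ h hθ σ hσ => ?_⟩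
  obtain ⟨π, hπ⟩ := exists_perm_of_near_finite (q := q) (w := w) (c := fun i => (c i : E)) h
    (t := ∏ i, (X - C (c i : K))) (by rw [map_prod_X_sub_C]; simp) (fun i => by
      have := w.valuation_le_one (K := E) (c i : 𝓞 E)
      simpa using this) (d := (vandermonde fun i => (c i : K)).det) (by
      rw [det_vandermonde, det_vandermonde]; simp) (fun i => by
      rw [← map_pow, ← not_le, ← placeAbs_finite_le_iff, not_le, map_pow]
      exact (coeff_le_polyNorm _ _ i).trans_lt hf)
  have := perm_eq_of_near (P := fun x => w.valuation E x <
      w.valuation E (algebraMap K E (vandermonde fun i => (c i : K)).det))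
    (c := fun i => (c i : E)) (θ := θ) hπ (σ := (σ : E →+* E)) (fun x hx => by
      change w.valuation E (σ x) < _
      rwa [valuation_smul_of_mem_stabilizer hσ]) (p := rootPerm h hθ σ) (r := 1)
      (rootPerm_spec h hθ σ) (fun j => by simp)
  rw [this]
  simp

end FiniteNear

/-! ### Nearby polynomials at a real place -/

section InfiniteNear

variable {K : Type*} [Field K] [NumberField K]

omit [NumberField K] in
lemma eval_le_polyNorm (v : AbsoluteValue K ℝ) (g : K[X]) {n : ℕ} (hg : g.natDegree ≤ n) {x : K}
    {B : ℝ} (hB : 1 ≤ B) (hx : v x ≤ B) : v (g.eval x) ≤ polyNorm v g * B ^ n := by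
  rw [eval_eq_sum, Polynomial.sum, polyNorm_eq, Finset.sum_mul]
  refine (v.sum_le _ _).trans (Finset.sum_le_sum fun i hi => ?_)
  rw [map_mul, map_pow]
  refine mul_le_mul_of_nonneg_left ?_ (v.nonneg _)
  exact (pow_le_pow_left₀ (v.nonneg _) hx i).trans
    (pow_le_pow_right₀ hB ((le_natDegree_of_mem_supp i hi).trans hg))

/-- Polynomials close to a split polynomial with integral roots have real roots, at a real place. -/
lemma exists_eps_conj_eq (v : InfinitePlace K) {n : ℕ} {c : Fin n → ℤ}
    (hc : Function.Injective c) : ∃ ε > 0, ∀ f : K[X], f.Monic → f.natDegree = n →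
      polyNorm (placeAbs (Sum.inr v)) (f - ∏ i, (X - C (c i : K))) < ε →
      ComplexEmbedding.IsReal v.embedding →
      ∀ x : ℂ, (f.map v.embedding).eval x = 0 → starRingEnd ℂ x = x := by
  set B : ℝ := 1 + ∑ i, |(c i : ℝ)| with hB
  have hB1 : 1 ≤ B := by
    rw [hB]; have : 0 ≤ ∑ i, |(c i : ℝ)| := Finset.sum_nonneg fun _ _ => abs_nonneg _
    linarith
  have hcB : ∀ i, |(c i : ℝ)| ≤ B := fun i => by
    have := Finset.single_le_sum (f := fun i => |(c i : ℝ)|) (fun _ _ => abs_nonneg _)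
      (Finset.mem_univ i)
    rw [hB]; linarith
  -- Distinct integers are at least `1` apart, so discs of radius `1/4` around the `cⱼ` are
  -- disjoint. They are stable under complex conjugation and each contains one root, which is
  -- therefore real. `B` bounds the `cⱼ` when the perturbation is evaluated.
  refine ⟨(1 / 4) ^ n / B ^ n, by positivity, fun f hfm hfn hf hreal x hx => ?_⟩
  have hv : ∀ y : K, placeAbs (Sum.inr v) y = ‖v.embedding y‖ := fun y =>
    (InfinitePlace.norm_embedding_eq v y).symm
  obtain ⟨z, hz⟩ := exists_roots (K := ℂ) (L := ℂ) (hfm.map v.embedding)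
    ((hfm.natDegree_map v.embedding).trans hfn)
  rw [Algebra.algebraMap_self, Polynomial.map_id] at hz
  have hroot : ∀ y : ℂ, (f.map v.embedding).eval y = 0 ↔ ∃ i, y = z i := by
    intro y
    rw [hz, eval_prod, Finset.prod_eq_zero_iff]
    simp [sub_eq_zero]
  obtain ⟨π, hπ⟩ := exists_perm_of_near (θ := z) (c := fun i => (c i : ℂ)) (fun x => ‖x‖ < 1 / 4)
    (by
      intro j
      by_contra! hcon
      have h1 : ‖(f.map v.embedding).eval (c j : ℂ)‖ < (1 / 4) ^ n := by
        have e : (f.map v.embedding).eval (c j : ℂ) =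
            v.embedding ((f - ∏ i, (X - C (c i : K))).eval (c j : K)) := by
          rw [eval_sub, eval_prod, Finset.prod_eq_zero (Finset.mem_univ j) (by simp), sub_zero,
            ← eval₂_at_apply, eval_map, map_intCast]
        rw [e, ← hv]
        have hdeg : (f - ∏ i, (X - C (c i : K))).natDegree ≤ n := by
          refine (natDegree_sub_le _ _).trans (max_le hfn.le ?_)
          rw [natDegree_prod_of_monic _ _ fun i _ => monic_X_sub_C _]
          simp only [natDegree_X_sub_C]
          simp
        refine (eval_le_polyNorm _ _ hdeg hB1 ?_).trans_lt ((lt_div_iff₀ (by positivity)).1 hf)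
        rw [hv, map_intCast, Complex.norm_intCast]
        exact_mod_cast hcB j
      rw [hz, eval_prod, norm_prod] at h1
      refine absurd h1 (not_lt.2 ?_)
      calc (1 / 4 : ℝ) ^ n = ∏ _i : Fin n, (1 / 4 : ℝ) := by simp
        _ ≤ _ := Finset.prod_le_prod (fun _ _ => by norm_num) fun i _ => by
          rw [eval_sub, eval_X, eval_C, norm_sub_rev]; exact hcon i)
    (by
      intro i j l hj hl
      by_contra hjl
      have h1 : (1 : ℝ) ≤ ‖((c j - c l : ℤ) : ℂ)‖ := by
        rw [Complex.norm_intCast]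
        exact_mod_cast Int.one_le_abs (sub_ne_zero.2 fun h => hjl (hc h))
      have h2 := norm_sub_le (z i - c l) (z i - c j)
      have e : (z i - c l) - (z i - c j) = ((c j - c l : ℤ) : ℂ) := by push_cast; ring
      rw [e] at h2
      linarith)
  obtain ⟨i, rfl⟩ := (hroot x).1 hx
  have hconj : (f.map v.embedding).eval (starRingEnd ℂ (z i)) = 0 := by
    have e : (starRingEnd ℂ).comp v.embedding = v.embedding := hreal
    have h := congrArg (starRingEnd ℂ) hx
    rw [map_zero, ← eval₂_at_apply, ← eval_map, Polynomial.map_map, e] at h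
    exact h
  obtain ⟨l, hl⟩ := (hroot _).1 hconj
  have h1 := (hπ i (π⁻¹ i)).2 (by simp)
  have h2 : ‖z l - (c (π⁻¹ i) : ℂ)‖ < 1 / 4 := by
    have e : z l - (c (π⁻¹ i) : ℂ) = starRingEnd ℂ (z i - c (π⁻¹ i)) := by
      rw [map_sub, hl, map_intCast]
    rw [e, Complex.norm_conj]
    exact h1
  rw [hl, (hπ l _).1 h2]
  simp

end InfiniteNear
end AnLocal

namespace AnLocal
open Polynomial IsDedekindDomain

/-! ### Complete splitting from trivial decomposition groups and real roots -/

section Splitting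

/-- The order of the decomposition group upstairs is `ef`, and `e` and `f` are multiplicative in
towers, so every prime of `F` above `q` has `ef = 1`. The sum of the `ef` is the degree. -/
lemma ncard_primesOver_of_stabilizer_eq_bot {K F L : Type*} [Field K] [NumberField K] [Field F]
    [NumberField F] [Field L] [NumberField L] [Algebra K F] [Algebra F L] [Algebra K L]
    [IsScalarTower K F L] [IsGalois K L] (q : HeightOneSpectrum (𝓞 K))
    (h : ∀ Q : Ideal (𝓞 L), Q.IsPrime → Q.LiesOver q.asIdeal →
      MulAction.stabilizer Gal(L/K) Q = ⊥) :
    (q.asIdeal.primesOver (𝓞 F)).ncard = finrank K F := by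
  have hfin : Finite (𝓞 K ⧸ q.asIdeal) := Ring.HasFiniteQuotients.finiteQuotient q.ne_bot
  have := (Algebra.QuasiFinite.finite_primesOver (S := 𝓞 F) q.asIdeal).fintype
  have hmax : q.asIdeal.IsMaximal := q.isMaximal
  have key := Ideal.sum_ramification_inertia_eq_finrank (R := 𝓞 K) q.asIdeal (𝓞 F)
  have hr : finrank K F = finrank (𝓞 K) (𝓞 F) :=
    IsFractionRing.finrank_eq (𝓞 K) K (𝓞 F) F
  rw [hr, ← key, Finset.sum_congr rfl (g := fun _ => 1), ← Set.fintypeCard_eq_ncard]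
  · simp
  · rintro ⟨P, hP, hPq⟩ -
    have hPm : P.IsMaximal := Ideal.IsMaximal.of_liesOver_isMaximal P q.asIdeal
    obtain ⟨Q, hQm, hQP⟩ := Ideal.exists_maximal_ideal_liesOver_of_isIntegral (S := 𝓞 L) P
    have hQq : Q.LiesOver q.asIdeal := Ideal.LiesOver.trans Q P q.asIdeal
    have h1 := Ideal.card_stabilizer_eq (G := Gal(L/K)) q.asIdeal Q
    rw [h Q hQm.isPrime hQq, Ideal.ramificationIdxIn_eq_ramificationIdx q.asIdeal Q Gal(L/K),
      Ideal.inertiaDegIn_eq_inertiaDeg q.asIdeal Q Gal(L/K),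
      Ideal.ramificationIdx_tower P Q, Ideal.inertiaDeg_tower P Q] at h1
    simp only [Nat.card_eq_fintype_card, Fintype.card_unique] at h1
    have h2 := (mul_eq_one.1 h1.symm)
    change P.ramificationIdx (𝓞 K) * P.inertiaDeg (𝓞 K) = 1
    rw [(mul_eq_one.1 h2.1).1, (mul_eq_one.1 h2.2).1, mul_one]

/-- Embeddings of `F` extending that of `v` map onto the places above `v`. Two with the same place
are equal or conjugate; the conjugate case forces `v` real, where the hypothesis makes the
embeddings real too. -/
lemma ncard_comap_eq {K F : Type*} [Field K] [NumberField K] [Field F]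
    [NumberField F] [Algebra K F] (v : InfinitePlace K)
    (h : ComplexEmbedding.IsReal v.embedding → ∀ φ : F →+* ℂ,
      φ.comp (algebraMap K F) = v.embedding → ComplexEmbedding.IsReal φ) :
    {w : InfinitePlace F | w.comap (algebraMap K F) = v}.ncard = finrank K F := by
  let _ : Algebra K ℂ := v.embedding.toAlgebra
  have hcomp : ∀ φ : F →ₐ[K] ℂ, (φ : F →+* ℂ).comp (algebraMap K F) = v.embedding :=
    fun φ => φ.comp_algebraMap
  rw [← AlgHom.card K F ℂ, ← Nat.card_coe_set_eq, ← Nat.card_eq_fintype_card]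
  refine (Nat.card_eq_of_bijective (fun φ : F →ₐ[K] ℂ =>
    (⟨InfinitePlace.mk (φ : F →+* ℂ), ?_⟩ :
      {w : InfinitePlace F | w.comap (algebraMap K F) = v})) ⟨?_, ?_⟩).symm
  · change (InfinitePlace.mk (φ : F →+* ℂ)).comap (algebraMap K F) = v
    rw [InfinitePlace.comap_mk, hcomp, InfinitePlace.mk_embedding]
  · intro φ ψ hφψ
    have h1 : InfinitePlace.mk (φ : F →+* ℂ) = InfinitePlace.mk (ψ : F →+* ℂ) :=
      congrArg Subtype.val hφψ
    rcases InfinitePlace.mk_eq_iff.1 h1 with h2 | h2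
    · exact AlgHom.coe_ringHom_injective h2
    · have hre : ComplexEmbedding.IsReal v.embedding := by
        rw [ComplexEmbedding.isReal_iff]
        have h3 := hcomp ψ
        rw [← h2] at h3
        rw [← h3]
        conv_rhs => rw [h3, ← hcomp φ]
        ext x
        simp
      have := ComplexEmbedding.isReal_iff.1 (h hre φ (hcomp φ))
      exact AlgHom.coe_ringHom_injective (this.symm.trans h2)
  · rintro ⟨w, hw⟩
    have hw' : InfinitePlace.mk (w.embedding.comp (algebraMap K F)) =
        InfinitePlace.mk v.embedding := by
      rw [← InfinitePlace.comap_mk, InfinitePlace.mk_embedding, InfinitePlace.mk_embedding]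
      exact hw
    rcases InfinitePlace.mk_eq_iff.1 hw' with h1 | h1
    · refine ⟨{ w.embedding with commutes' := fun x => RingHom.congr_fun h1 x }, Subtype.ext ?_⟩
      exact w.mk_embedding
    · refine ⟨{ ComplexEmbedding.conjugate w.embedding with
        commutes' := fun x => RingHom.congr_fun h1 x }, Subtype.ext ?_⟩
      exact (InfinitePlace.mk_conjugate_eq _).trans w.mk_embedding

/-- If the roots of `f` generate `L`, triviality on the roots is triviality. -/
lemma stabilizer_eq_bot {K L : Type*} [Field K] [NumberField K] [Field L] [NumberField L]
    [Algebra K L] {n : ℕ} {f : K[X]} {θ : Fin n → L}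
    (h : f.map (algebraMap K L) = ∏ i, (X - C (θ i)))
    (hθ : Function.Injective θ) (htop : Algebra.adjoin K (Set.range θ) = ⊤)
    {q : HeightOneSpectrum (𝓞 K)}
    (h1 : ∀ w : HeightOneSpectrum (𝓞 L), w.asIdeal.LiesOver q.asIdeal →
      ∀ σ ∈ MulAction.stabilizer Gal(L/K) w.asIdeal, rootPerm h hθ σ = 1)
    (Q : Ideal (𝓞 L)) (hQ : Q.IsPrime) (hQq : Q.LiesOver q.asIdeal) :
    MulAction.stabilizer Gal(L/K) Q = ⊥ := by
  have hne : Q ≠ ⊥ := Ideal.ne_bot_of_liesOver_of_ne_bot q.ne_bot Q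
  rw [eq_bot_iff]
  intro σ hσ
  exact rootPerm_injective h hθ htop ((h1 ⟨Q, hQ, hne⟩ hQq σ hσ).trans (map_one _).symm)

lemma isReal_of_root {K F : Type*} [Field K] [NumberField K] [Field F] [NumberField F]
    [Algebra K F] {v : InfinitePlace K} {f : K[X]} {x : F} (hx : aeval x f = 0)
    (htop : Algebra.adjoin K {x} = ⊤)
    (h : ∀ z : ℂ, (f.map v.embedding).eval z = 0 → starRingEnd ℂ z = z)
    (hv : ComplexEmbedding.IsReal v.embedding) (φ : F →+* ℂ)
    (hφ : φ.comp (algebraMap K F) = v.embedding) : ComplexEmbedding.IsReal φ := by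
  let _ : Algebra K ℂ := v.embedding.toAlgebra
  let φ₁ : F →ₐ[K] ℂ := { φ with commutes' := fun y => RingHom.congr_fun hφ y }
  let φ₂ : F →ₐ[K] ℂ := { ComplexEmbedding.conjugate φ with
    commutes' := fun y => by
      have h1 : φ (algebraMap K F y) = v.embedding y := RingHom.congr_fun hφ y
      have h2 : starRingEnd ℂ (v.embedding y) = v.embedding y := RingHom.congr_fun hv y
      change starRingEnd ℂ (φ (algebraMap K F y)) = v.embedding y
      rw [h1, h2] }
  have hx' : φ₂ x = φ₁ x := by
    refine h (φ x) ?_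
    rw [eval_map, ← hφ, ← hom_eval₂]
    have : eval₂ (algebraMap K F) x f = 0 := hx
    rw [this, map_zero]
  have : φ₂ = φ₁ := AlgHom.ext_of_adjoin_eq_top htop (by rintro y rfl; exact hx')
  rw [ComplexEmbedding.isReal_iff]
  ext y
  exact DFunLike.congr_fun this y

end Splitting
end AnLocal

namespace AnLocal
open Polynomial IsDedekindDomain

/-! ### Lifting decomposition and inertia groups to a larger Galois extension -/

section Restriction

lemma mem_stabilizer_iff_forall {G R : Type*} [Group G] [CommRing R] [MulSemiringAction G R]
    {I : Ideal R} {σ : G} : σ ∈ MulAction.stabilizer G I ↔ ∀ x, σ • x ∈ I ↔ x ∈ I := by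
  rw [MulAction.mem_stabilizer_iff]
  constructor
  · intro h x
    conv_lhs => rw [← h]
    exact Ideal.smul_mem_pointwise_smul_iff
  · intro h
    ext x
    rw [Ideal.mem_pointwise_smul_iff_inv_smul_mem, ← h, smul_inv_smul]

variable {K L E : Type*} [Field K] [NumberField K] [Field L] [NumberField L] [Field E]
  [NumberField E] [Algebra K L] [Algebra L E] [Algebra K E] [IsScalarTower K L E]
  {P : Ideal (𝓞 L)} {w : Ideal (𝓞 E)} [w.LiesOver P]

omit [NumberField K] [NumberField L] [NumberField E] [w.LiesOver P] [IsScalarTower K L E] in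
lemma algebraMap_smul_of_lift {σ : Gal(L/K)} {τ : Gal(E/K)}
    (h : ∀ x, τ (algebraMap L E x) = algebraMap L E (σ x)) (y : 𝓞 L) :
    algebraMap (𝓞 L) (𝓞 E) (σ • y) = τ • algebraMap (𝓞 L) (𝓞 E) y :=
  RingOfIntegers.ext (h y).symm

omit [NumberField K] [NumberField L] [NumberField E] [IsScalarTower K L E] in
lemma mem_stabilizer_of_lift {σ : Gal(L/K)} {τ : Gal(E/K)}
    (h : ∀ x, τ (algebraMap L E x) = algebraMap L E (σ x))
    (hτ : τ ∈ MulAction.stabilizer Gal(E/K) w) : σ ∈ MulAction.stabilizer Gal(L/K) P := by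
  rw [mem_stabilizer_iff_forall] at hτ ⊢
  intro y
  rw [Ideal.mem_of_liesOver w P, Ideal.mem_of_liesOver w P, algebraMap_smul_of_lift h, hτ]

omit [NumberField K] [NumberField L] [NumberField E] [IsScalarTower K L E] in
lemma mem_inertia_of_lift {σ : Gal(L/K)} {τ : Gal(E/K)}
    (h : ∀ x, τ (algebraMap L E x) = algebraMap L E (σ x))
    (hτ : τ ∈ w.inertia Gal(E/K)) : σ ∈ P.inertia Gal(L/K) := by
  intro y
  have h1 : τ • algebraMap (𝓞 L) (𝓞 E) y - algebraMap (𝓞 L) (𝓞 E) y ∈ w := hτ _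
  rw [← algebraMap_smul_of_lift h, ← map_sub, ← Ideal.mem_of_liesOver w P] at h1
  exact h1

variable [IsGalois K L] [IsGalois K E] [hP : P.IsMaximal] [hw : w.IsMaximal]

omit [NumberField K] hP in
-- Any extension of `σ` moves `w` to another prime above `P`; an element of `Gal(E/L)` moves it back
-- without changing the restriction to `L`.
lemma exists_stabilizer_lift {σ : Gal(L/K)} (hσ : σ ∈ MulAction.stabilizer Gal(L/K) P) :
    ∃ τ ∈ MulAction.stabilizer Gal(E/K) w, ∀ x, τ (algebraMap L E x) = algebraMap L E (σ x) := by
  have : IsGalois L E := IsGalois.tower_top_of_isGalois K L E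
  obtain ⟨τ, rfl⟩ := AlgEquiv.restrictNormalHom_surjective (K₁ := L) E σ
  set σ := AlgEquiv.restrictNormalHom L τ
  have hτ : ∀ x, τ (algebraMap L E x) = algebraMap L E (σ x) := fun x =>
    (AlgEquiv.restrictNormal_commutes τ L x).symm
  have hover : (τ • w).LiesOver P := by
    constructor
    ext y
    have h1 := mem_stabilizer_iff_forall.1 hσ (σ⁻¹ • y)
    rw [smul_inv_smul] at h1
    rw [h1, Ideal.mem_comap, Ideal.mem_pointwise_smul_iff_inv_smul_mem, Ideal.mem_of_liesOver w P]
    have h2 := algebraMap_smul_of_lift hτ (σ⁻¹ • y)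
    rw [smul_inv_smul] at h2
    rw [h2, inv_smul_smul]
  have hprime : P.IsPrime := Ideal.isPrime_of_liesOver w P
  obtain ⟨η, hη⟩ := Ideal.exists_smul_eq_of_isGaloisGroup P (τ • w) w Gal(E/L)
  refine ⟨η.restrictScalars K * τ, ?_, fun x => ?_⟩
  · rw [MulAction.mem_stabilizer_iff, mul_smul]
    exact hη
  · change η (τ _) = _
    rw [hτ, η.commutes]

omit [NumberField K] hP in
-- A lift in the decomposition group acts on the residue field of `w` trivially over that of `P`.
-- The decomposition group of `E/L` realises the same residue automorphism, and dividing by such an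
-- element gives an inertia lift.
lemma exists_inertia_lift {σ : Gal(L/K)} (hσ : σ ∈ P.inertia Gal(L/K)) :
    ∃ τ ∈ w.inertia Gal(E/K), ∀ x, τ (algebraMap L E x) = algebraMap L E (σ x) := by
  have : IsGalois L E := IsGalois.tower_top_of_isGalois K L E
  obtain ⟨τ, hτw, hτ⟩ := exists_stabilizer_lift (w := w) (Ideal.inertia_le_stabilizer P hσ)
  let g : (𝓞 E ⧸ w) ≃ₐ[𝓞 L ⧸ P] (𝓞 E ⧸ w) := AlgEquiv.ofRingEquiv
    (f := (Ideal.Quotient.stabilizerHom w (w.under ℤ) Gal(E/K) ⟨τ, hτw⟩ : _ ≃+* _)) (by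
      intro x
      obtain ⟨y, rfl⟩ := Ideal.Quotient.mk_surjective x
      change Ideal.Quotient.mk w (τ • algebraMap (𝓞 L) (𝓞 E) y) =
        Ideal.Quotient.mk w (algebraMap (𝓞 L) (𝓞 E) y)
      rw [Ideal.Quotient.eq, ← algebraMap_smul_of_lift hτ, ← map_sub, ← Ideal.mem_of_liesOver w P]
      exact hσ y)
  obtain ⟨η, hη⟩ := Ideal.Quotient.stabilizerHom_surjective Gal(E/L) P w g
  refine ⟨(η⁻¹ : Gal(E/L)).restrictScalars K * τ, fun x => ?_, fun x => ?_⟩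
  · have h1 := DFunLike.congr_fun hη (Ideal.Quotient.mk w x)
    have h2 : Ideal.Quotient.mk w ((η : Gal(E/L)) • x) = Ideal.Quotient.mk w (τ • x) := h1
    rw [Ideal.Quotient.eq] at h2
    have h3 := (mem_stabilizer_iff_forall.1 (inv_mem η.2) _).2 h2
    rw [smul_sub, inv_smul_smul] at h3
    have h4 := neg_mem h3
    rw [neg_sub] at h4
    exact h4
  · change (η⁻¹ : Gal(E/L)) (τ _) = _
    rw [hτ, AlgEquiv.commutes]

end Restriction

/-! ### A ramified square root -/

section Ramification

variable {K E : Type*} [Field K] [NumberField K] [Field E] [NumberField E] [Algebra K E]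
  [IsGalois K E]

/-- The inertia group moves the square root of a uniformizer. -/
lemma exists_mem_inertia_apply_ne {p : HeightOneSpectrum (𝓞 K)} {w : HeightOneSpectrum (𝓞 E)}
    [w.asIdeal.LiesOver p.asIdeal] {b : K} (hb : p.valuation K b = WithZero.exp (-1 : ℤ)) {β : E}
    (hβ : β ^ 2 = algebraMap K E b) : ∃ σ ∈ w.asIdeal.inertia Gal(E/K), σ β ≠ β := by
  by_contra! hcon
  let M : IntermediateField K E := IntermediateField.fixedField (w.asIdeal.inertia Gal(E/K))
  have hβM : β ∈ M := by
    rw [IntermediateField.mem_fixedField_iff]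
    exact hcon
  let u : Ideal (𝓞 M) := w.asIdeal.under (𝓞 M)
  have hwmax := w.isMaximal
  have humax : u.IsMaximal := Ideal.IsMaximal.under (𝓞 M) w.asIdeal
  have hup : u.LiesOver p.asIdeal := by
    have : w.asIdeal.LiesOver u := ⟨rfl⟩
    exact Ideal.LiesOver.tower_bot w.asIdeal u p.asIdeal
  have hwu : w.asIdeal.LiesOver u := ⟨rfl⟩
  have hune : u ≠ ⊥ := Ideal.ne_bot_of_liesOver_of_ne_bot p.ne_bot u
  have hpmax := p.isMaximal
  have hfinK : Finite (𝓞 K ⧸ p.asIdeal) := Ring.HasFiniteQuotients.finiteQuotient p.ne_bot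
  have hfinM : Finite (𝓞 M ⧸ u) := Ring.HasFiniteQuotients.finiteQuotient hune
  have h1 := Ideal.card_inertia_eq_ramificationIdxIn (G := Gal(E/K)) p.asIdeal w.asIdeal
  have h2 := Ideal.card_inertia_eq_ramificationIdxIn (G := Gal(E/M)) u w.asIdeal
  rw [Ideal.ramificationIdxIn_eq_ramificationIdx _ w.asIdeal Gal(E/K)] at h1
  rw [Ideal.ramificationIdxIn_eq_ramificationIdx _ w.asIdeal Gal(E/M)] at h2
  have htop : w.asIdeal.inertia Gal(E/M) = ⊤ := by
    rw [eq_top_iff]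
    intro σ _
    have h3 : σ.restrictScalars K ∈ IntermediateField.fixingSubgroup M := by
      rw [IntermediateField.mem_fixingSubgroup_iff]
      intro x hx
      exact σ.commutes ⟨x, hx⟩
    rw [IntermediateField.fixingSubgroup_fixedField] at h3
    exact h3
  have h4 : Nat.card (w.asIdeal.inertia Gal(E/M)) = Nat.card (w.asIdeal.inertia Gal(E/K)) := by
    rw [htop, Subgroup.card_top, IsGalois.card_aut_eq_finrank,
      IntermediateField.finrank_fixedField_eq_card]
  rw [h1, h2, Ideal.ramificationIdx_tower (R := 𝓞 K) u w.asIdeal] at h4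
  -- The inertia group is unchanged when `K` is replaced by its fixed field `M`, and its order is
  -- the ramification index, so `M` is unramified at `u`. If `β` were in `M`, the valuation of `b =
  -- β²` there would be both `1` and even.
  have h5 : u.ramificationIdx (𝓞 K) = 1 := by
    have := w.asIdeal.ramificationIdx_pos (𝓞 M)
    exact Nat.eq_of_mul_eq_mul_right this (by rw [one_mul]; exact h4.symm)
  let wu : HeightOneSpectrum (𝓞 M) := ⟨u, humax.isPrime, hune⟩
  have : wu.asIdeal.LiesOver p.asIdeal := hup
  have h6 := p.valuation_liesOver M wu b
  rw [Ideal.ramificationIdx'_eq_ramificationIdx _ _ p.ne_bot] at h6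
  change _ ^ u.ramificationIdx (𝓞 K) = _ at h6
  rw [h5, pow_one, hb] at h6
  have h7 : algebraMap K M b = (⟨β, hβM⟩ : M) ^ 2 := Subtype.ext hβ.symm
  rw [h7, map_pow] at h6
  have h8 : wu.valuation M ⟨β, hβM⟩ ≠ 0 := by
    intro h
    rw [h, zero_pow two_ne_zero] at h6
    exact WithZero.exp_ne_zero h6
  obtain ⟨m, hm⟩ : ∃ m : ℤ, wu.valuation M ⟨β, hβM⟩ = WithZero.exp m :=
    ⟨WithZero.log _, (WithZero.exp_log h8).symm⟩
  rw [hm, ← WithZero.exp_nsmul, WithZero.exp_inj] at h6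
  simp at h6
  omega

end Ramification
end AnLocal

namespace AnLocal
open Polynomial IsDedekindDomain Matrix

/-! ### The Klein group in the alternating group -/

section KleinPerm

lemma pt_zero {k : ℕ} (hn : 4 ≤ k + 4) : pt hn 0 = ⟨0, by omega⟩ := rfl
lemma pt_one {k : ℕ} (hn : 4 ≤ k + 4) : pt hn 1 = ⟨1, by omega⟩ := rfl
lemma pt_two {k : ℕ} (hn : 4 ≤ k + 4) : pt hn 2 = ⟨2, by omega⟩ := rfl
lemma pt_three {k : ℕ} (hn : 4 ≤ k + 4) : pt hn 3 = ⟨3, by omega⟩ := rfl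

lemma swap_mul_dblTransp₁ {k : ℕ} (hn : 4 ≤ k + 4) :
    Equiv.swap (pt hn 0) (pt hn 1) * dblTransp₁ hn * (Equiv.swap (pt hn 0) (pt hn 1))⁻¹ =
      dblTransp₁ hn := by
  ext ⟨i, hi⟩
  rcases i with _ | _ | _ | _ | i <;>
    simp [dblTransp₁, Equiv.swap_apply_def, pt_one, pt_two, pt_three, Fin.ext_iff]

lemma swap_mul_dblTransp₂ {k : ℕ} (hn : 4 ≤ k + 4) :
    Equiv.swap (pt hn 0) (pt hn 1) * dblTransp₂ hn * (Equiv.swap (pt hn 0) (pt hn 1))⁻¹ =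
      dblTransp₁ hn * dblTransp₂ hn := by
  ext ⟨i, hi⟩
  rcases i with _ | _ | _ | _ | i <;>
    simp [dblTransp₁, dblTransp₂, Equiv.swap_apply_def, pt_one, pt_two, pt_three, Fin.ext_iff]

lemma dblTransp₁_mem_klein {n : ℕ} (hn : 4 ≤ n) : dblTransp₁ hn ∈ klein hn :=
  Subgroup.subset_closure (by simp)

lemma dblTransp₂_mem_klein {n : ℕ} (hn : 4 ≤ n) : dblTransp₂ hn ∈ klein hn :=
  Subgroup.subset_closure (by simp)

lemma klein_map_swap {k : ℕ} (hn : 4 ≤ k + 4) :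
    (klein hn).map (MulAut.conj (Equiv.swap (pt hn 0) (pt hn 1))).toMonoidHom = klein hn := by
  rw [klein, MonoidHom.map_closure, Set.image_pair]
  simp only [MulEquiv.toMonoidHom_eq_coe, MonoidHom.coe_coe, MulAut.conj_apply]
  rw [swap_mul_dblTransp₁, swap_mul_dblTransp₂]
  refine le_antisymm ((Subgroup.closure_le _).2 ?_) ((Subgroup.closure_le _).2 ?_)
  · rintro x (rfl | rfl)
    · exact dblTransp₁_mem_klein hn
    · exact mul_mem (dblTransp₁_mem_klein hn) (dblTransp₂_mem_klein hn)
  · have h1 : dblTransp₁ hn ∈ Subgroup.closure {dblTransp₁ hn, dblTransp₁ hn * dblTransp₂ hn} :=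
      Subgroup.subset_closure (by simp)
    rintro x (rfl | rfl)
    · exact h1
    · have h2 := mul_mem (inv_mem h1) (Subgroup.subset_closure
        (show dblTransp₁ hn * dblTransp₂ hn ∈ ({dblTransp₁ hn, dblTransp₁ hn * dblTransp₂ hn} :
          Set (Equiv.Perm (Fin (k + 4)))) by simp))
      rwa [inv_mul_cancel_left] at h2

lemma kleinInertia_map_swap {k : ℕ} (hn : 4 ≤ k + 4) :
    (kleinInertia hn).map (MulAut.conj (Equiv.swap (pt hn 0) (pt hn 1))).toMonoidHom =
      kleinInertia hn := by
  rw [kleinInertia, MonoidHom.map_zpowers]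
  simp only [MulEquiv.toMonoidHom_eq_coe, MonoidHom.coe_coe, MulAut.conj_apply]
  rw [swap_mul_dblTransp₁]

/-- The Krasner pairing gives a conjugating permutation of unknown parity. The transposition of the
first two points normalises both groups, so the parity can be corrected. -/
lemma exists_even_conj {k : ℕ} (hn : 4 ≤ k + 4) (π : Equiv.Perm (Fin (k + 4))) :
    ∃ τ ∈ alternatingGroup (Fin (k + 4)),
      (klein hn).map (MulAut.conj π).toMonoidHom = (klein hn).map (MulAut.conj τ).toMonoidHom ∧
      (kleinInertia hn).map (MulAut.conj π).toMonoidHom =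
        (kleinInertia hn).map (MulAut.conj τ).toMonoidHom := by
  rcases Int.units_eq_one_or (Equiv.Perm.sign π) with h | h
  · exact ⟨π, h, rfl, rfl⟩
  · refine ⟨π * Equiv.swap (pt hn 0) (pt hn 1), ?_, ?_, ?_⟩
    · rw [Equiv.Perm.mem_alternatingGroup, Equiv.Perm.sign_mul, h, Equiv.Perm.sign_swap]
      · rfl
      · rw [pt_zero, pt_one]; simp
    · have : (MulAut.conj (π * Equiv.swap (pt hn 0) (pt hn 1))).toMonoidHom =
          (MulAut.conj π).toMonoidHom.comp
            (MulAut.conj (Equiv.swap (pt hn 0) (pt hn 1))).toMonoidHom := by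
        rw [map_mul]; rfl
      rw [this, ← Subgroup.map_map, klein_map_swap]
    · have : (MulAut.conj (π * Equiv.swap (pt hn 0) (pt hn 1))).toMonoidHom =
          (MulAut.conj π).toMonoidHom.comp
            (MulAut.conj (Equiv.swap (pt hn 0) (pt hn 1))).toMonoidHom := by
        rw [map_mul]; rfl
      rw [this, ← Subgroup.map_map, kleinInertia_map_swap]

/-- In degree four the Klein group acts without fixed points. -/
lemma exists_klein_apply_ne (hn : 4 ≤ 4) (i : Fin 4) : ∃ σ ∈ klein hn, σ i ≠ i := by
  refine ⟨dblTransp₁ hn, dblTransp₁_mem_klein hn, ?_⟩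
  change dblTransp₁ (le_refl 4) i ≠ i
  revert i
  decide

end KleinPerm

/-! ### Roots of the Klein target and the four sign changes -/

section KleinRoots

/-- The roots of the quartic with cubic resolvent `(X - β²)(X - α²)(X - 1)`, followed by `c`. -/
def kleinRoot {R : Type*} [CommRing R] (α β : R) (c : ℕ → R) (i : ℕ) : R :=
  if h : i < 4 then quarticRoot 0 ![α, β, α * β] ⟨i, h⟩ else c (i - 4)

lemma kleinRoot_add_four {R : Type*} [CommRing R] (α β : R) (c : ℕ → R) (i : ℕ) :
    kleinRoot α β c (i + 1 + 1 + 1 + 1) = c i := by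
  rw [kleinRoot, dif_neg (by omega)]
  rfl

variable {K E : Type*} [Field K] [Field E] [Algebra K E]

lemma map_poly_eq_prod_kleinRoot {a b : K} {α β : E} (hα : α ^ 2 = algebraMap K E a)
    (hβ : β ^ 2 = algebraMap K E b) (c : ℕ → K) (k : ℕ) :
    ((⟨![b, a, 1], 0, c⟩ : Target K).poly k).map (algebraMap K E) =
      ∏ i : Fin (k + 4), (X - C (kleinRoot α β (fun j => algebraMap K E (c j)) i)) := by
  rw [Target.poly, Polynomial.map_mul, quarticOf_map, map_prod_X_sub_C, map_prod_X_sub_C, map_zero,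
    quarticOf_eq_prod (fun i => algebraMap K E (![b, a, 1] i)) ![α, β, α * β] 0]
  · rw [Fin.prod_univ_eq_prod_range
      (fun i => X - C (kleinRoot α β (fun j => algebraMap K E (c j)) i)) (k + 4), add_comm k 4,
      Finset.prod_range_add, ← Fin.prod_univ_eq_prod_range _ 4]
    congr 1
    · exact Finset.prod_congr rfl fun i _ => by simp [kleinRoot]
  · simp [hα]
  · simp [hβ]
  · simp [mul_pow, hα, hβ, mul_comm]
  · simp only [cons_val, map_one, mul_one]
    rw [← hα, ← hβ]; ring

variable {α β : E} {c : ℕ → K} {k : ℕ} (hn : 4 ≤ k + 4) (τ : E →ₐ[K] E)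

lemma apply_kleinRoot_of_pos_pos (hα : τ α = α) (hβ : τ β = β) (i : Fin (k + 4)) :
    τ (kleinRoot α β (fun j => algebraMap K E (c j)) i) =
      kleinRoot α β (fun j => algebraMap K E (c j)) ((1 : Equiv.Perm (Fin (k + 4))) i) := by
  obtain ⟨i, hi⟩ := i
  rcases i with _ | _ | _ | _ | i
  on_goal 5 => simp [kleinRoot_add_four]
  all_goals simp [kleinRoot, quarticRoot, hα, hβ]

lemma apply_kleinRoot_of_pos_neg (hα : τ α = α) (hβ : τ β = -β) (i : Fin (k + 4)) :
    τ (kleinRoot α β (fun j => algebraMap K E (c j)) i) =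
      kleinRoot α β (fun j => algebraMap K E (c j)) (dblTransp₁ hn i) := by
  obtain ⟨i, hi⟩ := i
  rcases i with _ | _ | _ | _ | i
  on_goal 5 => simp [kleinRoot_add_four, dblTransp₁, Equiv.swap_apply_def, pt_one, pt_two, pt_three, Fin.ext_iff]
  all_goals
    simp [kleinRoot, quarticRoot, hα, hβ, dblTransp₁, Equiv.swap_apply_def, pt_one, pt_two, pt_three, Fin.ext_iff]
    try ring

lemma apply_kleinRoot_of_neg_pos (hα : τ α = -α) (hβ : τ β = β) (i : Fin (k + 4)) :
    τ (kleinRoot α β (fun j => algebraMap K E (c j)) i) =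
      kleinRoot α β (fun j => algebraMap K E (c j)) (dblTransp₂ hn i) := by
  obtain ⟨i, hi⟩ := i
  rcases i with _ | _ | _ | _ | i
  on_goal 5 => simp [kleinRoot_add_four, dblTransp₂, Equiv.swap_apply_def, pt_one, pt_two, pt_three, Fin.ext_iff]
  all_goals
    simp [kleinRoot, quarticRoot, hα, hβ, dblTransp₂, Equiv.swap_apply_def, pt_one, pt_two, pt_three, Fin.ext_iff]
    try ring

lemma apply_kleinRoot_of_neg_neg (hα : τ α = -α) (hβ : τ β = -β) (i : Fin (k + 4)) :
    τ (kleinRoot α β (fun j => algebraMap K E (c j)) i) =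
      kleinRoot α β (fun j => algebraMap K E (c j)) ((dblTransp₁ hn * dblTransp₂ hn) i) := by
  obtain ⟨i, hi⟩ := i
  rcases i with _ | _ | _ | _ | i
  on_goal 5 => simp [kleinRoot_add_four, dblTransp₁, dblTransp₂, Equiv.swap_apply_def, pt_one, pt_two, pt_three, Fin.ext_iff]
  all_goals
    simp [kleinRoot, quarticRoot, hα, hβ, dblTransp₁, dblTransp₂, Equiv.swap_apply_def, pt_one, pt_two, pt_three, Fin.ext_iff]
    try ring

end KleinRoots

/-! ### Separability of targets and an irreducible quadratic -/

section KleinTarget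

variable {K : Type*} [Field K] [NumberField K]

lemma squareDisc_poly {d : Target K} (hγ : Function.Injective d.γ) (h0 : ∀ i, d.γ i ≠ 0)
    (hc : Function.Injective d.c) (hc0 : ∀ j, (quarticOf (∏ i, (X - C (d.γ i))) d.s).eval (d.c j) ≠ 0)
    (k : ℕ) : SquareDisc (k + 4) (d.poly k) := by
  induction k with
  | zero =>
    have h := (squareDisc_prod hγ).quarticOf (s := d.s) (by
      rw [(prod_three_coeff d.γ).1]
      exact neg_ne_zero.2 (mul_ne_zero (mul_ne_zero (h0 0) (h0 1)) (h0 2)))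
    simpa [Target.poly] using h
  | succ k ih =>
    rw [Target.poly_succ, add_right_comm]
    refine ih.mul_X_sub_C (ih.separable.mul separable_X_sub_C ?_)
    refine IsCoprime.symm ((irreducible_X_sub_C _).coprime_iff_not_dvd.2 fun hd => ?_)
    rw [dvd_iff_isRoot, IsRoot.def, Target.poly, eval_mul, eval_prod] at hd
    refine mul_ne_zero (hc0 k) (Finset.prod_ne_zero_iff.2 fun j hj => ?_) hd
    rw [eval_sub, eval_X, eval_C, sub_ne_zero]
    exact fun h => (Finset.mem_range.1 hj).ne' (hc h)

lemma exists_natCast_eval_ne_zero {f : K[X]} (hf : f ≠ 0) :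
    ∃ N : ℕ, ∀ j : ℕ, f.eval ((N + j : ℕ) : K) ≠ 0 := by
  classical
  have hfin : Set.Finite {j : ℕ | f.eval (j : K) = 0} := by
    refine Set.Finite.of_finite_image (f := fun j : ℕ => (j : K)) ?_ Nat.cast_injective.injOn
    refine (f.roots.toFinset.finite_toSet).subset ?_
    rintro _ ⟨j, hj, rfl⟩
    simpa [hf] using hj
  obtain ⟨N, hN⟩ := hfin.bddAbove
  exact ⟨N + 1, fun j hj => by have := hN hj; omega⟩

/-- The map `x ↦ x - x²` takes the same value at `0` and `1`, so on a finite field it is not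
surjective. Using `X² - X + c` instead of `X² - c` covers characteristic two as well. -/
lemma exists_irreducible_X_sq_sub {k : Type*} [Field k] [Finite k] :
    ∃ c : k, Irreducible (X ^ 2 - X + C c) := by
  have hns : ¬ Function.Surjective fun x : k => x - x ^ 2 := by
    rw [← Finite.injective_iff_surjective]
    intro h
    exact zero_ne_one (h (a₁ := (0 : k)) (a₂ := 1) (by simp))
  simp only [Function.Surjective, not_forall, not_exists] at hns
  obtain ⟨c, hc⟩ := hns
  have hdeg : (X ^ 2 - X + C c : k[X]).natDegree = 2 := by compute_degree!
  refine ⟨c, irreducible_of_degree_le_three_of_not_isRoot (by rw [hdeg]; simp) fun x hx => hc x ?_⟩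
  rw [IsRoot.def] at hx
  simp only [eval_add, eval_sub, eval_pow, eval_X, eval_C] at hx
  linear_combination -hx

end KleinTarget
end AnLocal

namespace AnLocal
open Polynomial IsDedekindDomain Matrix

/-! ### Adjoining two square roots -/

section Sqrt

universe u v

lemma exists_galois_extension_with_sqrt {K : Type v} {L : Type u} [Field K] [NumberField K] [Field L]
    [NumberField L] [Algebra K L] [IsGalois K L] (a b : K) :
    ∃ (E : Type u) (_ : Field E) (_ : NumberField E) (_ : Algebra K E) (_ : Algebra L E)
      (_ : IsScalarTower K L E) (_ : IsGalois K E) (α β : E),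
      α ^ 2 = algebraMap K E a ∧ β ^ 2 = algebraMap K E b := by
  obtain ⟨p₀, hp₀, hsplit⟩ := IsGalois.is_separable_splitting_field K L
  set g : K[X] := (X ^ 2 - C a) * (X ^ 2 - C b) with hg
  have hg0 : g ≠ 0 := mul_ne_zero (X_pow_sub_C_ne_zero two_pos a) (X_pow_sub_C_ne_zero two_pos b)
  let E := SplittingField (g.map (algebraMap K L))
  have h1 : IsSplittingField K E (p₀ * g) :=
    IsSplittingField.mul (K := L) E p₀ g hp₀.ne_zero hg0
  have hn : Normal K E := Normal.of_isSplittingField (p₀ * g)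
  have hfin : FiniteDimensional K E := IsSplittingField.finiteDimensional E (p₀ * g)
  have hchar : CharZero E := charZero_of_injective_algebraMap (algebraMap K E).injective
  have hfinQ : FiniteDimensional ℚ E := FiniteDimensional.trans ℚ K E
  have hnf : NumberField E := ⟨⟩
  have hE : (g.map (algebraMap K E)).Splits := by
    have := SplittingField.splits (g.map (algebraMap K L))
    rwa [Polynomial.map_map, ← IsScalarTower.algebraMap_eq] at this
  have hsq : ∀ c : K, X ^ 2 - C c ∣ g → ∃ x : E, x ^ 2 = algebraMap K E c := by
    intro c hc
    have h2 : ((X ^ 2 - C c : K[X]).map (algebraMap K E)).Splits :=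
      hE.of_dvd (map_ne_zero hg0) (Polynomial.map_dvd _ hc)
    obtain ⟨x, hx⟩ := h2.exists_eval_eq_zero (by
      rw [degree_map, degree_X_pow_sub_C two_pos]; norm_num)
    refine ⟨x, ?_⟩
    simpa [sub_eq_zero] using hx
  obtain ⟨α, hα⟩ := hsq a (dvd_mul_right _ _)
  obtain ⟨β, hβ⟩ := hsq b (dvd_mul_left _ _)
  exact ⟨E, inferInstance, hnf, inferInstance, inferInstance, inferInstance, ⟨⟩, α, β, hα, hβ⟩

end Sqrt

/-! ### The square root of `1 - 4c`, unramified at `p` -/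

section SignAction

variable {K E : Type*} [Field K] [NumberField K] [Field E] [NumberField E] [Algebra K E]
  {p : HeightOneSpectrum (𝓞 K)} {w : HeightOneSpectrum (𝓞 E)} [w.asIdeal.LiesOver p.asIdeal]
  {a : 𝓞 K} {α : E}

omit [NumberField K] [NumberField E] in
lemma apply_sqrt {x : K} (hα : α ^ 2 = algebraMap K E x) (τ : Gal(E/K)) : τ α = α ∨ τ α = -α := by
  rw [← sq_eq_sq_iff_eq_or_eq_neg, ← map_pow, hα, AlgEquiv.commutes]

omit [NumberField K] in
/-- The integer `(1 + √(1 - 4c)) / 2`. -/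
lemma exists_half_integer {c : 𝓞 K} (hα : α ^ 2 = algebraMap K E (1 - 4 * c : 𝓞 K)) :
    ∃ ω : 𝓞 E, (2 * ω - 1 : E) = α ∧ ω ^ 2 - ω + algebraMap (𝓞 K) (𝓞 E) c = 0 := by
  have hroot : ((1 + α) / 2) ^ 2 - (1 + α) / 2 + algebraMap K E (c : K) = 0 := by
    push_cast at hα
    simp only [map_ofNat] at hα
    linear_combination hα / 4
  have hint : IsIntegral (𝓞 K) ((1 + α) / 2) := by
    refine ⟨X ^ 2 - X + C c, by monicity!, ?_⟩
    simp only [eval₂_add, eval₂_sub, eval₂_pow, eval₂_X, eval₂_C]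
    exact hroot
  have hint' : IsIntegral ℤ ((1 + α) / 2) := isIntegral_trans _ hint
  refine ⟨⟨(1 + α) / 2, hint'⟩, ?_, RingOfIntegers.ext ?_⟩
  · change 2 * ((1 + α) / 2) - 1 = α
    ring
  · exact hroot

variable {c : 𝓞 K} (hirr : Irreducible (X ^ 2 - X + C (Ideal.Quotient.mk p.asIdeal c)))
  (hα : α ^ 2 = algebraMap K E (1 - 4 * c : 𝓞 K))

include hirr

/-- If `4c = 1` in the residue field, then `2c` is a root of `X² - X + c`. -/
lemma one_sub_four_mul_notMem : 1 - 4 * c ∉ p.asIdeal := by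
  intro h
  rw [← Ideal.Quotient.eq_zero_iff_mem] at h
  simp only [map_sub, map_one, map_mul, map_ofNat] at h
  have h1 := degree_eq_one_of_irreducible_of_root hirr
    (x := 2 * Ideal.Quotient.mk p.asIdeal c) (by
      simp only [IsRoot.def, eval_add, eval_sub, eval_pow, eval_X, eval_C]
      linear_combination -(Ideal.Quotient.mk p.asIdeal c) * h)
  have h2 : (X ^ 2 - X + C (Ideal.Quotient.mk p.asIdeal c)).degree = 2 := by compute_degree!
  rw [h2] at h1
  norm_num at h1

omit [NumberField E] in
lemma two_mul_sub_one_notMem {ω : 𝓞 E} (hω : ω ^ 2 - ω + algebraMap (𝓞 K) (𝓞 E) c = 0) 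
    (w : HeightOneSpectrum (𝓞 E)) [w.asIdeal.LiesOver p.asIdeal] : 2 * ω - 1 ∉ w.asIdeal := by
  intro h
  refine one_sub_four_mul_notMem hirr ?_
  rw [Ideal.mem_of_liesOver w.asIdeal p.asIdeal]
  have h1 : algebraMap (𝓞 K) (𝓞 E) (1 - 4 * c) = (2 * ω - 1) * (2 * ω - 1) := by
    rw [map_sub, map_mul, map_one, map_ofNat]
    linear_combination -4 * hω
  rw [h1]
  exact Ideal.mul_mem_left _ _ h

include hα

/-- Changing the sign of `α = 2ω - 1` replaces `ω` by `1 - ω`, a difference of `±(2ω - 1)`, whose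
square `1 - 4c` is a unit at `p`. Working with `ω` keeps this valid above `2`. -/
lemma apply_sqrt_of_mem_inertia {σ : Gal(E/K)} (hσ : σ ∈ w.asIdeal.inertia Gal(E/K)) : σ α = α := by
  obtain ⟨ω, hω, hω2⟩ := exists_half_integer hα
  refine (apply_sqrt hα σ).resolve_right fun h => two_mul_sub_one_notMem hirr hω2 w ?_
  have h1 : σ • ω - ω ∈ w.asIdeal := hσ ω
  have h2 : σ • ω = 1 - ω := by
    refine RingOfIntegers.ext ?_
    change σ (ω : E) = 1 - (ω : E)
    have h3 : (2 : E) * σ (ω : E) = 2 * (1 - ω) := by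
      have := congrArg σ hω
      rw [map_sub, map_mul, map_one, map_ofNat, h, ← hω] at this
      linear_combination this
    exact mul_left_cancel₀ two_ne_zero h3
  rw [h2] at h1
  have h4 := neg_mem h1
  convert h4 using 1
  ring

/-- `ω` and `1 - ω` reduce to roots of the same irreducible polynomial, hence are exchanged by the
decomposition group; they differ modulo `w`, so `α` must change sign. -/
lemma exists_mem_stabilizer_apply_sqrt_eq_neg [IsGalois K E] (w : HeightOneSpectrum (𝓞 E))
    [w.asIdeal.LiesOver p.asIdeal] :
    ∃ σ ∈ MulAction.stabilizer Gal(E/K) w.asIdeal, σ α = -α := by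
  obtain ⟨ω, hω, hω2⟩ := exists_half_integer hα
  have hmax := w.isMaximal
  have hroot : ∀ x : 𝓞 E, x ^ 2 - x + algebraMap (𝓞 K) (𝓞 E) c = 0 →
      aeval (Ideal.Quotient.mk w.asIdeal x)
        (X ^ 2 - X + C (Ideal.Quotient.mk p.asIdeal c)) = 0 := by
    intro x hx
    have := congrArg (Ideal.Quotient.mk w.asIdeal) hx
    simp only [map_add, map_sub, map_pow, map_zero] at this
    simp only [map_add, map_sub, map_pow, aeval_X, aeval_C]
    exact this
  obtain ⟨σ, hσ⟩ := exists_stabilizer_of_irreducible p w.asIdeal hirr (hroot ω hω2)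
    (hroot (1 - ω) (by linear_combination hω2))
  refine ⟨σ, σ.2, (apply_sqrt hα (σ : Gal(E/K))).resolve_left fun h => 
    two_mul_sub_one_notMem hirr hω2 w ?_⟩
  have h1 : Ideal.Quotient.mk w.asIdeal ((σ : Gal(E/K)) • ω) =
    Ideal.Quotient.mk w.asIdeal (1 - ω) := hσ
  have h2 : (σ : Gal(E/K)) • ω = ω := by
    refine RingOfIntegers.ext ?_
    change (σ : Gal(E/K)) (ω : E) = (ω : E)
    have h3 : (2 : E) * (σ : Gal(E/K)) (ω : E) = 2 * ω := by
      have := congrArg (σ : Gal(E/K)) hω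
      rw [map_sub, map_mul, map_one, map_ofNat, h, ← hω] at this
      linear_combination this
    exact mul_left_cancel₀ two_ne_zero h3
  rw [h2, Ideal.Quotient.eq] at h1
  convert h1 using 1
  ring

end SignAction

/-! ### Decomposition and inertia groups of the Klein target -/

section LocalGroups

variable {K L E : Type*} [Field K] [NumberField K] [Field L] [NumberField L] [Field E]
  [NumberField E] [Algebra K L] [Algebra L E] [Algebra K E] [IsScalarTower K L E]
  [IsGalois K L] [IsGalois K E]

/-- Passing to `E`, an element of the decomposition group acts on the target's roots through its
signs on `α` and `β`, which give the four elements of the Klein group. Inertia fixes `α` and changes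
the sign of `β`, giving the first double transposition; lifting from `L` to `E` makes these groups
the ones at `P`. -/
lemma map_rootPerm_eq {p : HeightOneSpectrum (𝓞 K)} {P : Ideal (𝓞 L)} [P.IsMaximal]
    {w : HeightOneSpectrum (𝓞 E)} [w.asIdeal.LiesOver P] [w.asIdeal.LiesOver p.asIdeal]
    {b c : 𝓞 K} (hirr : Irreducible (X ^ 2 - X + C (Ideal.Quotient.mk p.asIdeal c)))
    (hb : p.valuation K (b : K) = WithZero.exp (-1 : ℤ)) {α β : E}
    (hα : α ^ 2 = algebraMap K E (1 - 4 * c : 𝓞 K)) (hβ : β ^ 2 = algebraMap K E b)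
    {k : ℕ} (hn : 4 ≤ k + 4) {f : K[X]} {θ : Fin (k + 4) → L}
    (h : f.map (algebraMap K L) = ∏ i, (X - C (θ i))) (hθ : Function.Injective θ)
    {π : Equiv.Perm (Fin (k + 4))} {e : ℕ → K}
    (hπ : ∀ τ ∈ MulAction.stabilizer Gal(E/K) w.asIdeal, ∀ σ : Gal(L/K),
      (∀ x, τ (algebraMap L E x) = algebraMap L E (σ x)) → ∀ ρ : Equiv.Perm (Fin (k + 4)),
      (∀ i : Fin (k + 4), τ (kleinRoot α β (fun j => algebraMap K E (e j)) i) =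
        kleinRoot α β (fun j => algebraMap K E (e j)) (ρ i)) → rootPerm h hθ σ = π * ρ * π⁻¹) :
    (MulAction.stabilizer Gal(L/K) P).map (rootPerm h hθ) =
        (klein hn).map (MulAut.conj π).toMonoidHom ∧
      (P.inertia Gal(L/K)).map (rootPerm h hθ) =
        (kleinInertia hn).map (MulAut.conj π).toMonoidHom := by
  have hmax := w.isMaximal
  have hrest : ∀ (τ : Gal(E/K)) (x : L),
      τ (algebraMap L E x) = algebraMap L E (AlgEquiv.restrictNormalHom L τ x) := fun τ x =>
    (AlgEquiv.restrictNormal_commutes τ L x).symm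
  have hI1 : ∃ τ ∈ w.asIdeal.inertia Gal(E/K), 
      rootPerm h hθ (AlgEquiv.restrictNormalHom L τ) = π * dblTransp₁ hn * π⁻¹ := by
    obtain ⟨τ, hτ, hτβ⟩ := exists_mem_inertia_apply_ne (w := w) hb hβ
    exact ⟨τ, hτ, hπ τ (Ideal.inertia_le_stabilizer _ hτ) _ (hrest τ) _
      (apply_kleinRoot_of_pos_neg hn (τ : E →ₐ[K] E) (apply_sqrt_of_mem_inertia hirr hα hτ)
        ((apply_sqrt hβ τ).resolve_left hτβ))⟩
  constructor
  · refine le_antisymm ?_ ?_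
    · rintro _ ⟨σ, hσ, rfl⟩
      obtain ⟨τ, hτ, hτσ⟩ := exists_stabilizer_lift (w := w.asIdeal) hσ
      have key : ∀ ρ ∈ klein hn, (∀ i : Fin (k + 4), τ (kleinRoot α β (fun j => algebraMap K E (e j)) i) =
          kleinRoot α β (fun j => algebraMap K E (e j)) (ρ i)) →
          rootPerm h hθ σ ∈ (klein hn).map (MulAut.conj π).toMonoidHom := fun ρ hρ hi =>
        ⟨ρ, hρ, (hπ τ hτ σ hτσ ρ hi).symm⟩
      have h1 := dblTransp₁_mem_klein hn
      have h2 := dblTransp₂_mem_klein hn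
      rcases apply_sqrt hα τ with hA | hA <;> rcases apply_sqrt hβ τ with hB | hB
      · exact key _ (one_mem _) (apply_kleinRoot_of_pos_pos (τ : E →ₐ[K] E) hA hB)
      · exact key _ h1 (apply_kleinRoot_of_pos_neg hn (τ : E →ₐ[K] E) hA hB)
      · exact key _ h2 (apply_kleinRoot_of_neg_pos hn (τ : E →ₐ[K] E) hA hB)
      · exact key _ (mul_mem h1 h2) (apply_kleinRoot_of_neg_neg hn (τ : E →ₐ[K] E) hA hB)
    · have hD : ∀ τ ∈ MulAction.stabilizer Gal(E/K) w.asIdeal,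
          AlgEquiv.restrictNormalHom L τ ∈ MulAction.stabilizer Gal(L/K) P := fun τ hτ =>
        mem_stabilizer_of_lift (hrest τ) hτ
      have h1 : π * dblTransp₁ hn * π⁻¹ ∈
          (MulAction.stabilizer Gal(L/K) P).map (rootPerm h hθ) := by
        obtain ⟨τ, hτ, hτ'⟩ := hI1
        exact ⟨_, hD τ (Ideal.inertia_le_stabilizer _ hτ), hτ'⟩
      have h2 : π * dblTransp₂ hn * π⁻¹ ∈
          (MulAction.stabilizer Gal(L/K) P).map (rootPerm h hθ) := by
        obtain ⟨τ, hτ, hA⟩ := exists_mem_stabilizer_apply_sqrt_eq_neg hirr hα w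
        -- The element moving `α` may also move `β`; in that case it is multiplied by the inertia
        -- element already found.
        rcases apply_sqrt hβ τ with hB | hB
        · exact ⟨_, hD τ hτ, hπ τ hτ _ (hrest τ) _
            (apply_kleinRoot_of_neg_pos hn (τ : E →ₐ[K] E) hA hB)⟩
        · have h3 : π * (dblTransp₁ hn * dblTransp₂ hn) * π⁻¹ ∈
              (MulAction.stabilizer Gal(L/K) P).map (rootPerm h hθ) :=
            ⟨_, hD τ hτ, hπ τ hτ _ (hrest τ) _
              (apply_kleinRoot_of_neg_neg hn (τ : E →ₐ[K] E) hA hB)⟩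
          have h4 := mul_mem (inv_mem h1) h3
          convert h4 using 1
          group
      rw [Subgroup.map_le_iff_le_comap, klein, Subgroup.closure_le]
      rintro x (rfl | rfl)
      · exact h1
      · exact h2
  · refine le_antisymm ?_ ?_
    · rintro _ ⟨σ, hσ, rfl⟩
      obtain ⟨τ, hτ, hτσ⟩ := exists_inertia_lift (w := w.asIdeal) hσ
      have hA := apply_sqrt_of_mem_inertia hirr hα hτ
      have hτD := Ideal.inertia_le_stabilizer _ hτ
      rcases apply_sqrt hβ τ with hB | hB
      · exact ⟨1, one_mem _, (hπ τ hτD σ hτσ 1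
          (apply_kleinRoot_of_pos_pos (τ : E →ₐ[K] E) hA hB)).symm⟩
      · exact ⟨dblTransp₁ hn, Subgroup.mem_zpowers _, (hπ τ hτD σ hτσ _
          (apply_kleinRoot_of_pos_neg hn (τ : E →ₐ[K] E) hA hB)).symm⟩
    · obtain ⟨τ, hτ, hτ'⟩ := hI1
      rw [Subgroup.map_le_iff_le_comap, kleinInertia, Subgroup.zpowers_le]
      exact ⟨_, mem_inertia_of_lift (hrest τ) hτ, hτ'⟩

end LocalGroups
end AnLocal

namespace AnLocal
open Polynomial IsDedekindDomain Matrix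

/-! ### The Klein target -/

section KleinTarget

universe u v

variable {K : Type v} [Field K] [NumberField K]

omit [NumberField K] in
-- Both squares are the discriminant of `f`. This allows the radius in the Klein target to be fixed
-- before the extension `L` is known.
lemma SquareDisc.det_sq_eq {n : ℕ} {f : K[X]} {θ₀ : Fin n → AlgebraicClosure K}
    (h₀ : f.map (algebraMap K (AlgebraicClosure K)) = ∏ i, (X - C (θ₀ i))) {δ₀ : K}
    (hδ₀ : algebraMap K (AlgebraicClosure K) δ₀ = (vandermonde θ₀).det)
    {L : Type*} [Field L] [Algebra K L] [Algebra.IsAlgebraic K L] {θ : Fin n → L}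
    (h : f.map (algebraMap K L) = ∏ i, (X - C (θ i))) (hθ : Function.Injective θ) {δ : K}
    (hδ : algebraMap K L δ = (vandermonde θ).det) : δ ^ 2 = δ₀ ^ 2 := by
  let ι : L →ₐ[K] AlgebraicClosure K := IsAlgClosed.lift
  have hι : f.map (algebraMap K (AlgebraicClosure K)) = ∏ i, (X - C (ι (θ i))) := by
    have := congrArg (Polynomial.map (ι : L →+* AlgebraicClosure K)) h
    rw [Polynomial.map_map, AlgHom.comp_algebraMap] at this
    rw [this, map_prod_X_sub_C]
    rfl
  obtain ⟨q, hq⟩ := exists_perm_of_map_eq_prod h₀ hι (ι.injective.comp hθ)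
  have h1 := det_vandermonde_perm hq
  have h2 : (vandermonde fun i => ι (θ i)).det = ι (vandermonde θ).det := by
    rw [det_vandermonde, det_vandermonde]; simp
  rw [h2, ← hδ, ι.commutes, ← hδ₀] at h1
  apply (algebraMap K (AlgebraicClosure K)).injective
  rw [map_pow, map_pow, h1, mul_pow, ← Int.cast_pow]
  rcases Int.units_eq_one_or (Equiv.Perm.sign q) with h3 | h3 <;> rw [h3] <;> simp

/-- The local target with decomposition group `V₄` and inertia group of order two. -/
lemma exists_klein_target (p : HeightOneSpectrum (𝓞 K)) {k : ℕ} (hn : 4 ≤ k + 4) :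
    ∃ (d : Target K) (ε : ℝ), 0 < ε ∧ ∀ f : K[X],
      polyNorm (placeAbs (Sum.inl p)) (f - d.poly k) < ε →
      ∀ {L : Type u} [Field L] [NumberField L] [Algebra K L] [IsGalois K L] {θ : Fin (k + 4) → L}
        (h : f.map (algebraMap K L) = ∏ i, (X - C (θ i))) (hθ : Function.Injective θ)
        (P : Ideal (𝓞 L)), P.IsPrime → P.LiesOver p.asIdeal →
        ∃ π : Equiv.Perm (Fin (k + 4)),
          (MulAction.stabilizer Gal(L/K) P).map (rootPerm h hθ) =
            (klein hn).map (MulAut.conj π).toMonoidHom ∧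
          (P.inertia Gal(L/K)).map (rootPerm h hθ) =
            (kleinInertia hn).map (MulAut.conj π).toMonoidHom := by
  have hpmax := p.isMaximal
  have hfin : Finite (𝓞 K ⧸ p.asIdeal) := Ring.HasFiniteQuotients.finiteQuotient p.ne_bot
  obtain ⟨c, hirr⟩ : ∃ c : 𝓞 K, Irreducible (X ^ 2 - X + C (Ideal.Quotient.mk p.asIdeal c)) := by
    let _ : Field (𝓞 K ⧸ p.asIdeal) := Ideal.Quotient.field p.asIdeal
    obtain ⟨c, hc⟩ := exists_irreducible_X_sq_sub (k := 𝓞 K ⧸ p.asIdeal)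
    obtain ⟨c, rfl⟩ := Ideal.Quotient.mk_surjective c
    exact ⟨c, hc⟩
  obtain ⟨b, hb⟩ := p.intValuation_exists_uniformizer
  have hbK : p.valuation K (b : K) = WithZero.exp (-1 : ℤ) := by
    rw [← hb]; exact p.valuation_of_algebraMap b
  have hbp : b ∈ p.asIdeal := by
    have := (p.intValuation_le_pow_iff_mem b 1).1 (by rw [hb]; simp)
    simpa using this
  have hb0 : (b : K) ≠ 0 := by
    intro h
    rw [h, map_zero] at hbK
    exact WithZero.exp_ne_zero hbK.symm
  set a : 𝓞 K := 1 - 4 * c with ha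
  have hap : a ∉ p.asIdeal := one_sub_four_mul_notMem hirr
  have ha0 : (a : K) ≠ 0 := by
    intro h
    have : a = 0 := RingOfIntegers.ext h
    exact hap (this ▸ zero_mem _)
  have ha1 : (a : K) ≠ 1 := by
    intro h
    have h1 : a = 1 := RingOfIntegers.ext h
    have h2 : c = 0 := by
      have : (4 : 𝓞 K) * c = 0 := by linear_combination ha - h1
      exact (mul_eq_zero.1 this).resolve_left (by norm_num)
    have h3 := degree_eq_one_of_irreducible_of_root hirr (x := 0) (by simp [IsRoot.def, h2])
    have h4 : (X ^ 2 - X + C (Ideal.Quotient.mk p.asIdeal c)).degree = 2 := by compute_degree!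
    rw [h4] at h3
    norm_num at h3
  have hab : (b : K) ≠ a := fun h => hap ((RingOfIntegers.ext h : b = a) ▸ hbp)
  have hb1 : (b : K) ≠ 1 := by
    intro h
    have : b = 1 := RingOfIntegers.ext h
    exact hpmax.ne_top ((Ideal.eq_top_iff_one _).2 (this ▸ hbp))
  have hγ : Function.Injective ![(b : K), a, 1] := by
    intro i j hij
    fin_cases i <;> fin_cases j <;> first
      | rfl
      | exact absurd hij hab
      | exact absurd hij.symm hab
      | exact absurd hij hb1
      | exact absurd hij.symm hb1
      | exact absurd hij ha1
      | exact absurd hij.symm ha1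
  have hq0 : quarticOf (∏ i, (X - C (![(b : K), a, 1] i))) (0 : K) ≠ 0 := by
    have h1 := (squareDisc_prod hγ).quarticOf (s := 0) (by
      rw [(prod_three_coeff _).1]
      simp [ha0, hb0])
    exact h1.monic.ne_zero
  -- The further roots are consecutive integers starting beyond every natural root of the quartic,
  -- so the target is separable in each degree.
  obtain ⟨N, hN⟩ := exists_natCast_eval_ne_zero hq0
  let e : ℕ → K := fun j => ((N + j : ℕ) : K)
  let d : Target K := ⟨![(b : K), a, 1], 0, e⟩
  have hdisc : SquareDisc (k + 4) (d.poly k) := by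
    refine squareDisc_poly hγ (fun i => ?_) (fun i j hij => ?_) hN k
    · change ![(b : K), a, 1] i ≠ 0
      fin_cases i <;> simp [ha0, hb0]
    · have := Nat.cast_injective (R := K) hij
      omega
  obtain ⟨θ₀, hθ₀, h₀, δ₀, hδ₀⟩ := id hdisc
  have hδ0 : δ₀ ≠ 0 := by
    rintro rfl
    rw [map_zero] at hδ₀
    exact vandermonde_det_ne_zero hθ₀ hδ₀.symm
  refine ⟨d, placeAbs (Sum.inl p) δ₀ ^ (k + 4), pow_pos ((placeAbs (Sum.inl p)).pos hδ0) _,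
    fun f hf L _ _ _ _ θ h hθ P hP hPp => ?_⟩
  have hPne : P ≠ ⊥ := Ideal.ne_bot_of_liesOver_of_ne_bot p.ne_bot P
  have hPmax : P.IsMaximal := hP.isMaximal hPne
  obtain ⟨E, _, _, _, _, _, _, α, β, hα, hβ⟩ :=
    exists_galois_extension_with_sqrt (L := L) (a : K) (b : K)
  obtain ⟨Q, hQmax, hQP⟩ := Ideal.exists_maximal_ideal_liesOver_of_isIntegral (S := 𝓞 E) P
  have hQp : Q.LiesOver p.asIdeal := Ideal.LiesOver.trans Q P p.asIdeal
  let w : HeightOneSpectrum (𝓞 E) := ⟨Q, hQmax.isPrime,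
    Ideal.ne_bot_of_liesOver_of_ne_bot p.ne_bot Q⟩
  have hwP : w.asIdeal.LiesOver P := hQP
  have hwp : w.asIdeal.LiesOver p.asIdeal := hQp
  set r : Fin (k + 4) → E := fun i => kleinRoot α β (fun j => algebraMap K E (e j)) i with hr
  have ht : (d.poly k).map (algebraMap K E) = ∏ i, (X - C (r i)) :=
    map_poly_eq_prod_kleinRoot hα hβ e k
  obtain ⟨δ, hδ⟩ := hdisc.det_mem_range ht
  have hrinj : Function.Injective r := injective_of_separable ht hdisc.separable
  have hδδ : placeAbs (Sum.inl p) δ = placeAbs (Sum.inl p) δ₀ := by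
    have h1 := SquareDisc.det_sq_eq h₀ hδ₀ ht hrinj hδ
    have h2 := congrArg (placeAbs (Sum.inl p)) h1
    rw [map_pow, map_pow] at h2
    exact (pow_left_inj₀ ((placeAbs _).nonneg _) ((placeAbs _).nonneg _) two_ne_zero).1 h2
  have hθE : f.map (algebraMap K E) = ∏ i, (X - C (algebraMap L E (θ i))) := by
    rw [IsScalarTower.algebraMap_eq K L E, ← Polynomial.map_map, h, map_prod_X_sub_C]
  have hval : ∀ (x : E) (y : 𝓞 K), x ^ 2 = algebraMap K E (y : K) → w.valuation E x ≤ 1 := by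
    intro x y hx
    have h1 : w.valuation E (x ^ 2) ≤ 1 := by
      rw [hx]
      exact w.valuation_le_one (algebraMap (𝓞 K) (𝓞 E) y)
    rw [map_pow] at h1
    exact (pow_le_one_iff_of_nonneg zero_le two_ne_zero).1 h1
  have hvα := hval α a hα
  have hvβ := hval β b hβ
  have hint : ∀ i, w.valuation E (r i) ≤ 1 := by
    intro i
    have hA : α ∈ (w.valuation E).valuationSubring := hvα
    have hB : β ∈ (w.valuation E).valuationSubring := hvβ
    have hAB := mul_mem hA hB
    have hQ : ∀ j, quarticRoot 0 ![α, β, α * β] j ∈ (w.valuation E).valuationSubring := by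
      intro j
      have h0 := zero_mem (w.valuation E).valuationSubring
      fin_cases j
      · exact add_mem (add_mem (add_mem h0 hA) hB) hAB
      · exact sub_mem (sub_mem (add_mem h0 hA) hB) hAB
      · exact sub_mem (add_mem (sub_mem h0 hA) hB) hAB
      · exact add_mem (sub_mem (sub_mem h0 hA) hB) hAB
    change r i ∈ (w.valuation E).valuationSubring
    simp only [hr, kleinRoot]
    split_ifs
    · exact hQ _
    · simp only [e, map_natCast]
      exact natCast_mem _ _
  obtain ⟨π, hπ⟩ := exists_perm_of_near_finite (q := p) (w := w) hθE ht hint hδ (fun i => by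
    rw [← map_pow, ← not_le, ← placeAbs_finite_le_iff, not_le, map_pow, hδδ]
    exact (coeff_le_polyNorm _ _ i).trans_lt hf)
  refine ⟨π, map_rootPerm_eq (w := w) hirr hbK hα hβ hn h hθ (e := e) ?_⟩
  intro τ hτ σ hτσ ρ hρ
  refine perm_eq_of_near (P := fun x => w.valuation E x < w.valuation E (algebraMap K E δ)) 
    (θ := fun i => algebraMap L E (θ i)) (c := r) hπ (σ := (τ : E →+* E)) (fun x hx => ?_) 
    (fun i => ?_) hρ
  · change w.valuation E (τ x) < _
    rwa [valuation_smul_of_mem_stabilizer hτ]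
  · change τ _ = _
    rw [hτσ, rootPerm_spec h hθ]

end KleinTarget
end AnLocal

namespace AnLocal
open Polynomial IsDedekindDomain IntermediateField

/-! ### The Galois group of an approximating polynomial -/

section GaloisGroup

variable {K L : Type*} [Field K] [NumberField K] [Field L] [NumberField L] [Algebra K L]
  [IsGalois K L]

lemma HasCycleAt.hasTransitiveSupport {n : ℕ} {f : K[X]} {θ : Fin n → L}
    (h : f.map (algebraMap K L) = ∏ i, (X - C (θ i))) (hθ : Function.Injective θ)
    {q : HeightOneSpectrum (𝓞 K)} {k : ℕ} (hc : HasCycleAt k f q) :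
    HasTransitiveSupport (rootPerm h hθ).range k := by
  have hqm := q.isMaximal
  obtain ⟨Q, hQm, hQq⟩ := Ideal.exists_maximal_ideal_liesOver_of_isIntegral (S := 𝓞 L) q.asIdeal
  obtain ⟨s, hs, h1, h2⟩ := hc.exists_finset h hθ Q
  refine ⟨s, hs, fun i hi j hj => ?_⟩
  obtain ⟨σ, hσ, hij⟩ := h1 i hi j hj
  exact ⟨_, ⟨σ, rfl⟩, hij, h2 σ hσ⟩

lemma HasCycleAt.exists_stabilizer_ne_bot {n : ℕ} {f : K[X]} {θ : Fin n → L}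
    (h : f.map (algebraMap K L) = ∏ i, (X - C (θ i))) (hθ : Function.Injective θ)
    {q : HeightOneSpectrum (𝓞 K)} {k : ℕ} (hk : 1 < k) (hc : HasCycleAt k f q) :
    ∃ Q : Ideal (𝓞 L), Q.IsPrime ∧ Q.LiesOver q.asIdeal ∧
      MulAction.stabilizer Gal(L/K) Q ≠ ⊥ := by
  have hqm := q.isMaximal
  obtain ⟨Q, hQm, hQq⟩ := Ideal.exists_maximal_ideal_liesOver_of_isIntegral (S := 𝓞 L) q.asIdeal
  obtain ⟨s, hs, h1, h2⟩ := hc.exists_finset h hθ Q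
  refine ⟨Q, hQm.isPrime, hQq, fun hbot => ?_⟩
  obtain ⟨i, hi, j, hj, hij⟩ := Finset.one_lt_card.1 (hs ▸ hk)
  obtain ⟨σ, hσ, hσij⟩ := h1 i hi j hj
  rw [hbot, Subgroup.mem_bot] at hσ
  rw [hσ, map_one] at hσij
  exact hij hσij

lemma IsAlternating.range_rootPerm {k : ℕ} {S : Finset (Place K)} {M : ℕ} {f : K[X]}
    (hf : IsAlternating k S M f) {θ : Fin (k + 4) → L}
    (h : f.map (algebraMap K L) = ∏ i, (X - C (θ i))) (hθ : Function.Injective θ)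
    (hfix : k = 0 → ∀ i, ∃ σ, rootPerm h hθ σ i ≠ i) :
    (rootPerm h hθ).range = alternatingGroup (Fin (k + 4)) := by
  have hev : Even (k + 4) ↔ Even k := by rw [Nat.even_add]; simp [show Even 4 by decide]
  have hod : Odd (k + 4) ↔ Odd k := by rw [← Nat.not_even_iff_odd, ← Nat.not_even_iff_odd, hev]
  refine eq_alternatingGroup (by omega) ?_ ?_ (fun hk => ⟨?_, fun i => ?_⟩) fun hk => ⟨?_, ?_⟩
  · rintro _ ⟨σ, rfl⟩
    exact rootPerm_mem_alternatingGroup hf.squareDisc h hθ σ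
  · obtain ⟨q, -, hq⟩ := hf.three
    exact hq.hasTransitiveSupport h hθ
  · obtain ⟨q, -, hq⟩ := hf.even (hev.1 hk)
    exact hq.hasTransitiveSupport h hθ
  · by_cases hk0 : k = 0
    · obtain ⟨σ, hσ⟩ := hfix hk0 i
      exact ⟨_, ⟨σ, rfl⟩, hσ⟩
    · by_contra! hcon
      have h1 : θ i ∈ Set.range (algebraMap K L) := by
        rw [IsGalois.mem_range_algebraMap_iff_fixed]
        intro σ
        rw [rootPerm_spec h hθ, hcon _ ⟨σ, rfl⟩]
      obtain ⟨x, hx⟩ := h1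
      have h2 := (aeval_eq_zero_iff h (θ i)).2 ⟨i, rfl⟩
      rw [← hx, aeval_algebraMap_apply, coe_aeval_eq_eval] at h2
      exact hf.eval_ne_zero (hev.1 hk) hk0 x ((algebraMap K L).injective (h2.trans (map_zero _).symm))
  · obtain ⟨q, -, hq⟩ := hf.full (hod.1 hk)
    exact hq.hasTransitiveSupport h hθ
  · obtain ⟨q, -, hq⟩ := hf.odd (hod.1 hk)
    exact hq.hasTransitiveSupport h hθ

omit [NumberField K] [NumberField L] [IsGalois K L] in
-- Transitivity makes every root of `f` a root of the minimal polynomial of one of them, and the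
-- roots are distinct.
lemma minpoly_eq_of_transitive {n : ℕ} {f : K[X]} {θ : Fin n → L}
    (h : f.map (algebraMap K L) = ∏ i, (X - C (θ i))) (hθ : Function.Injective θ)
    (ht : ∀ i j, ∃ σ, rootPerm h hθ σ i = j) (i : Fin n) : minpoly K (θ i) = f := by
  have hf := monic_of_map_eq_prod h
  have hroot : aeval (θ i) f = 0 := (aeval_eq_zero_iff h _).2 ⟨i, rfl⟩
  have hint : IsIntegral K (θ i) := ⟨f, hf, hroot⟩
  refine (eq_of_monic_of_dvd_of_natDegree_le (minpoly.monic hint) hf (minpoly.dvd K _ hroot) ?_).symm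
  have hd : (∏ j, (X - C (θ j))) ∣ (minpoly K (θ i)).map (algebraMap K L) := by
    refine Finset.prod_dvd_of_coprime (fun j _ l _ hjl => ?_) fun j _ => ?_
    · exact pairwise_coprime_X_sub_C hθ hjl
    · obtain ⟨σ, hσ⟩ := ht i j
      rw [dvd_iff_isRoot, IsRoot.def, ← hσ, ← rootPerm_spec h hθ, eval_map_algebraMap]
      change aeval ((σ : L →ₐ[K] L) (θ i)) _ = 0
      rw [aeval_algHom_apply, minpoly.aeval, map_zero]
  have h1 := natDegree_le_of_dvd hd ((minpoly.monic hint).map _).ne_zero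
  rwa [← h, natDegree_map, natDegree_map] at h1

omit [NumberField K] [NumberField L] [IsGalois K L] in
lemma rootPerm_transitive {n : ℕ} (hn : 3 ≤ n) {f : K[X]} {θ : Fin n → L}
    (h : f.map (algebraMap K L) = ∏ i, (X - C (θ i))) (hθ : Function.Injective θ)
    (hr : (rootPerm h hθ).range = alternatingGroup (Fin n)) (i j : Fin n) :
    ∃ σ, rootPerm h hθ σ i = j := by
  have := alternatingGroup.isPretransitive_of_three_le_card (Fin n) (by simpa using hn)
  obtain ⟨⟨g, hg⟩, hgij⟩ := MulAction.exists_smul_eq (alternatingGroup (Fin n)) i j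
  rw [← hr] at hg
  obtain ⟨σ, rfl⟩ := hg
  exact ⟨σ, hgij⟩

end GaloisGroup

/-! ### Embeddings as conjugates of a primitive element -/

section Conjugates

variable {K F L : Type*} [Field K] [Field F] [Field L] [Algebra K F] [Algebra K L]

/-- Numbering the conjugates of a primitive element. -/
lemma exists_equiv_fin {n : ℕ} {f : K[X]} {θ : Fin n → L}
    (h : f.map (algebraMap K L) = ∏ i, (X - C (θ i))) (hθ : Function.Injective θ)
    {x : F} (hx : minpoly K x = f) (htop : K⟮x⟯ = ⊤) :
    ∃ e : (F →ₐ[K] L) ≃ Fin n, permRep e = rootPerm h hθ := by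
  have hf := monic_of_map_eq_prod h
  have hxf : aeval x f = 0 := hx ▸ minpoly.aeval K x
  have hint : IsIntegral K x := ⟨f, hf, hxf⟩
  have hex : ∀ φ : F →ₐ[K] L, ∃ i, φ x = θ i := fun φ =>
    (aeval_eq_zero_iff h _).1 (by rw [aeval_algHom_apply, hxf, map_zero])
  choose e he using hex
  have hinj : Function.Injective e := fun φ ψ hφψ => by
    have h1 : φ x = ψ x := by rw [he, he, hφψ]
    have h2 : Algebra.adjoin K {x} = ⊤ := by
      rw [← adjoin_simple_toSubalgebra_of_isAlgebraic hint.isAlgebraic, htop, top_toSubalgebra]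
    exact AlgHom.ext_of_adjoin_eq_top h2 (by rintro y rfl; exact h1)
  have hsurj : Function.Surjective e := fun i => by
    have hroot : aeval (θ i) (minpoly K x) = 0 := hx ▸ (aeval_eq_zero_iff h _).2 ⟨i, rfl⟩
    let φ₀ : K⟮x⟯ →ₐ[K] L := (algHomAdjoinIntegralEquiv K hint).symm ⟨θ i, by
      rw [mem_aroots]; exact ⟨minpoly.ne_zero hint, hroot⟩⟩
    let ψ : F →ₐ[K] K⟮x⟯ := ((equivOfEq htop).trans topEquiv).symm
    refine ⟨φ₀.comp ψ, hθ ?_⟩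
    rw [← he]
    have h1 : ψ x = AdjoinSimple.gen K x := Subtype.ext rfl
    change φ₀ (ψ x) = _
    rw [h1]
    exact algHomAdjoinIntegralEquiv_symm_apply_gen K hint _
  let e' := Equiv.ofBijective e ⟨hinj, hsurj⟩
  refine ⟨e', ?_⟩
  ext σ i
  congr 1
  symm
  rw [rootPerm_eq_iff]
  obtain ⟨φ, rfl⟩ := e'.surjective i
  have h1 : permRep e' σ (e' φ) = e' ((σ : L →ₐ[K] L).comp φ) := by
    change e' (embeddingPerm K F L σ (e'.symm (e' φ))) = _
    rw [Equiv.symm_apply_apply]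
    rfl
  rw [h1]
  change σ (θ (e φ)) = θ (e _)
  rw [← he, ← he]
  rfl

end Conjugates
end AnLocal

namespace AnLocal
open Polynomial IsDedekindDomain IntermediateField

/-! ### The field generated by one root -/

section RootField

variable {K : Type*} [Field K] [NumberField K]

instance numberField_galoisClosure (F : IntermediateField K (AlgebraicClosure K))
    [FiniteDimensional K F] : NumberField (galoisClosure F) :=
  have : FiniteDimensional ℚ (galoisClosure F) := FiniteDimensional.trans ℚ K _
  ⟨⟩

instance isGalois_galoisClosure (F : IntermediateField K (AlgebraicClosure K)) :
    IsGalois K (galoisClosure F) := ⟨⟩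

omit [NumberField K] in
lemma map_eq_prod_of_mem {n : ℕ} {f : K[X]} {θ : Fin n → AlgebraicClosure K}
    (h : f.map (algebraMap K (AlgebraicClosure K)) = ∏ i, (X - C (θ i)))
    {N : IntermediateField K (AlgebraicClosure K)} (hN : ∀ i, θ i ∈ N) :
    f.map (algebraMap K N) = ∏ i, (X - C (⟨θ i, hN i⟩ : N)) := by
  apply Polynomial.map_injective (algebraMap N (AlgebraicClosure K)) (algebraMap N _).injective
  rw [Polynomial.map_map, ← IsScalarTower.algebraMap_eq, h, map_prod_X_sub_C]
  rfl

/-- `F` is generated by a root of `f`, whose conjugates `θ` are numbered by `e`; the Galois group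
of `f` is the alternating group. -/
structure IsRootField {n : ℕ} (f : K[X]) (F : IntermediateField K (AlgebraicClosure K))
    (θ : Fin n → galoisClosure F) (e : (F →ₐ[K] galoisClosure F) ≃ Fin n) : Prop where
  map_eq : f.map (algebraMap K (galoisClosure F)) = ∏ i, (X - C (θ i))
  injective : Function.Injective θ
  adjoin_eq_top : Algebra.adjoin K (Set.range θ) = ⊤
  permRep_eq : permRep e = rootPerm map_eq injective
  identifies : IdentifiesWithAn e
  finrank_eq : finrank K F = n
  exists_generator : ∃ x : F, aeval x f = 0 ∧ Algebra.adjoin K {x} = ⊤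

lemma IsAlternating.exists_isRootField {k : ℕ} {S : Finset (Place K)} {M : ℕ} {f : K[X]}
    (hf : IsAlternating k S M f)
    (hfix : ∀ (F : IntermediateField K (AlgebraicClosure K)) [FiniteDimensional K F]
      {θ : Fin (k + 4) → galoisClosure F}
      (h : f.map (algebraMap K (galoisClosure F)) = ∏ i, (X - C (θ i)))
      (hθ : Function.Injective θ), k = 0 → ∀ i, ∃ σ, rootPerm h hθ σ i ≠ i) :
    ∃ (F : IntermediateField K (AlgebraicClosure K)) (θ : Fin (k + 4) → galoisClosure F)
      (e : (F →ₐ[K] galoisClosure F) ≃ Fin (k + 4)), IsRootField f F θ e := by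
  obtain ⟨θ₀, hθ₀, h₀, -⟩ := id hf.squareDisc
  have hfm := hf.squareDisc.monic
  have hroot₀ : ∀ i, aeval (θ₀ i) f = 0 := fun i => (aeval_eq_zero_iff h₀ _).2 ⟨i, rfl⟩
  have hint₀ : ∀ i, IsIntegral K (θ₀ i) := fun i => ⟨f, hfm, hroot₀ i⟩
  -- Irreducibility is not yet known, so the Galois group is first computed in the normal closure of
  -- the field generated by all roots. Its transitivity gives the minimal polynomial, after which
  -- all roots lie in the Galois closure of the field of one root.
  have hmin : minpoly K (θ₀ 0) = f := by
    let N := IntermediateField.adjoin K (Set.range θ₀)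
    have hfin : FiniteDimensional K N := finiteDimensional_adjoin (by
      rintro _ ⟨i, rfl⟩; exact hint₀ i)
    have hN : ∀ i, θ₀ i ∈ galoisClosure N := fun i =>
      le_normalClosure N (subset_adjoin K _ ⟨i, rfl⟩)
    have h := map_eq_prod_of_mem h₀ hN
    have hθ : Function.Injective fun i => (⟨θ₀ i, hN i⟩ : galoisClosure N) := fun i j hij =>
      hθ₀ (congrArg Subtype.val hij)
    have hr := hf.range_rootPerm h hθ (hfix N h hθ)
    have := minpoly_eq_of_transitive h hθ (rootPerm_transitive (by omega) h hθ hr) 0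
    rw [← this]
    exact (minpoly.algebraMap_eq (B := galoisClosure N) (B' := AlgebraicClosure K)
      Subtype.val_injective ⟨θ₀ 0, hN 0⟩)
  let F : IntermediateField K (AlgebraicClosure K) := K⟮θ₀ 0⟯
  have hfin : FiniteDimensional K F := adjoin.finiteDimensional (hint₀ 0)
  let x : F := AdjoinSimple.gen K (θ₀ 0)
  have hx : minpoly K x = f := by
    rw [← hmin]
    exact (minpoly.algebraMap_eq (B := F) (B' := AlgebraicClosure K) Subtype.val_injective x).symm
  have hxint : IsIntegral K x := Algebra.IsIntegral.isIntegral x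
  have hxtop : K⟮x⟯ = ⊤ := by
    apply IntermediateField.map_injective F.val
    rw [adjoin_map, Set.image_singleton, ← AlgHom.fieldRange_eq_map, fieldRange_val]
    rfl
  have hxtop' : Algebra.adjoin K {x} = ⊤ := by
    rw [← adjoin_simple_toSubalgebra_of_isAlgebraic hxint.isAlgebraic, hxtop, top_toSubalgebra]
  have hmem : ∀ i, θ₀ i ∈ galoisClosure F := by
    intro i
    let φ : F →ₐ[K] AlgebraicClosure K := (algHomAdjoinIntegralEquiv K (hint₀ 0)).symm ⟨θ₀ i, by
      rw [mem_aroots, hmin]; exact ⟨hfm.ne_zero, hroot₀ i⟩⟩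
    have h1 : φ x = θ₀ i := algHomAdjoinIntegralEquiv_symm_apply_gen K (hint₀ 0) _
    exact AlgHom.fieldRange_le_normalClosure φ ⟨x, h1⟩
  have h := map_eq_prod_of_mem h₀ hmem
  have hθ : Function.Injective fun i => (⟨θ₀ i, hmem i⟩ : galoisClosure F) := fun i j hij =>
    hθ₀ (congrArg Subtype.val hij)
  have hr := hf.range_rootPerm h hθ (hfix F h hθ)
  obtain ⟨e, he⟩ := exists_equiv_fin h hθ hx hxtop
  refine ⟨F, _, e, h, hθ, ?_, he, ?_, ?_, x, hx ▸ minpoly.aeval K x, hxtop'⟩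
  · rw [← adjoin_toSubalgebra, ← top_toSubalgebra]
    congr 1
    apply IntermediateField.map_injective (galoisClosure F).val
    rw [adjoin_map, ← AlgHom.fieldRange_eq_map, fieldRange_val, ← Set.range_comp]
    refine le_antisymm ?_ ?_
    · rw [adjoin_le_iff]
      rintro _ ⟨i, rfl⟩
      exact hmem i
    · refine normalClosure_le_iff.2 fun φ => ?_
      rw [AlgHom.fieldRange_eq_map, ← hxtop, adjoin_map, Set.image_singleton, adjoin_simple_le_iff]
      obtain ⟨i, hi⟩ := (aeval_eq_zero_iff h₀ (φ x)).1 (by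
        rw [aeval_algHom_apply, ← hx, minpoly.aeval, map_zero])
      rw [hi]
      exact subset_adjoin K _ ⟨i, rfl⟩
  · rw [IdentifiesWithAn, he, hr]
  · rw [adjoin.finrank (hint₀ 0), hmin, hf.squareDisc.natDegree]

variable {n : ℕ} {f : K[X]} {F : IntermediateField K (AlgebraicClosure K)}
    {θ : Fin n → galoisClosure F} {e : (F →ₐ[K] galoisClosure F) ≃ Fin n}

omit [NumberField K] in
lemma galoisClosure_eq_of_algEquiv {F F' : IntermediateField K (AlgebraicClosure K)}
    (e : F ≃ₐ[K] F') : galoisClosure F = galoisClosure F' := by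
  have key : ∀ {F F' : IntermediateField K (AlgebraicClosure K)}, (F ≃ₐ[K] F') →
      galoisClosure F ≤ galoisClosure F' := by
    intro F F' e
    refine normalClosure_le_iff.2 fun φ => ?_
    rintro _ ⟨x, rfl⟩
    exact AlgHom.fieldRange_le_normalClosure (φ.comp (e.symm : F' →ₐ[K] F)) ⟨e x, by simp⟩
  exact le_antisymm (key e) (key e.symm)

end RootField

end AnLocal

namespace AnLocal
open Polynomial IsDedekindDomain IntermediateField

/-! ### Splitting conditions and infinitely many fields -/

section Family

universe v

variable {K : Type v} [Field K] [NumberField K]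

/-- All decomposition groups above `q` in the Galois closure of `F` are trivial. -/
def HasTrivialDecomposition (q : HeightOneSpectrum (𝓞 K))
    (F : IntermediateField K (AlgebraicClosure K)) : Prop :=
  ∀ Q : Ideal (𝓞 (galoisClosure F)), Q.IsPrime → Q.LiesOver q.asIdeal →
    MulAction.stabilizer Gal(galoisClosure F/K) Q = ⊥

omit [NumberField K] in
lemma hasTrivialDecomposition_iff {q : HeightOneSpectrum (𝓞 K)}
    {F F' : IntermediateField K (AlgebraicClosure K)} (e : F ≃ₐ[K] F') :
    HasTrivialDecomposition q F ↔ HasTrivialDecomposition q F' := by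
  have key : ∀ {L L' : IntermediateField K (AlgebraicClosure K)}, L = L' →
      ((∀ Q : Ideal (𝓞 L), Q.IsPrime → Q.LiesOver q.asIdeal →
        MulAction.stabilizer Gal(L/K) Q = ⊥) ↔
      (∀ Q : Ideal (𝓞 L'), Q.IsPrime → Q.LiesOver q.asIdeal →
        MulAction.stabilizer Gal(L'/K) Q = ⊥)) := by
    rintro L _ rfl
    rfl
  exact key (galoisClosure_eq_of_algEquiv e)

/-- A totally split local condition. -/
lemma exists_split_target (k : ℕ) : ∃ d : Target K, ∀ v : Place K, ∃ ε > 0, ∀ f : K[X],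
    polyNorm (placeAbs v) (f - d.poly k) < ε →
    ∀ {F : IntermediateField K (AlgebraicClosure K)} {θ : Fin (k + 4) → galoisClosure F}
      {e : (F →ₐ[K] galoisClosure F) ≃ Fin (k + 4)}, IsRootField f F θ e →
      SplitsCompletely F v ∧ ∀ q, v = finitePlace q → HasTrivialDecomposition q F := by
  -- The integers `0, 1, 2, 4, 5, …`. The value `3` is skipped because `0 - 1 - 2 + 3 = 0` would
  -- make one of the square roots of the quartic vanish.
  let c : ℕ → ℤ := fun i => if i < 3 then i else i + 1
  have hc : Function.Injective c := by
    intro i j hij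
    simp only [c] at hij
    split_ifs at hij <;> omega
  obtain ⟨d, hd⟩ := exists_target (K := K) (fun i => (c i : K)) k (by norm_num [c])
    (by norm_num [c]) (by norm_num [c])
  have hd' : d.poly k = ∏ i : Fin (k + 4), (X - C ((c i : ℤ) : K)) := by
    rw [hd, ← Fin.prod_univ_eq_prod_range (fun i => X - C ((c i : ℤ) : K))]
  have hcF : Function.Injective fun i : Fin (k + 4) => c i := hc.comp Fin.val_injective
  refine ⟨d, fun v => ?_⟩
  rw [hd']
  rcases v with q | v
  · obtain ⟨ε, hε, h⟩ := exists_eps_rootPerm_eq_one.{v, v} q hcF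
    refine ⟨ε, hε, fun f hf F θ e hF => ?_⟩
    have hfin : FiniteDimensional K F := FiniteDimensional.of_finrank_pos (by
      rw [hF.finrank_eq]; omega)
    have hnf : NumberField F := NumberField.of_module_finite K F
    have htriv : HasTrivialDecomposition q F :=
      stabilizer_eq_bot hF.map_eq hF.injective hF.adjoin_eq_top fun w _ σ hσ =>
        h f hf w hF.map_eq hF.injective σ hσ
    refine ⟨?_, fun q' hq' => ?_⟩
    · exact ncard_primesOver_of_stabilizer_eq_bot (L := galoisClosure F) q htriv
    · cases hq'
      exact htriv
  · obtain ⟨ε, hε, h⟩ := exists_eps_conj_eq v hcF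
    refine ⟨ε, hε, fun f hf F θ e hF => ⟨?_, fun q hq => by cases hq⟩⟩
    have hfin : FiniteDimensional K F := FiniteDimensional.of_finrank_pos (by
      rw [hF.finrank_eq]; omega)
    have hnf : NumberField F := NumberField.of_module_finite K F
    obtain ⟨x, hx, htop⟩ := hF.exists_generator
    exact ncard_comap_eq v fun hv => isReal_of_root hx htop
      (h f (monic_of_map_eq_prod hF.map_eq) (natDegree_of_map_eq_prod hF.map_eq) hf hv) hv

/-- The prime `q` is the witness of the 3-cycle: its nontrivial decomposition group distinguishes
`F` from fields in which `q` is put into the split set. That `q ≠ p` allows this in later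
constructions. -/
lemma exists_extension {k : ℕ} (hn : 4 ≤ k + 4) (S : Finset (Place K))
    (p : HeightOneSpectrum (𝓞 K)) (hp : finitePlace p ∉ S) :
    ∃ (F : IntermediateField K (AlgebraicClosure K)) (q : HeightOneSpectrum (𝓞 K)),
      IsAnExtensionWithKleinAt hn p F ∧ (∀ v ∈ S, SplitsCompletely F v) ∧
      (∀ q, finitePlace q ∈ S → HasTrivialDecomposition q F) ∧
      q ≠ p ∧ ¬ HasTrivialDecomposition q F := by
  classical
  obtain ⟨d, hd⟩ := exists_split_target (K := K) k
  obtain ⟨dp, εp, hεp, hdp⟩ := exists_klein_target.{v, v} p hn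
  obtain ⟨ε, hε, hS⟩ := exists_uniform_delta S (fun v ε => ∀ f : K[X],
    polyNorm (placeAbs v) (f - d.poly k) < ε →
    ∀ {F : IntermediateField K (AlgebraicClosure K)} {θ : Fin (k + 4) → galoisClosure F}
      {e : (F →ₐ[K] galoisClosure F) ≃ Fin (k + 4)}, IsRootField f F θ e →
      SplitsCompletely F v ∧ ∀ q, v = finitePlace q → HasTrivialDecomposition q F)
    (fun v δ δ' hδ h f hf => h f (hf.trans_le hδ)) (fun v _ => hd v)
  obtain ⟨f, hf, hnear⟩ := reach k (insert (finitePlace p) S)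
    (fun v => if v = finitePlace p then dp else d) (min ε εp) 0 (lt_min hε hεp)
  have hfp : polyNorm (placeAbs (finitePlace p)) (f - dp.poly k) < εp := by
    have := hnear (finitePlace p) (Finset.mem_insert_self _ _)
    rw [if_pos rfl] at this
    exact this.trans_le (min_le_right _ _)
  have hfS : ∀ v ∈ S, polyNorm (placeAbs v) (f - d.poly k) < ε := by
    intro v hv
    have := hnear v (Finset.mem_insert_of_mem hv)
    rw [if_neg (by rintro rfl; exact hp hv)] at this
    exact this.trans_le (min_le_left _ _)
  -- In degree four no Newton polygon excludes rational roots; instead the Klein group at `p`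
  -- already moves each of the four roots.
  obtain ⟨F, θ, e, hF⟩ := hf.exists_isRootField (by
    intro F _ θ h hθ hk i
    subst hk
    have hpm := p.isMaximal
    obtain ⟨Q, hQm, hQp⟩ := Ideal.exists_maximal_ideal_liesOver_of_isIntegral
      (S := 𝓞 (galoisClosure F)) p.asIdeal
    obtain ⟨π, hπ, -⟩ := hdp f hfp h hθ Q hQm.isPrime hQp
    obtain ⟨g, hg, hgi⟩ := exists_klein_apply_ne hn (π⁻¹ i)
    have h1 : π * g * π⁻¹ ∈ (klein hn).map (MulAut.conj π).toMonoidHom := ⟨g, hg, rfl⟩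
    rw [← hπ] at h1
    obtain ⟨σ, -, hσ⟩ := h1
    refine ⟨σ, fun hi => hgi ?_⟩
    rw [hσ] at hi
    have h2 := congrArg (π⁻¹ : Equiv.Perm _) hi
    simpa using h2)
  have hfin : FiniteDimensional K F := FiniteDimensional.of_finrank_pos (by
    rw [hF.finrank_eq]; omega)
  obtain ⟨q, hq, hq3⟩ := hf.three
  refine ⟨F, q, ⟨hF.finrank_eq, e, hF.identifies, fun P hP hPp => ?_⟩,
    fun v hv => (hS v hv f (hfS v hv) hF).1,
    fun q hq => (hS _ hq f (hfS _ hq) hF).2 q rfl, ?_, ?_⟩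
  · obtain ⟨π, h1, h2⟩ := hdp f hfp hF.map_eq hF.injective P hP hPp
    obtain ⟨τ, hτ, h3, h4⟩ := exists_even_conj hn π
    refine ⟨τ, hτ, ?_, ?_⟩
    · rw [hF.permRep_eq, ← h3, ← h1]
      rfl
    · rw [hF.permRep_eq, ← h4, ← h2]
      rfl
  · rintro rfl
    exact hq.1 (Finset.mem_insert_self _ _)
  · intro htriv
    obtain ⟨Q, hQ, hQq, hne⟩ := hq3.exists_stabilizer_ne_bot hF.map_eq hF.injective (by norm_num)
    exact hne (htriv Q hQ hQq)

theorem infinitelyMany_isAnExtensionWithKleinAt {n : ℕ} (hn : 4 ≤ n) (S : Finset (Place K))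
    (p : HeightOneSpectrum (𝓞 K)) (hp : finitePlace p ∉ S) :
    InfinitelyManyExtensions fun F : IntermediateField K (AlgebraicClosure K) =>
      IsAnExtensionWithKleinAt hn p F ∧ ∀ v ∈ S, SplitsCompletely F v := by
  classical
  obtain ⟨k, rfl⟩ : ∃ k, n = k + 4 := ⟨n - 4, by omega⟩
  -- A sequence of fields with their witness primes, each field having trivial decomposition groups
  -- at all earlier witnesses. An isomorphism between two of them would identify their Galois
  -- closures and contradict the witness of the earlier one.
  obtain ⟨A, hA, hA'⟩ := exists_seq_of_forall_finset_exists
    (fun A : IntermediateField K (AlgebraicClosure K) × HeightOneSpectrum (𝓞 K) =>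
      (IsAnExtensionWithKleinAt hn p A.1 ∧ ∀ v ∈ S, SplitsCompletely A.1 v) ∧
        A.2 ≠ p ∧ ¬ HasTrivialDecomposition A.2 A.1)
    (fun A B => HasTrivialDecomposition A.2 B.1) (by
      intro s hs
      obtain ⟨F, q, h1, h2, h3, h4, h5⟩ := exists_extension hn
        (S ∪ s.image fun A => finitePlace A.2) p (by
          rw [Finset.mem_union, Finset.mem_image, not_or]
          refine ⟨hp, ?_⟩
          rintro ⟨A, hA, hAp⟩
          exact (hs A hA).2.1 (Sum.inl_injective hAp))
      exact ⟨(F, q), ⟨⟨h1, fun v hv => h2 v (Finset.mem_union_left _ hv)⟩, h4, h5⟩,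
        fun A hA => h3 _ (Finset.mem_union_right _ (Finset.mem_image_of_mem _ hA))⟩)
  refine ⟨fun i => (A i).1, fun i j hij => ⟨fun e => ?_⟩, fun i => (hA i).1⟩
  rcases lt_or_gt_of_ne hij with h | h
  · exact (hA i).2.2 ((hasTrivialDecomposition_iff e).2 (hA' i j h))
  · exact (hA j).2.2 ((hasTrivialDecomposition_iff e).1 (hA' j i h))

lemma exists_finitePlace_notMem (S : Finset (Place K)) :
    ∃ p : HeightOneSpectrum (𝓞 K), finitePlace p ∉ S := by
  obtain ⟨ℓ, hℓ, -, h⟩ := exists_rational_prime (N := 1) one_ne_zero S 0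
  obtain ⟨q, hq⟩ := exists_prime_above (K := K) hℓ
  exact ⟨q, (h q hq).1⟩

end Family

end AnLocal

theorem lemma4p9 {K : Type*} [Field K] [NumberField K] (S : Set (AnLocal.Place K)) (hS : S.Finite)
    (p₁ : IsDedekindDomain.HeightOneSpectrum (𝓞 K)) (hp₁ : AnLocal.finitePlace p₁ ∈ S)
    (hinf : ∀ v : InfinitePlace K, AnLocal.archPlace v ∈ S \ {AnLocal.finitePlace p₁})
    (n : ℕ) (hn : 4 ≤ n) :
    AnLocal.InfinitelyManyExtensions (fun F₁ : IntermediateField K (AlgebraicClosure K) =>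
      AnLocal.IsAnExtensionWithKleinAt hn p₁ F₁ ∧
        ∀ q ∈ S \ {AnLocal.finitePlace p₁}, AnLocal.SplitsCompletely F₁ q) ∧
    AnLocal.InfinitelyManyExtensions (fun F₂ : IntermediateField K (AlgebraicClosure K) =>
      AnLocal.IsAnExtension n F₂ ∧ ∀ q ∈ S, AnLocal.SplitsCompletely F₂ q) := by
  classical
  constructor
  · obtain ⟨F, hF, hF'⟩ := AnLocal.infinitelyMany_isAnExtensionWithKleinAt hn
      (hS.toFinset.erase (AnLocal.finitePlace p₁)) p₁ (Finset.notMem_erase _ _)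
    refine ⟨F, hF, fun i => ⟨(hF' i).1, fun q hq => (hF' i).2 q ?_⟩⟩
    exact Finset.mem_erase.2 ⟨hq.2, hS.mem_toFinset.2 hq.1⟩
  -- The Klein condition is imposed at a prime outside `S` and then forgotten; all of `S` is left to
  -- split.
  · obtain ⟨p, hp⟩ := AnLocal.exists_finitePlace_notMem hS.toFinset
    obtain ⟨F, hF, hF'⟩ := AnLocal.infinitelyMany_isAnExtensionWithKleinAt hn hS.toFinset p hp
    refine ⟨F, hF, fun i => ⟨?_, fun q hq => (hF' i).2 q (hS.mem_toFinset.2 hq)⟩⟩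
    obtain ⟨hdeg, e, he, -⟩ := (hF' i).1
    exact ⟨hdeg, e, he⟩
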